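/- **Setting.** Let $\delta\in\mathbb R$, $q_0>0$, $|q_\pm|=q_0$, and let $q(x,t)$ be a ($C^6$) solution of the sextic nonlinear Schrödinger equation $$\begin{aligned}&iq_t+\tfrac12q_{xx}+q(|q|^2-q_0^2)+20\delta q(|q|^6-q_0^6)+\delta q_{xxxxxx}+10\delta q^3[(q_x^*)^2+2q^*q^*_{xx}]\\&+\delta q[12q^*q_{xxxx}+8q_xq^*_{xxx}+22|q_{xx}|^2]+\delta q[18q_{xxx}q_x^*+70(q^*)^2q_x^2]+20\delta q_x^2q^*_{xx}\\&+10\delta q_x[5q_{xx}q_x^*+3q^*q_{xxx}]+20\delta q^*q_{xx}^2+\delta[60q^*|q_x|^2+50(q^*)^2q_{xx}+2q^*_{xxxx}]q^2=0\end{aligned}$$ (asterisk = complex conjugate) such that for every $t$: $q(x,t)\to q_\pm$ as $x\to\pm\infty$, and $(1+|x|)\,|q(x,t)-q_\pm|$ is integrable near $\pm\infty$. Put $$k(z)=\tfrac12\Big(z-\frac{q_0^2}z\Big),\quad \lambda(z)=\tfrac12\Big(z+\frac{q_0^2}z\Big),\quad \theta(x,t;z)=\lambda\,[x+(32\delta k^5-16\delta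 q_0^2k^3+12\delta q_0^4k+k)t],$$ $D^\pm=\{z:\pm(|z|^2-q_0^2)\operatorname{Im}z>0\}$, $\Sigma=(\mathbb R\cup\{|z|=q_0\})\setminus\{0,\pm iq_0\}$, $\gamma=1+q_0^2/z^2$, $Y_\pm=\begin{pmatrix}1&-q_\pm^*/z\\ q_\pm/z&1\end{pmatrix}$. The equation is the compatibility condition of the Lax pair $\psi_x=X\psi$, $\psi_t=T\psi$, where $X=\begin{pmatrix}ik&iq^*\\ iq&-ik\end{pmatrix}$, $T=\begin{pmatrix}T_{11}&T_{12}\\T_{21}&-T_{11}\end{pmatrix}$ with $$\begin{aligned} T_{11}={}&32i\delta k^6-16i\delta k^4|q|^2-8\delta k^3(qq_x^*-q^*q_x)+ik^2[1+12\delta|q|^4-4\delta|q_x|^2+4\delta(q^*_{xx}q+q_{xx}q^*)]\\ &+ik[12i\delta|q|^2(q_xq^*-q_x^*q)+2i\delta(q_xq^*_{xx}-q^*_xq_{xx}+q^*q_{xxx}-q^*_{xxx}q)]\\ &+i[-\tfrac12|q|^2-10\delta|q|^6-5\delta(q_x^2(q^*)^2+(q_x^*)^2q^2)-\delta|q_{xx}|^2+\delta(q_xq^*_{xxx}+q^*_xq_{xxx}-q^*q_{xxxx}-qq^*_{xxxx})\\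 &\quad-10\delta|q|^2(q_{xx}q^*+q^*_{xx}q)]+i(\tfrac12q_0^2+10\delta q_0^6),\\ T_{21}={}&32i\delta k^5q-16\delta k^4q_x+ik^3(-16\delta|q|^2q-8\delta q_{xx})+ik^2(-24i\delta|q|^2q_x-4i\delta q_{xxx})\\ &+ik[q+12\delta q^*q_x^2+16\delta|q|^2q_{xx}+4\delta q^2q^*_{xx}+2\delta q_{xxxx}+12\delta|q|^4q+8\delta q|q_x|^2]\\ &+i[\tfrac i2q_x+i\delta q_{xxxxx}+10i\delta(qq_x^*q_{xx}+qq^*_{xx}q_x+|q|^2q_{xxx}+3|q|^4q_x+q_x|q_x|^2+2q^*q_xq_{xx})],\\ T_{12}(k)={}&-\big(T_{21}(k^*)\big)^*. \end{aligned}$$ Let $\psi_\pm(x,t;z)$ be its Jost solutions: $\psi_{-,1},\psi_{+,2}$ (columns, $z\in D^-\cup\Sigma$) and $\psi_{+,1},\psi_{-,2}$ ($z\in D^+\cup\Sigma$) solve both equations with $k=k(z)$, and the columns of $\mu_\pm=\psi_\pm e^{-i\theta\sigma_3}$ tend to those of $Y_\pm$ as $x\to\pm\infty$. The scattering matrix $S=(s_{ij})$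 is given by $\psi_+=\psi_-S$, i.e. $s_{11}=W(\psi_{+,1},\psi_{-,2})/\gamma$, $s_{12}=W(\psi_{+,2},\psi_{-,2})/\gamma$, $s_{21}=W(\psi_{-,1},\psi_{+,1})/\gamma$, $s_{22}=W(\psi_{-,1},\psi_{+,2})/\gamma$ (Wronskians, independent of $x,t$); $\rho=s_{21}/s_{11}$, $\tilde\rho=s_{12}/s_{22}$, and $$G=\begin{pmatrix}0&-\tilde\rho e^{2i\theta}\\ \rho e^{-2i\theta}&\rho\tilde\rho\end{pmatrix}.$$ *Double poles, no reflection.* Let $z_1,\dots,z_N$ be distinct with $\operatorname{Im}z_n>0$, $|z_n|>q_0$. Put $\xi_n=z_n$, $\xi_{N+n}=-q_0^2/z_n^*$ $(n\le N)$, and (a notation, not a conjugate) $\xi^*_k=-q_0^2/\xi_k$. Assume that the zeros of $s_{11}$ in $D^+\cup\Sigma$ are exactly $\xi_1,\dots,\xi_{2N}$, that $s_{11}'(z_n)=0\ne s_{11}''(z_n)$, and that $G\equiv0$ on $\Sigma$. **Statement.** $\psi_{+,1}$, $\psi_{-,2}$ and $s_{11}$ are analytic in $z\in D^+$, $s_{11}''(\xi_n)\neq0$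 for $n=1,\dots,2N$, and there are constants $b_n\ne0$, $d_n$, independent of $x,t$, with $\psi_{+,1}(\xi_n)=b_n\psi_{-,2}(\xi_n)$ and $\psi_{+,1}'(\xi_n)=d_n\psi_{-,2}(\xi_n)+b_n\psi_{-,2}'(\xi_n)$ ($'=\partial_z$). Let $$A_n=\frac{2b_n}{s_{11}''(\xi_n)},\quad B_n=\frac{d_n}{b_n}-\frac{s_{11}'''(\xi_n)}{3s_{11}''(\xi_n)},\quad D_n=B_n-2i\theta'(\xi_n),\quad C_n(w)=\frac{A_ne^{-2i\theta(\xi_n)}}{w-\xi_n}.$$ Then $A_{N+n}=\dfrac{q_0^4q_-}{(z_n^*)^4q_-^*}A_n^*$ and $B_{N+n}=\dfrac{q_0^2}{\xi_{N+n}^2}B_n^*+\dfrac2{\xi_{N+n}}$ for $n\le N$ (here $A_n^*,B_n^*,z_n^*$ are conjugates), and for all $x,t$ the vector $$X_n=\mu_{-,22}(\xi_n),\qquad X_{2N+n}=\mu_{-,22}'(\xi_n)\qquad(1\le n\le2N)$$ solves the $4N\times4N$ linear system $MX=V$, where for $1\le k,n\le 2N$ $$M_{k,n}=C_n(\xi^*_k)\Big(D_n+\frac1{\xi^*_k-\xi_n}\Big)+\delta_{kn}\frac{\xi_k}{q_-^*},\qquad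 M_{k,2N+n}=C_n(\xi_k^*),$$ $$M_{2N+k,n}=\frac{C_n(\xi^*_k)}{\xi^*_k-\xi_n}\Big(D_n+\frac2{\xi^*_k-\xi_n}\Big)-\delta_{kn}\frac{\xi_k^2}{q_0^2q_-^*},\qquad M_{2N+k,2N+n}=\frac{C_n(\xi^*_k)}{\xi^*_k-\xi_n}-\delta_{kn}\frac{\xi_k^3}{q_0^2q_-^*},$$ $$V_k=-\frac{q_-}{\xi^*_k},\qquad V_{2N+k}=-\frac{q_-}{(\xi_k^*)^2}.$$ Moreover $\det M\neq0$, so that by Cramer's rule $X_j=\det M_j^{\rm ext}/\det M$ for $1\le j\le4N$, where $M^{\rm ext}_j$ is $M$ with its $j$-th column replaced by $V$, and the solution is $$q(x,t)=q_-+\sum_{n=1}^{2N}A_ne^{-2i\theta(\xi_n)}\big[\mu_{-,22}'(\xi_n)+D_n\mu_{-,22}(\xi_n)\big]=q_-+\sum_{n=1}^{2N}A_ne^{-2i\theta(\xi_n)}\,\frac{\det M_{2N+n}^{\rm ext}+D_n\det M_n^{\rm ext}}{\det M}.$$ -/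

import Mathlib

open scoped ComplexConjugate
open Complex Filter Topology

namespace SexticNLS

noncomputable section

/-! ### The equation -/

/-- The `j`-th spatial derivative of `q` at `(x, t)`. -/
def dx (q : ℝ → ℝ → ℂ) (x t : ℝ) (j : ℕ) : ℂ :=
  iteratedDeriv j (fun y => q y t) x

/-- The complex conjugate of the `j`-th spatial derivative of `q` at `(x, t)`. -/
def dxc (q : ℝ → ℝ → ℂ) (x t : ℝ) (j : ℕ) : ℂ :=
  conj (dx q x t j)

/-- The spatial part of the sextic nonlinear Schrödinger equation in the frame in which the
boundary values at infinity do not depend on time; `u j` stands for the `j`-th spatial derivative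
of `q` and `v j` for its complex conjugate. -/
def nlsField (δ q₀ : ℝ) (u v : ℕ → ℂ) : ℂ :=
  1 / 2 * u 2 + u 0 * (u 0 * v 0 - q₀ ^ 2)
    + 20 * δ * u 0 * ((u 0 * v 0) ^ 3 - q₀ ^ 6)
    + δ * u 6
    + 10 * δ * u 0 ^ 3 * (v 1 ^ 2 + 2 * v 0 * v 2)
    + δ * u 0 * (12 * v 0 * u 4 + 8 * u 1 * v 3 + 22 * (u 2 * v 2))
    + δ * u 0 * (18 * u 3 * v 1 + 70 * v 0 ^ 2 * u 1 ^ 2)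
    + 20 * δ * u 1 ^ 2 * v 2
    + 10 * δ * u 1 * (5 * u 2 * v 1 + 3 * v 0 * u 3)
    + 20 * δ * v 0 * u 2 ^ 2
    + δ * (60 * v 0 * (u 1 * v 1) + 50 * v 0 ^ 2 * u 2 + 2 * v 4) * u 0 ^ 2

/-- `q` solves the sextic nonlinear Schrödinger equation `i q_t + … = 0`. -/
def SolvesSexticNLS (δ q₀ : ℝ) (q : ℝ → ℝ → ℂ) : Prop :=
  ∀ x t : ℝ, I * deriv (fun s => q x s) t + nlsField δ q₀ (dx q x t) (dxc q x t) = 0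

/-! ### The Lax pair -/

/-- The matrix `X = i k σ₃ + Q`. -/
def laxX (u v : ℕ → ℂ) (k : ℂ) : Matrix (Fin 2) (Fin 2) ℂ :=
  !![I * k, I * v 0; I * u 0, -(I * k)]

/-- The upper left entry of `T`. -/
def laxT11 (δ q₀ : ℝ) (u v : ℕ → ℂ) (k : ℂ) : ℂ :=
  32 * I * δ * k ^ 6
    - 16 * I * δ * k ^ 4 * (u 0 * v 0)
    - 8 * δ * k ^ 3 * (u 0 * v 1 - v 0 * u 1)
    + I * k ^ 2 * (1 + 12 * δ * (u 0 * v 0) ^ 2 - 4 * δ * (u 1 * v 1)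
        + 4 * δ * (v 2 * u 0 + u 2 * v 0))
    + I * k * (12 * I * δ * (u 0 * v 0) * (u 1 * v 0 - v 1 * u 0)
        + 2 * I * δ * (u 1 * v 2 - v 1 * u 2 + v 0 * u 3 - v 3 * u 0))
    + I * (-(1 / 2) * (u 0 * v 0) - 10 * δ * (u 0 * v 0) ^ 3
        - 5 * δ * (u 1 ^ 2 * v 0 ^ 2 + v 1 ^ 2 * u 0 ^ 2) - δ * (u 2 * v 2)
        + δ * (u 1 * v 3 + v 1 * u 3 - v 0 * u 4 - u 0 * v 4)
        - 10 * δ * (u 0 * v 0) * (u 2 * v 0 + v 2 * u 0))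
    + I * (1 / 2 * q₀ ^ 2 + 10 * δ * q₀ ^ 6)

/-- The lower left entry of `T`. -/
def laxT21 (δ : ℝ) (u v : ℕ → ℂ) (k : ℂ) : ℂ :=
  32 * I * δ * k ^ 5 * u 0
    - 16 * δ * k ^ 4 * u 1
    + I * k ^ 3 * (-(16 * δ * (u 0 * v 0) * u 0) - 8 * δ * u 2)
    + I * k ^ 2 * (-(24 * I * δ * (u 0 * v 0) * u 1) - 4 * I * δ * u 3)
    + I * k * (u 0 + 12 * δ * v 0 * u 1 ^ 2 + 16 * δ * (u 0 * v 0) * u 2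
        + 4 * δ * u 0 ^ 2 * v 2 + 2 * δ * u 4 + 12 * δ * (u 0 * v 0) ^ 2 * u 0
        + 8 * δ * u 0 * (u 1 * v 1))
    + I * (I / 2 * u 1 + I * δ * u 5
        + 10 * I * δ * (u 0 * v 1 * u 2 + u 0 * v 2 * u 1 + (u 0 * v 0) * u 3
          + 3 * (u 0 * v 0) ^ 2 * u 1 + u 1 * (u 1 * v 1) + 2 * v 0 * u 1 * u 2))

/-- The upper right entry of `T`. -/
def laxT12 (δ : ℝ) (u v : ℕ → ℂ) (k : ℂ) : ℂ :=
  32 * I * δ * k ^ 5 * v 0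
    + 16 * δ * k ^ 4 * v 1
    + I * k ^ 3 * (-(16 * δ * (u 0 * v 0) * v 0) - 8 * δ * v 2)
    + I * k ^ 2 * (24 * I * δ * (u 0 * v 0) * v 1 + 4 * I * δ * v 3)
    + I * k * (v 0 + 12 * δ * u 0 * v 1 ^ 2 + 16 * δ * (u 0 * v 0) * v 2
        + 4 * δ * v 0 ^ 2 * u 2 + 2 * δ * v 4 + 12 * δ * (u 0 * v 0) ^ 2 * v 0
        + 8 * δ * v 0 * (u 1 * v 1))
    - I * (I / 2 * v 1 + I * δ * v 5
        + 10 * I * δ * (v 0 * u 1 * v 2 + v 0 * u 2 * v 1 + (u 0 * v 0) * v 3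
          + 3 * (u 0 * v 0) ^ 2 * v 1 + v 1 * (u 1 * v 1) + 2 * u 0 * v 1 * v 2))

/-- The trace-free matrix `T` of the time part of the Lax pair. -/
def laxT (δ q₀ : ℝ) (u v : ℕ → ℂ) (k : ℂ) : Matrix (Fin 2) (Fin 2) ℂ :=
  !![laxT11 δ q₀ u v k, laxT12 δ u v k; laxT21 δ u v k, -laxT11 δ q₀ u v k]

/-! ### The uniformization variable -/

/-- `k(z) = (z - q₀² / z) / 2`. -/
def kfun (q₀ : ℝ) (z : ℂ) : ℂ := 1 / 2 * (z - q₀ ^ 2 / z)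

/-- `λ(z) = (z + q₀² / z) / 2`. -/
def lam (q₀ : ℝ) (z : ℂ) : ℂ := 1 / 2 * (z + q₀ ^ 2 / z)

/-- The phase `θ(x, t; z) = λ [x + (32 δ k⁵ - 16 δ q₀² k³ + 12 δ q₀⁴ k + k) t]`. -/
def theta (δ q₀ x t : ℝ) (z : ℂ) : ℂ :=
  lam q₀ z * (x + (32 * δ * kfun q₀ z ^ 5 - 16 * δ * q₀ ^ 2 * kfun q₀ z ^ 3
    + 12 * δ * q₀ ^ 4 * kfun q₀ z + kfun q₀ z) * t)

/-- The region `D⁺`, where `Im λ > 0`. -/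
def DPlus (q₀ : ℝ) : Set ℂ := {z | 0 < (‖z‖ ^ 2 - q₀ ^ 2) * z.im}

/-- The region `D⁻`, where `Im λ < 0`. -/
def DMinus (q₀ : ℝ) : Set ℂ := {z | (‖z‖ ^ 2 - q₀ ^ 2) * z.im < 0}

/-- The contour `Σ`, the union of the real axis and the circle of radius `q₀`, without the
point `0` and the branch points `± i q₀`, at which `det Y± = 0`. -/
def contour (q₀ : ℝ) : Set ℂ :=
  {z | (z.im = 0 ∨ ‖z‖ = q₀) ∧ z ≠ 0 ∧ z ≠ I * q₀ ∧ z ≠ -(I * q₀)}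

/-! ### Jost solutions -/

/-- `Y(z)`, for the boundary value `c` (one of `q₋`, `q₊`). -/
def Ymat (c z : ℂ) : Matrix (Fin 2) (Fin 2) ℂ := !![1, -(conj c / z); c / z, 1]

/-- `γ(z) = det Y±(z)`. -/
def gam (q₀ : ℝ) (z : ℂ) : ℂ := 1 + q₀ ^ 2 / z ^ 2

/-- `μ = ψ exp(- i θ σ₃)`. -/
def mu (δ q₀ : ℝ) (ψ : ℝ → ℝ → ℂ → Matrix (Fin 2) (Fin 2) ℂ) (x t : ℝ) (z : ℂ) :
    Matrix (Fin 2) (Fin 2) ℂ :=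
  ψ x t z * Matrix.diagonal ![exp (-(I * theta δ q₀ x t z)), exp (I * theta δ q₀ x t z)]

/-- On the set `U` of values of `z`, the `j`-th column of `ψ` is a solution of both equations of
the Lax pair of `q`, normalized by `μ ∼ Y` as `x → ±∞` (the filter `l` is `atBot` or `atTop`
and `c` is the corresponding boundary value of `q`). -/
structure IsJostColumn (δ q₀ : ℝ) (q : ℝ → ℝ → ℂ) (U : Set ℂ) (l : Filter ℝ) (c : ℂ)
    (j : Fin 2) (ψ : ℝ → ℝ → ℂ → Matrix (Fin 2) (Fin 2) ℂ) : Prop where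
  lax_x : ∀ x t : ℝ, ∀ z ∈ U, HasDerivAt (fun y => (ψ y t z).col j)
    ((laxX (dx q x t) (dxc q x t) (kfun q₀ z)).mulVec ((ψ x t z).col j)) x
  lax_t : ∀ x t : ℝ, ∀ z ∈ U, HasDerivAt (fun s => (ψ x s z).col j)
    ((laxT δ q₀ (dx q x t) (dxc q x t) (kfun q₀ z)).mulVec ((ψ x t z).col j)) t
  normalized : ∀ t : ℝ, ∀ z ∈ U,
    Tendsto (fun x => (mu δ q₀ ψ x t z).col j) l (𝓝 ((Ymat c z).col j))

/-- `ψp` and `ψm` are the Jost solutions `ψ₊` and `ψ₋`: the columns `ψ₋₁` and `ψ₊₂` for `z` in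
`D⁻ ∪ Σ`, the columns `ψ₊₁` and `ψ₋₂` for `z` in `D⁺ ∪ Σ`. Other values are irrelevant. -/
structure IsJostPair (δ q₀ : ℝ) (q : ℝ → ℝ → ℂ) (qm qp : ℂ)
    (ψm ψp : ℝ → ℝ → ℂ → Matrix (Fin 2) (Fin 2) ℂ) : Prop where
  minus_one : IsJostColumn δ q₀ q (DMinus q₀ ∪ contour q₀) atBot qm 0 ψm
  minus_two : IsJostColumn δ q₀ q (DPlus q₀ ∪ contour q₀) atBot qm 1 ψm
  plus_one : IsJostColumn δ q₀ q (DPlus q₀ ∪ contour q₀) atTop qp 0 ψp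
  plus_two : IsJostColumn δ q₀ q (DMinus q₀ ∪ contour q₀) atTop qp 1 ψp

/-! ### Scattering matrix, reflection coefficients, jump matrix -/

/-- The Wronskian of two column vectors. -/
def wronskian (φ χ : Fin 2 → ℂ) : ℂ := φ 0 * χ 1 - φ 1 * χ 0

/-- The scattering matrix `S(z)`, given by `ψ₊ = ψ₋ S`, that is, through Wronskians of the Jost
solutions. Since `X` and `T` have trace zero, these do not depend on `(x, t)`; they are
evaluated at `(0, 0)`. -/
def scattering (q₀ : ℝ) (ψm ψp : ℝ → ℝ → ℂ → Matrix (Fin 2) (Fin 2) ℂ) (z : ℂ) :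
    Matrix (Fin 2) (Fin 2) ℂ :=
  !![wronskian ((ψp 0 0 z).col 0) ((ψm 0 0 z).col 1) / gam q₀ z,
     wronskian ((ψp 0 0 z).col 1) ((ψm 0 0 z).col 1) / gam q₀ z;
     wronskian ((ψm 0 0 z).col 0) ((ψp 0 0 z).col 0) / gam q₀ z,
     wronskian ((ψm 0 0 z).col 0) ((ψp 0 0 z).col 1) / gam q₀ z]

/-- The entry `s₁₁` of the scattering matrix. -/
def s11 (q₀ : ℝ) (ψm ψp : ℝ → ℝ → ℂ → Matrix (Fin 2) (Fin 2) ℂ) (z : ℂ) : ℂ :=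
  scattering q₀ ψm ψp z 0 0

/-- The reflection coefficient `ρ = s₂₁ / s₁₁`. -/
def rho (q₀ : ℝ) (ψm ψp : ℝ → ℝ → ℂ → Matrix (Fin 2) (Fin 2) ℂ) (z : ℂ) : ℂ :=
  scattering q₀ ψm ψp z 1 0 / scattering q₀ ψm ψp z 0 0

/-- The reflection coefficient `ρ̃ = s₁₂ / s₂₂`. -/
def rhoTilde (q₀ : ℝ) (ψm ψp : ℝ → ℝ → ℂ → Matrix (Fin 2) (Fin 2) ℂ) (z : ℂ) : ℂ :=
  scattering q₀ ψm ψp z 0 1 / scattering q₀ ψm ψp z 1 1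

/-- The matrix `G` in the jump condition `M⁻ = M⁺ (1 - G)` on `Σ`. -/
def jumpG (δ q₀ : ℝ) (ψm ψp : ℝ → ℝ → ℂ → Matrix (Fin 2) (Fin 2) ℂ) (x t : ℝ) (z : ℂ) :
    Matrix (Fin 2) (Fin 2) ℂ :=
  !![0, -(rhoTilde q₀ ψm ψp z * exp (2 * I * theta δ q₀ x t z));
     rho q₀ ψm ψp z * exp (-(2 * I * theta δ q₀ x t z)),
     rho q₀ ψm ψp z * rhoTilde q₀ ψm ψp z]

/-! ### Discrete data and the linear system

The `2N` indices are the elements of `Fin N ⊕ Fin N`, the `4N` indices of the linear system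
those of `(Fin N ⊕ Fin N) ⊕ (Fin N ⊕ Fin N)`. -/

variable {N : ℕ}

/-- The double zeros of `s₁₁` in `D⁺`: `ξ_n = z_n` and `ξ_{N+n} = - q₀² / z_n*`. -/
def xi (q₀ : ℝ) (zn : Fin N → ℂ) : Fin N ⊕ Fin N → ℂ :=
  Sum.elim zn (fun n => -(q₀ ^ 2 / conj (zn n)))

/-- The reflected points `ξ*_n = - q₀² / ξ_n`, which are the double zeros of `s₂₂` in `D⁻`. -/
def xiStar (q₀ : ℝ) (zn : Fin N → ℂ) (k : Fin N ⊕ Fin N) : ℂ := -(q₀ ^ 2 / xi q₀ zn k)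

/-- The constant `b` relates the Jost solutions at a double zero `w` of `s₁₁`, and `b` and `d`
relate their `z`-derivatives there, for all `(x, t)`. -/
def IsNorming (ψm ψp : ℝ → ℝ → ℂ → Matrix (Fin 2) (Fin 2) ℂ) (w b d : ℂ) : Prop :=
  ∀ (x t : ℝ) (i : Fin 2),
    ψp x t w i 0 = b * ψm x t w i 1 ∧
    deriv (fun z => ψp x t z i 0) w = d * ψm x t w i 1 + b * deriv (fun z => ψm x t z i 1) w

/-- `A = 2 b / s₁₁''`. -/
def coeffA (s : ℂ → ℂ) (w b : ℂ) : ℂ := 2 * b / iteratedDeriv 2 s w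

/-- `B = d / b - s₁₁''' / (3 s₁₁'')`. -/
def coeffB (s : ℂ → ℂ) (w b d : ℂ) : ℂ :=
  d / b - iteratedDeriv 3 s w / (3 * iteratedDeriv 2 s w)

/-- `C_n(w) = A_n exp(- 2 i θ(ξ_n)) / (w - ξ_n)`. -/
def coeffC (δ q₀ : ℝ) (zn : Fin N → ℂ) (A : Fin N ⊕ Fin N → ℂ) (x t : ℝ)
    (n : Fin N ⊕ Fin N) (w : ℂ) : ℂ :=
  A n * exp (-(2 * I * theta δ q₀ x t (xi q₀ zn n))) / (w - xi q₀ zn n)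

/-- `D_n = B_n - 2 i θ'(ξ_n)`, where the prime is the derivative in `z`. -/
def coeffD (δ q₀ : ℝ) (zn : Fin N → ℂ) (B : Fin N ⊕ Fin N → ℂ) (x t : ℝ)
    (n : Fin N ⊕ Fin N) : ℂ :=
  B n - 2 * I * deriv (fun z => theta δ q₀ x t z) (xi q₀ zn n)

/-- The `4N × 4N` matrix of the linear system. -/
def sysM (δ q₀ : ℝ) (qm : ℂ) (zn : Fin N → ℂ) (A B : Fin N ⊕ Fin N → ℂ) (x t : ℝ) :
    Matrix ((Fin N ⊕ Fin N) ⊕ (Fin N ⊕ Fin N)) ((Fin N ⊕ Fin N) ⊕ (Fin N ⊕ Fin N)) ℂ :=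
  Matrix.fromBlocks
    (Matrix.of fun k n =>
      coeffC δ q₀ zn A x t n (xiStar q₀ zn k)
          * (coeffD δ q₀ zn B x t n + 1 / (xiStar q₀ zn k - xi q₀ zn n))
        + if k = n then xi q₀ zn k / conj qm else 0)
    (Matrix.of fun k n => coeffC δ q₀ zn A x t n (xiStar q₀ zn k))
    (Matrix.of fun k n =>
      coeffC δ q₀ zn A x t n (xiStar q₀ zn k) / (xiStar q₀ zn k - xi q₀ zn n)
          * (coeffD δ q₀ zn B x t n + 2 / (xiStar q₀ zn k - xi q₀ zn n))
        - if k = n then xi q₀ zn k ^ 2 / (q₀ ^ 2 * conj qm) else 0)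
    (Matrix.of fun k n =>
      coeffC δ q₀ zn A x t n (xiStar q₀ zn k) / (xiStar q₀ zn k - xi q₀ zn n)
        - if k = n then xi q₀ zn k ^ 3 / (q₀ ^ 2 * conj qm) else 0)

/-- The right-hand side of the linear system. -/
def sysV (q₀ : ℝ) (qm : ℂ) (zn : Fin N → ℂ) : (Fin N ⊕ Fin N) ⊕ (Fin N ⊕ Fin N) → ℂ :=
  Sum.elim (fun k => -(qm / xiStar q₀ zn k)) (fun k => -(qm / xiStar q₀ zn k ^ 2))

/-- The unknowns: `μ₋₂₂(ξ_n)` and then `μ₋₂₂'(ξ_n)`. -/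
def sysX (δ q₀ : ℝ) (zn : Fin N → ℂ) (ψm : ℝ → ℝ → ℂ → Matrix (Fin 2) (Fin 2) ℂ) (x t : ℝ) :
    (Fin N ⊕ Fin N) ⊕ (Fin N ⊕ Fin N) → ℂ :=
  Sum.elim (fun n => mu δ q₀ ψm x t (xi q₀ zn n) 1 1)
    (fun n => deriv (fun z => mu δ q₀ ψm x t z 1 1) (xi q₀ zn n))

/-- The quotient of determinants `det M_j^ext / det M` in Cramer's rule: in `M_j^ext` the `j`-th
column of `M` is replaced by `V`. -/
def cramerX (δ q₀ : ℝ) (qm : ℂ) (zn : Fin N → ℂ) (A B : Fin N ⊕ Fin N → ℂ) (x t : ℝ)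
    (j : (Fin N ⊕ Fin N) ⊕ (Fin N ⊕ Fin N)) : ℂ :=
  ((sysM δ q₀ qm zn A B x t).updateCol j (sysV q₀ qm zn)).det / (sysM δ q₀ qm zn A B x t).det

/-- The reconstruction `q₋ + ∑ A_n exp(- 2 i θ(ξ_n)) (X_{2N+n} + D_n X_n)` of the potential. -/
def reconstruct (δ q₀ : ℝ) (qm : ℂ) (zn : Fin N → ℂ) (A B : Fin N ⊕ Fin N → ℂ) (x t : ℝ)
    (X : (Fin N ⊕ Fin N) ⊕ (Fin N ⊕ Fin N) → ℂ) : ℂ :=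
  qm + ∑ n : Fin N ⊕ Fin N, A n * exp (-(2 * I * theta δ q₀ x t (xi q₀ zn n)))
    * (X (Sum.inr n) + coeffD δ q₀ zn B x t n * X (Sum.inl n))

end

end SexticNLS

open SexticNLS

namespace SexticNLS

/-! ### Complex analysis -/

/-- Painlevé's theorem for the real line. -/
theorem differentiableOn_ball_of_im_ne_zero {f : ℂ → ℂ} {c : ℂ} {r : ℝ}
    (hc : ContinuousOn f (Metric.ball c r))
    (hd : ∀ z ∈ Metric.ball c r, z.im ≠ 0 → DifferentiableAt ℂ f z) :
    DifferentiableOn ℂ f (Metric.ball c r) := by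
  refine (isConservativeOn_and_continuousOn_iff_isDifferentiableOn Metric.isOpen_ball).1 ⟨?_, hc⟩
  intro z w hzw
  have key : ∀ a b : ℂ, Rectangle a b ⊆ Rectangle z w →
      (0 : ℝ) ∉ Set.Ioo (min a.im b.im) (max a.im b.im) →
      wedgeIntegral a b f + wedgeIntegral b a f = 0 := by
    intro a b hab h0
    rw [wedgeIntegral_add_wedgeIntegral_eq]
    have := integral_boundary_rect_eq_zero_of_continuousOn_of_differentiableOn f a b
      (hc.mono (hab.trans hzw)) (fun x hx => by
        have hx2 := hx.2
        refine (hd x (hzw (hab ?_)) ?_).differentiableWithinAt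
        · exact ⟨Set.Ioo_subset_Icc_self hx.1, Set.Ioo_subset_Icc_self hx.2⟩
        · intro h
          exact h0 (h ▸ hx.2))
    simpa using this
  rw [← add_eq_zero_iff_eq_neg]
  by_cases h0 : (0 : ℝ) ∈ Set.Ioo (min z.im w.im) (max z.im w.im)
  · have h0' : (0 : ℝ) ∈ Set.uIcc z.im w.im := Set.Ioo_subset_Icc_self h0
    have e1 := key z (w.re : ℂ) (by
      intro x hx
      refine ⟨by simpa using hx.1, ?_⟩
      have := hx.2
      exact Set.uIcc_subset_uIcc Set.left_mem_uIcc (by simpa using h0') this)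
      (by
        rintro ⟨h1, h2⟩
        rcases le_total z.im 0 with h | h <;> simp [h] at h1 h2)
    have e2 := key (z.re : ℂ) w (by
      intro x hx
      refine ⟨by simpa using hx.1, ?_⟩
      have := hx.2
      exact Set.uIcc_subset_uIcc (by simpa using h0') Set.right_mem_uIcc this)
      (by
        rintro ⟨h1, h2⟩
        rcases le_total w.im 0 with h | h <;> simp [h] at h1 h2)
    rw [wedgeIntegral_add_wedgeIntegral_eq] at e1 e2 ⊢
    have hint : ∀ x ∈ Set.uIcc z.re w.re, ∀ a b : ℝ, a ∈ Set.uIcc z.im w.im →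
        b ∈ Set.uIcc z.im w.im →
        IntervalIntegrable (fun y : ℝ => f (x + y * I)) MeasureTheory.volume a b := by
      intro x hx a b ha hb
      refine ContinuousOn.intervalIntegrable ?_
      refine hc.comp (by fun_prop) ?_
      intro y hy
      refine hzw ⟨by simpa using hx, ?_⟩
      simpa using Set.uIcc_subset_uIcc ha hb hy
    have s1 := intervalIntegral.integral_add_adjacent_intervals
      (hint z.re Set.left_mem_uIcc z.im 0 Set.left_mem_uIcc h0')
      (hint z.re Set.left_mem_uIcc 0 w.im h0' Set.right_mem_uIcc)
    have s2 := intervalIntegral.integral_add_adjacent_intervals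
      (hint w.re Set.right_mem_uIcc z.im 0 Set.left_mem_uIcc h0')
      (hint w.re Set.right_mem_uIcc 0 w.im h0' Set.right_mem_uIcc)
    rw [← s1, ← s2]
    simp only [ofReal_re, ofReal_im, ofReal_zero, zero_mul, add_zero, smul_eq_mul] at e1 e2 ⊢
    linear_combination e1 + e2
  · exact key z w le_rfl h0

/-- Liouville's theorem with finitely many removable singularities. -/
theorem eq_zero_of_removable_of_tendsto_zero {h : ℂ → ℂ} {S : Set ℂ} (hS : S.Finite)
    (hd : ∀ z ∉ S, DifferentiableAt ℂ h z)
    (hs : ∀ s ∈ S, Tendsto (fun z => (z - s) * h z) (𝓝[≠] s) (𝓝 0))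
    (hinf : Tendsto h (cocompact ℂ) (𝓝 0)) : ∀ z ∉ S, h z = 0 := by
  set H : ℂ → ℂ := fun z => limUnder (𝓝[≠] z) h with hH
  have e1 : ∀ z ∉ S, H z = h z := fun z hz =>
    ((hd z hz).continuousAt.tendsto.mono_left nhdsWithin_le_nhds).limUnder_eq
  have hpunct : ∀ s, ∀ᶠ z in 𝓝[≠] s, z ∉ S := by
    intro s
    have : (S \ {s})ᶜ ∈ 𝓝 s := (hS.subset Set.sdiff_subset).isClosed.isOpen_compl.mem_nhds (by simp)
    filter_upwards [nhdsWithin_le_nhds this, self_mem_nhdsWithin] with z h1 h2 h3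
    exact h1 ⟨h3, h2⟩
  have hdiff : Differentiable ℂ H := by
    intro s
    have hev : H =ᶠ[𝓝[≠] s] h := (hpunct s).mono fun z hz => e1 z hz
    have hlim : Tendsto h (𝓝[≠] s) (𝓝 (H s)) := by
      by_cases hsS : s ∈ S
      · refine tendsto_limUnder_of_differentiable_on_punctured_nhds_of_isLittleO
          ((hpunct s).mono fun z hz => hd z hz) ?_
        rw [Asymptotics.isLittleO_iff_tendsto']
        · have h2 : Tendsto (fun z => (z - s) * h z - (z - s) * h s) (𝓝[≠] s) (𝓝 (0 - 0)) := by
            refine (hs s hsS).sub ?_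
            have : Tendsto (fun z => (z - s) * h s) (𝓝 s) (𝓝 ((s - s) * h s)) :=
              Continuous.tendsto (by fun_prop) s
            rw [sub_self, zero_mul] at this
            exact this.mono_left nhdsWithin_le_nhds
          rw [sub_zero] at h2
          refine h2.congr fun z => ?_
          rw [div_inv_eq_mul]
          ring
        · filter_upwards [self_mem_nhdsWithin] with z hz h0
          exact absurd (sub_eq_zero.1 (inv_eq_zero.1 h0)) hz
      · rw [e1 s hsS]
        exact (hd s hsS).continuousAt.tendsto.mono_left nhdsWithin_le_nhds
    refine (analyticAt_of_differentiable_on_punctured_nhds_of_continuousAt ?_ ?_).differentiableAt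
    · have h3 : ∀ᶠ z in 𝓝[≠] s, ∀ᶠ y in 𝓝 z, y ∉ S := by
        filter_upwards [hpunct s] with z hz
        exact hS.isClosed.isOpen_compl.mem_nhds hz
      filter_upwards [h3] with z hz
      exact (hd z hz.self_of_nhds).congr_of_eventuallyEq (hz.mono fun y hy => e1 y hy)
    · exact continuousAt_iff_punctured_nhds.2 (hlim.congr' hev.symm)
  have hinf' : Tendsto H (cocompact ℂ) (𝓝 0) := by
    refine hinf.congr' ?_
    filter_upwards [hS.isCompact.compl_mem_cocompact] with z hz
    exact (e1 z hz).symm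
  intro z hz
  rw [← e1 z hz]
  exact hdiff.apply_eq_of_tendsto_cocompact z hinf'

theorem iteratedDeriv_two_three_of_eventuallyEq {s e : ℂ → ℂ} {ξ : ℂ} (he : AnalyticAt ℂ e ξ)
    (hs : s =ᶠ[𝓝 ξ] fun z => (z - ξ) ^ 2 * e z) :
    s ξ = 0 ∧ deriv s ξ = 0 ∧ iteratedDeriv 2 s ξ = 2 * e ξ ∧
      iteratedDeriv 3 s ξ = 6 * deriv e ξ := by
  have d0 := he.eventually_analyticAt
  have h1 : deriv s =ᶠ[𝓝 ξ] fun z => (z - ξ) * (2 * e z + (z - ξ) * deriv e z) := by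
    filter_upwards [hs.eventuallyEq_nhds, d0] with z hz hez
    rw [hz.deriv_eq]
    have := (((hasDerivAt_id z).sub_const ξ).pow 2).mul hez.differentiableAt.hasDerivAt
    refine (this.congr_deriv ?_).deriv
    simp
    ring
  have h2 : deriv (deriv s) =ᶠ[𝓝 ξ]
      fun z => 2 * e z + (z - ξ) * (4 * deriv e z + (z - ξ) * deriv (deriv e) z) := by
    filter_upwards [h1.eventuallyEq_nhds, d0] with z hz hez
    rw [hz.deriv_eq]
    have := ((hasDerivAt_id z).sub_const ξ).mul ((hez.differentiableAt.hasDerivAt.const_mul 2).add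
      (((hasDerivAt_id z).sub_const ξ).mul hez.deriv.differentiableAt.hasDerivAt))
    refine (this.congr_deriv ?_).deriv
    simp
    ring
  have h3 : deriv (deriv (deriv s)) ξ = 6 * deriv e ξ := by
    rw [h2.deriv_eq]
    have := (he.differentiableAt.hasDerivAt.const_mul 2).add
      (((hasDerivAt_id ξ).sub_const ξ).mul ((he.deriv.differentiableAt.hasDerivAt.const_mul 4).add
      (((hasDerivAt_id ξ).sub_const ξ).mul he.deriv.deriv.differentiableAt.hasDerivAt)))
    refine (this.congr_deriv ?_).deriv
    simp
    ring
  refine ⟨by simpa using hs.eq_of_nhds, by simpa using h1.eq_of_nhds, ?_, ?_⟩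
  · rw [iteratedDeriv_succ, iteratedDeriv_one]
    simpa using h2.eq_of_nhds
  · rw [iteratedDeriv_succ, iteratedDeriv_succ, iteratedDeriv_one]
    exact h3

theorem exists_eventuallyEq_sq_mul {s : ℂ → ℂ} {ξ : ℂ} (hs : AnalyticAt ℂ s ξ) (h0 : s ξ = 0)
    (h1 : deriv s ξ = 0) :
    ∃ e : ℂ → ℂ, AnalyticAt ℂ e ξ ∧ s =ᶠ[𝓝 ξ] fun z => (z - ξ) ^ 2 * e z := by
  have a1 : AnalyticAt ℂ (dslope s ξ) ξ := by
    obtain ⟨U, hU, hsU⟩ := hs.exists_mem_nhds_analyticOnNhd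
    have : DifferentiableOn ℂ (dslope s ξ) U :=
      (differentiableOn_dslope hU).2 hsU.differentiableOn
    exact this.analyticAt hU
  have a2 : AnalyticAt ℂ (dslope (dslope s ξ) ξ) ξ := by
    obtain ⟨U, hU, hsU⟩ := a1.exists_mem_nhds_analyticOnNhd
    have : DifferentiableOn ℂ (dslope (dslope s ξ) ξ) U :=
      (differentiableOn_dslope hU).2 hsU.differentiableOn
    exact this.analyticAt hU
  refine ⟨_, a2, Eventually.of_forall fun z => ?_⟩
  have e1 := sub_smul_dslope s ξ z
  have e2 := sub_smul_dslope (dslope s ξ) ξ z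
  rw [dslope_same, h1] at e2
  simp only [smul_eq_mul, h0, sub_zero] at e1 e2
  show s z = (z - ξ) ^ 2 * dslope (dslope s ξ) ξ z
  rw [pow_two, mul_assoc, e2, e1]

theorem differentiableAt_of_im_ne_zero {f : ℂ → ℂ} {c : ℂ} (hc : ∀ᶠ z in 𝓝 c, ContinuousAt f z)
    (hd : ∀ᶠ z in 𝓝 c, z.im ≠ 0 → DifferentiableAt ℂ f z) : DifferentiableAt ℂ f c := by
  obtain ⟨r, hr, h⟩ := Metric.eventually_nhds_iff_ball.1 (hc.and hd)
  exact (differentiableOn_ball_of_im_ne_zero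
    (fun z hz => (h z hz).1.continuousWithinAt) (fun z hz => (h z hz).2)).differentiableAt
    (Metric.ball_mem_nhds c hr)

/-- Painlevé's theorem for a circle around the origin. -/
theorem differentiableAt_of_norm_ne {f : ℂ → ℂ} {c : ℂ} {q₀ : ℝ} (hq₀ : 0 < q₀) (hcn : ‖c‖ = q₀)
    (hc : ∀ᶠ z in 𝓝 c, ContinuousAt f z)
    (hd : ∀ᶠ z in 𝓝 c, ‖z‖ ≠ q₀ → DifferentiableAt ℂ f z) : DifferentiableAt ℂ f c := by
  have hc0 : c ≠ 0 := by
    rintro rfl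
    simp at hcn
    linarith
  set E : ℂ → ℂ := fun w => c * exp (I * w) with hE
  have hEd : Differentiable ℂ E := by fun_prop
  have hE0 : E 0 = c := by simp [hE]
  have hEt : Tendsto E (𝓝 0) (𝓝 c) := by
    have := hEd.continuous.tendsto 0
    rwa [hE0] at this
  have hg : DifferentiableAt ℂ (fun w => f (E w)) 0 := by
    refine differentiableAt_of_im_ne_zero ?_ ?_
    · filter_upwards [hEt.eventually hc] with w hw
      exact ContinuousAt.comp hw hEd.continuous.continuousAt
    · filter_upwards [hEt.eventually hd] with w hw him
      refine DifferentiableAt.comp w (hw ?_) hEd.differentiableAt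
      rw [hE]
      simp only [norm_mul, hcn, norm_exp]
      intro h
      have h2 : Real.exp ((I * w).re) = 1 := by
        field_simp at h
        exact h
      rw [Real.exp_eq_one_iff] at h2
      simp at h2
      exact him h2
  have hlog : DifferentiableAt ℂ (fun z => -I * log (z / c)) c := by
    refine DifferentiableAt.const_mul (DifferentiableAt.clog (by fun_prop) ?_) _
    rw [div_self hc0]
    exact one_mem_slitPlane
  have h1 : DifferentiableAt ℂ (fun z => f (E (-I * log (z / c)))) c := by
    refine DifferentiableAt.comp (g := fun w => f (E w)) c ?_ hlog
    simpa [hc0] using hg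
  refine h1.congr_of_eventuallyEq ?_
  filter_upwards [isOpen_ne.mem_nhds hc0] with z hz
  have : E (-I * log (z / c)) = z := by
    have e : I * (-I * log (z / c)) = log (z / c) := by
      rw [← mul_assoc]
      simp
    simp only [hE, e]
    rw [exp_log (div_ne_zero hz hc0)]
    field_simp
  rw [this]

theorem differentiableAt_of_off_real_circle {f : ℂ → ℂ} {O : Set ℂ} {q₀ : ℝ} (hq₀ : 0 < q₀)
    (hO : IsOpen O) (hc : ContinuousOn f O)
    (hd : ∀ z ∈ O, z.im ≠ 0 → ‖z‖ ≠ q₀ → DifferentiableAt ℂ f z) :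
    ∀ z ∈ O, DifferentiableAt ℂ f z := by
  have hcev : ∀ z ∈ O, ∀ᶠ y in 𝓝 z, ContinuousAt f y := fun z hz => by
    filter_upwards [hO.mem_nhds hz] with y hy
    exact hc.continuousAt (hO.mem_nhds hy)
  have h1 : ∀ z ∈ O, ‖z‖ ≠ q₀ → DifferentiableAt ℂ f z := by
    intro z hz hn
    refine differentiableAt_of_im_ne_zero (hcev z hz) ?_
    have : ∀ᶠ y in 𝓝 z, ‖y‖ ≠ q₀ := (continuous_norm.tendsto z).eventually (isOpen_ne.mem_nhds hn)
    filter_upwards [hO.mem_nhds hz, this] with y hy hyn him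
    exact hd y hy him hyn
  have h2 : ∀ z ∈ O, z.im ≠ 0 → DifferentiableAt ℂ f z := by
    intro z hz him
    by_cases hn : ‖z‖ = q₀
    · refine differentiableAt_of_norm_ne hq₀ hn (hcev z hz) ?_
      filter_upwards [hO.mem_nhds hz] with y hy hyn
      exact h1 y hy hyn
    · exact hd z hz him hn
  exact fun z hz => differentiableAt_of_im_ne_zero (hcev z hz)
    (by filter_upwards [hO.mem_nhds hz] with y hy him using h2 y hy him)

/-- If `F(z) F(τ z) (R(τ z) - R(z))` is analytic near the fixed point `p` of the involution `τ`
and `F` is bounded away from zero and infinity on one of the two sides of `p`,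
then the singularity of `F` at `p` is removable. -/
theorem exists_tendsto_of_involution {p v₀ : ℂ} {τ F R V : ℂ → ℂ} {A : Set ℂ}
    (hA : (𝓝[A] p).NeBot) (hpA : p ∉ A)
    (hτ : AnalyticAt ℂ τ p) (hτp : τ p = p) (hτne : ∀ᶠ z in 𝓝[≠] p, τ z ≠ p)
    (hcov : ∀ᶠ z in 𝓝[≠] p, z ∈ A ∨ τ z ∈ A)
    (hF : ∀ᶠ z in 𝓝[≠] p, DifferentiableAt ℂ F z) (hFA : Tendsto F (𝓝[A] p) (𝓝 v₀))
    (hv₀ : v₀ ≠ 0) (hR : AnalyticAt ℂ R p) (hV : AnalyticAt ℂ V p)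
    (hV0 : ∀ᶠ z in 𝓝[≠] p, V z ≠ 0)
    (hprod : ∀ᶠ z in 𝓝[≠] p, F z * F (τ z) * (R (τ z) - R z) = V z) :
    ∃ L, Tendsto F (𝓝[≠] p) (𝓝 L) := by
  have hle : 𝓝[A] p ≤ 𝓝[≠] p := nhdsWithin_mono p (fun z hz h => hpA (h ▸ hz))
  have hQ : AnalyticAt ℂ (fun z => R (τ z) - R z) p :=
    (AnalyticAt.comp (g := R) (f := τ) (by rwa [hτp]) hτ).sub hR
  have hP : MeromorphicAt (fun z => V z / (R (τ z) - R z)) p :=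
    hV.meromorphicAt.div hQ.meromorphicAt
  obtain ⟨n, hn⟩ := hP
  have hFτ : Tendsto τ (𝓝[≠] p) (𝓝[≠] p) := by
    refine tendsto_nhdsWithin_of_tendsto_nhds_of_eventually_within _ ?_ hτne
    have := hτ.continuousAt.tendsto
    rw [hτp] at this
    exact this.mono_left nhdsWithin_le_nhds
  have hlow : ∀ᶠ z in 𝓝[≠] p, z ∈ A → ‖v₀‖ / 2 ≤ ‖F z‖ ∧ ‖F z‖ ≤ 2 * ‖v₀‖ := by
    have h0 : 0 < ‖v₀‖ := norm_pos_iff.2 hv₀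
    have : ∀ᶠ z in 𝓝[A] p, ‖F z‖ ∈ Set.Icc (‖v₀‖ / 2) (2 * ‖v₀‖) :=
      hFA.norm.eventually (Icc_mem_nhds (by linarith) (by linarith))
    rw [eventually_nhdsWithin_iff] at this
    exact this.filter_mono nhdsWithin_le_nhds
  have hbdd : ∃ C, ∀ᶠ z in 𝓝[≠] p, ‖(z - p) ^ n * F z‖ ≤ C := by
    obtain ⟨C, hC⟩ : ∃ C, ∀ᶠ z in 𝓝 p, ‖(z - p) ^ n * (V z / (R (τ z) - R z))‖ ≤ C := by
      have := hn.continuousAt.norm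
      exact ⟨_, (this.tendsto.eventually (gt_mem_nhds (lt_add_one _))).mono fun z hz => hz.le⟩
    have hsmall : ∀ᶠ z in 𝓝 p, ‖(z - p) ^ n‖ ≤ 1 := by
      have : ∀ᶠ z in 𝓝 p, ‖z - p‖ < 1 := by
        filter_upwards [Metric.ball_mem_nhds p one_pos] with z hz
        rwa [← dist_eq_norm]
      filter_upwards [this] with z hz
      rw [norm_pow]
      exact pow_le_one₀ (norm_nonneg _) hz.le
    refine ⟨max (2 * ‖v₀‖) (C / (‖v₀‖ / 2)), ?_⟩
    filter_upwards [hlow, hFτ.eventually hlow, hcov, nhdsWithin_le_nhds hC,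
      nhdsWithin_le_nhds hsmall, hprod, hV0] with z h1 h2 h3 h4 h5 h6 h7
    rcases h3 with h | h
    · refine le_trans ?_ (le_max_left _ _)
      rw [norm_mul]
      calc _ ≤ 1 * ‖F z‖ := by gcongr
        _ ≤ _ := by simpa using (h1 h).2
    · refine le_trans ?_ (le_max_right _ _)
      have h0 : 0 < ‖v₀‖ := norm_pos_iff.2 hv₀
      rw [le_div_iff₀ (by positivity)]
      have hne : R (τ z) - R z ≠ 0 := by
        intro h0
        rw [h0, mul_zero] at h6
        exact h7 h6.symm
      have e : V z / (R (τ z) - R z) = F z * F (τ z) := by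
        rw [← h6]
        field_simp
      rw [e, ← mul_assoc, norm_mul] at h4
      refine le_trans ?_ h4
      gcongr
      exact (h2 h).1
  obtain ⟨C, hC⟩ := hbdd
  have hd : ∀ᶠ z in 𝓝[≠] p, DifferentiableAt ℂ (fun z => (z - p) ^ n * F z) z := by
    filter_upwards [hF] with z hz
    exact DifferentiableAt.mul (by fun_prop) hz
  have hlim := tendsto_limUnder_of_differentiable_on_punctured_nhds_of_bounded_under
    (f := fun z => (z - p) ^ n * F z) (c := p) hd (by
      refine ⟨C + ‖(p - p) ^ n * F p‖, ?_⟩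
      rw [eventually_map]
      filter_upwards [hC] with z hz
      exact (norm_sub_le _ _).trans (by gcongr))
  set ℓ := limUnder (𝓝[≠] p) fun z => (z - p) ^ n * F z
  have hU : AnalyticAt ℂ (Function.update (fun z => (z - p) ^ n * F z) p ℓ) p := by
    refine analyticAt_of_differentiable_on_punctured_nhds_of_continuousAt ?_
      (continuousAt_update_same.2 hlim)
    filter_upwards [hd, self_mem_nhdsWithin] with z hz hzp
    refine hz.congr_of_eventuallyEq ?_
    filter_upwards [isOpen_ne.mem_nhds hzp] with y hy
    exact Function.update_of_ne hy _ _
  have hFm : MeromorphicAt F p := by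
    have hm : MeromorphicAt (fun z => (z - p) ^ n) p :=
      AnalyticAt.meromorphicAt (by fun_prop)
    refine (hU.meromorphicAt.div hm).congr ?_
    filter_upwards [self_mem_nhdsWithin] with z hz
    have : z - p ≠ 0 := sub_ne_zero.2 hz
    simp only [Pi.div_apply, Function.update_of_ne hz]
    field_simp
  rw [tendsto_nhds_iff_meromorphicOrderAt_nonneg hFm]
  by_contra hneg
  rw [not_le, ← tendsto_cobounded_iff_meromorphicOrderAt_neg hFm] at hneg
  have h1 := hneg.mono_left hle
  exact hFA.not_tendsto (Metric.disjoint_nhds_cobounded _) h1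

end SexticNLS

namespace SexticNLS

/-! ### Gronwall inequalities and Volterra equations on a half-line -/

open MeasureTheory in
/-- Gronwall's inequality on a half-line, with data at `+∞`. -/
theorem gronwall_atTop {a ε M : ℝ} {w φ : ℝ → ℝ} (hw : Continuous w) (hw0 : ∀ y, 0 ≤ w y)
    (hwi : IntegrableOn w (Set.Ioi a)) (hφ : Continuous φ) (hφ0 : ∀ y, 0 ≤ φ y)
    (hM : ∀ y, a ≤ y → φ y ≤ M) (hε : 0 ≤ ε)
    (h : ∀ x, a ≤ x → φ x ≤ ε + ∫ y in Set.Ioi x, w y * φ y) :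
    ∀ x, a ≤ x → φ x ≤ ε * Real.exp (∫ y in Set.Ioi a, w y) := by
  have hwφ : Continuous fun y => w y * φ y := hw.mul hφ
  have hwφi : IntegrableOn (fun y => w y * φ y) (Set.Ioi a) := by
    refine (hwi.mul_const M).mono' hwφ.aestronglyMeasurable ?_
    filter_upwards [ae_restrict_mem measurableSet_Ioi] with y hy
    rw [Real.norm_of_nonneg (mul_nonneg (hw0 y) (hφ0 y))]
    exact mul_le_mul_of_nonneg_left (hM y (le_of_lt hy)) (hw0 y)
  set W := ∫ y in Set.Ioi a, w y
  set Φ := ∫ y in Set.Ioi a, w y * φ y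
  have hsplit : ∀ x, a ≤ x → ∫ y in Set.Ioi x, w y * φ y = Φ - ∫ y in a..x, w y * φ y := by
    intro x hx
    rw [eq_sub_iff_add_eq', intervalIntegral.integral_of_le hx,
      ← setIntegral_union (Set.Ioc_disjoint_Ioi le_rfl) measurableSet_Ioi
        (hwφi.mono_set Set.Ioc_subset_Ioi_self) (hwφi.mono_set (Set.Ioi_subset_Ioi hx)),
      Set.Ioc_union_Ioi_eq_Ioi hx]
  set H : ℝ → ℝ := fun x => (ε + (Φ - ∫ y in a..x, w y * φ y)) *
    Real.exp ((∫ y in a..x, w y) - W) with hH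
  have hd : ∀ x, HasDerivAt H ((-(w x * φ x)) * Real.exp ((∫ y in a..x, w y) - W) +
      (ε + (Φ - ∫ y in a..x, w y * φ y)) * (Real.exp ((∫ y in a..x, w y) - W) * w x)) x := by
    intro x
    have h1 := (hwφ.integral_hasStrictDerivAt a x).hasDerivAt
    have h2 := (hw.integral_hasStrictDerivAt a x).hasDerivAt
    exact ((h1.const_sub Φ).const_add ε).mul (h2.sub_const W).exp
  have hmono : MonotoneOn H (Set.Ici a) := by
    refine monotoneOn_of_deriv_nonneg (convex_Ici a)
      (fun x _ => (hd x).continuousAt.continuousWithinAt)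
      (fun x _ => (hd x).differentiableAt.differentiableWithinAt) ?_
    intro x hx
    rw [interior_Ici] at hx
    rw [(hd x).deriv]
    have h3 := h x (le_of_lt hx)
    rw [hsplit x (le_of_lt hx)] at h3
    have h4 := mul_le_mul_of_nonneg_left h3 (mul_nonneg (Real.exp_pos
      ((∫ y in a..x, w y) - W)).le (hw0 x))
    linarith
  have hlim : Tendsto H atTop (𝓝 ((ε + (Φ - Φ)) * Real.exp (W - W))) := by
    have h1 := intervalIntegral_tendsto_integral_Ioi a hwφi tendsto_id
    have h2 := intervalIntegral_tendsto_integral_Ioi a hwi tendsto_id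
    exact ((h1.const_sub Φ).const_add ε).mul
      ((Real.continuous_exp.tendsto _).comp (h2.sub_const W))
  simp only [sub_self, Real.exp_zero, add_zero, mul_one] at hlim
  intro x hx
  have h1 : H x ≤ ε := ge_of_tendsto hlim
    ((eventually_ge_atTop x).mono fun y hy => hmono hx (hx.trans hy) hy)
  have h2 := h x hx
  rw [hsplit x hx] at h2
  have hI : 0 ≤ ∫ y in a..x, w y := intervalIntegral.integral_nonneg hx fun y _ => hw0 y
  have h3 : (ε + (Φ - ∫ y in a..x, w y * φ y)) ≤
      ε * Real.exp (W - ∫ y in a..x, w y) := by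
    have := mul_le_mul_of_nonneg_right h1 (Real.exp_pos (W - ∫ y in a..x, w y)).le
    rw [hH, mul_assoc, ← Real.exp_add] at this
    simpa using this
  refine h2.trans (h3.trans ?_)
  gcongr
  linarith

/-- Gronwall's inequality for a linear differential equation, in both directions. -/
theorem norm_le_exp_mul_norm {V : Type*} [NormedAddCommGroup V] [NormedSpace ℝ V] {u u' : ℝ → V}
    {a b C : ℝ} (hC : 0 ≤ C) (hu : ∀ x ∈ Set.Icc a b, HasDerivAt u (u' x) x)
    (hb : ∀ x ∈ Set.Icc a b, ‖u' x‖ ≤ C * ‖u x‖) {x y : ℝ} (hx : x ∈ Set.Icc a b)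
    (hy : y ∈ Set.Icc a b) : ‖u y‖ ≤ Real.exp (C * (b - a)) * ‖u x‖ := by
  have main : ∀ s : ℝ, |s| ≤ b - a → ‖u x‖ * Real.exp (C * |s|) ≤
      Real.exp (C * (b - a)) * ‖u x‖ := by
    intro s hs
    rw [mul_comm]
    gcongr
  rcases le_total x y with h | h
  · have := norm_le_gronwallBound_of_norm_deriv_right_le (f := u) (f' := u') (δ := ‖u x‖) (K := C)
      (ε := 0) (a := x) (b := y)
      (fun s hs => (hu s ⟨hx.1.trans hs.1, hs.2.trans hy.2⟩).continuousAt.continuousWithinAt)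
      (fun s hs => (hu s ⟨hx.1.trans hs.1, hs.2.le.trans hy.2⟩).hasDerivWithinAt) le_rfl
      (fun s hs => by
        rw [add_zero]
        exact hb s ⟨hx.1.trans hs.1, hs.2.le.trans hy.2⟩) y ⟨h, le_rfl⟩
    rw [gronwallBound_ε0] at this
    refine this.trans ?_
    have := main (y - x) (by rw [abs_of_nonneg (by linarith)]; linarith [hx.1, hy.2])
    rwa [abs_of_nonneg (by linarith)] at this
  · have := norm_le_gronwallBound_of_norm_deriv_right_le (f := fun s => u (-s))
      (f' := fun s => -u' (-s)) (δ := ‖u x‖) (K := C)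
      (ε := 0) (a := -x) (b := -y)
      (fun s hs => ((hu (-s) ⟨by linarith [hy.1, hs.2], by linarith [hx.2, hs.1]⟩).scomp s
        (hasDerivAt_neg s)).continuousAt.continuousWithinAt)
      (fun s hs => by
        have := ((hu (-s) ⟨by linarith [hy.1, hs.2], by linarith [hx.2, hs.1]⟩).scomp s
          (hasDerivAt_neg s)).hasDerivWithinAt (s := Set.Ici s)
        simpa [Function.comp_def] using this) (by simp)
      (fun s hs => by
        rw [add_zero, norm_neg]
        exact hb (-s) ⟨by linarith [hy.1, hs.2], by linarith [hx.2, hs.1]⟩) (-y)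
      ⟨by linarith, le_rfl⟩
    rw [gronwallBound_ε0] at this
    simp only [neg_neg] at this
    refine this.trans ?_
    have := main (x - y) (by rw [abs_of_nonneg (by linarith)]; linarith [hx.2, hy.1])
    rw [abs_of_nonneg (by linarith)] at this
    rwa [show -y - -x = x - y by ring]

section Volterra

variable {V : Type*} [NormedAddCommGroup V] [NormedSpace ℂ V]

/-- `μ` is a bounded solution on `[a, ∞)` of the Volterra equation with source `Y` and kernel `K`
dominated by `w`. -/
structure IsVolterra (a : ℝ) (w : ℝ → ℝ) (K : ℝ → ℝ → V →L[ℂ] V) (Y μ : ℝ → V) : Prop where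
  kernel_cont : ∀ x, Continuous (K x)
  kernel_le : ∀ x y, a ≤ x → x ≤ y → ‖K x y‖ ≤ w y
  cont : Continuous μ
  bdd : ∃ M, ∀ x, a ≤ x → ‖μ x‖ ≤ M
  eq : ∀ x, a ≤ x → μ x = Y x + ∫ y in Set.Ioi x, K x y (μ y)

variable {a : ℝ} {w : ℝ → ℝ} {K K' : ℝ → ℝ → V →L[ℂ] V} {Y Y' μ μ' : ℝ → V}

open MeasureTheory in
theorem IsVolterra.integrableOn (hwi : IntegrableOn w (Set.Ioi a))
    (hK : ∀ x, Continuous (K x)) (hKw : ∀ x y, a ≤ x → x ≤ y → ‖K x y‖ ≤ w y)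
    (h : IsVolterra a w K' Y μ) {x : ℝ} (hx : a ≤ x) :
    IntegrableOn (fun y => K x y (μ y)) (Set.Ioi x) := by
  obtain ⟨M, hM⟩ := h.bdd
  refine ((hwi.mono_set (Set.Ioi_subset_Ioi hx)).mul_const M).mono'
    ((hK x).clm_apply h.cont).aestronglyMeasurable ?_
  filter_upwards [ae_restrict_mem measurableSet_Ioi] with y hy
  have h1 := hKw x y hx (le_of_lt hy)
  exact ((K x y).le_opNorm _).trans (mul_le_mul h1 (hM y (hx.trans (le_of_lt hy)))
    (norm_nonneg _) ((norm_nonneg _).trans h1))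

open MeasureTheory in
theorem IsVolterra.norm_le (hw : Continuous w) (hw0 : ∀ y, 0 ≤ w y)
    (hwi : IntegrableOn w (Set.Ioi a)) (h : IsVolterra a w K Y μ) {ε : ℝ}
    (hY : ∀ x, a ≤ x → ‖Y x‖ ≤ ε) (x : ℝ) (hx : a ≤ x) :
    ‖μ x‖ ≤ ε * Real.exp (∫ y in Set.Ioi a, w y) := by
  obtain ⟨M, hM⟩ := h.bdd
  refine gronwall_atTop hw hw0 hwi h.cont.norm (fun y => norm_nonneg _) hM
    ((norm_nonneg _).trans (hY a le_rfl)) ?_ x hx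
  intro x hx
  rw [h.eq x hx]
  have hi : IntegrableOn (fun y => w y * ‖μ y‖) (Set.Ioi x) := by
    refine ((hwi.mono_set (Set.Ioi_subset_Ioi hx)).mul_const M).mono'
      (hw.mul h.cont.norm).aestronglyMeasurable ?_
    filter_upwards [ae_restrict_mem measurableSet_Ioi] with y hy
    rw [Real.norm_of_nonneg (mul_nonneg (hw0 y) (norm_nonneg _))]
    exact mul_le_mul_of_nonneg_left (hM y (hx.trans (le_of_lt hy))) (hw0 y)
  refine (norm_add_le _ _).trans (add_le_add (hY x hx) (norm_integral_le_of_norm_le hi ?_))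
  filter_upwards [ae_restrict_mem measurableSet_Ioi] with y hy
  exact ((K x y).le_opNorm _).trans
    (mul_le_mul_of_nonneg_right (h.kernel_le x y hx (le_of_lt hy)) (norm_nonneg _))

open MeasureTheory in
/-- The deviation of a bounded solution from its source. -/
theorem IsVolterra.norm_sub_le (hwi : IntegrableOn w (Set.Ioi a)) (h : IsVolterra a w K Y μ)
    {M : ℝ} (hM : ∀ x, a ≤ x → ‖μ x‖ ≤ M) (x : ℝ) (hx : a ≤ x) :
    ‖μ x - Y x‖ ≤ M * ∫ y in Set.Ioi x, w y := by
  rw [h.eq x hx, add_sub_cancel_left, mul_comm, ← integral_mul_const]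
  refine norm_integral_le_of_norm_le ((hwi.mono_set (Set.Ioi_subset_Ioi hx)).mul_const M) ?_
  filter_upwards [ae_restrict_mem measurableSet_Ioi] with y hy
  have h1 := h.kernel_le x y hx (le_of_lt hy)
  exact ((K x y).le_opNorm _).trans (mul_le_mul h1 (hM y (hx.trans (le_of_lt hy)))
    (norm_nonneg _) ((norm_nonneg _).trans h1))

open MeasureTheory in
theorem IsVolterra.sub (hwi : IntegrableOn w (Set.Ioi a)) (h : IsVolterra a w K Y μ)
    (h' : IsVolterra a w K' Y' μ') :
    IsVolterra a w K (fun x => Y x - Y' x + ∫ y in Set.Ioi x, (K x y - K' x y) (μ' y))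
      (fun x => μ x - μ' x) where
  kernel_cont := h.kernel_cont
  kernel_le := h.kernel_le
  cont := h.cont.sub h'.cont
  bdd := by
    obtain ⟨M, hM⟩ := h.bdd
    obtain ⟨M', hM'⟩ := h'.bdd
    exact ⟨M + M', fun x hx => (_root_.norm_sub_le _ _).trans (add_le_add (hM x hx) (hM' x hx))⟩
  eq := by
    intro x hx
    have i1 := IsVolterra.integrableOn hwi h.kernel_cont h.kernel_le h hx
    have i2 := IsVolterra.integrableOn hwi h'.kernel_cont h'.kernel_le h' hx
    have i3 := IsVolterra.integrableOn hwi h.kernel_cont h.kernel_le h' hx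
    simp only [sub_apply, map_sub]
    rw [integral_sub i3 i2, integral_sub i1 i3, h.eq x hx, h'.eq x hx]
    abel

omit [NormedSpace ℂ V] in
theorem exists_tendsto_of_dist_le [CompleteSpace V] {Z : Type*} {l : Filter Z} [l.NeBot] {g : Z → V}
    (h : ∀ ε > 0, ∀ᶠ p in l ×ˢ l, dist (g p.1) (g p.2) ≤ ε) : ∃ L, Tendsto g l (𝓝 L) := by
  have : Cauchy (map g l) := by
    refine ⟨inferInstance, ?_⟩
    rw [prod_map_map_eq, Metric.uniformity_basis_dist_le.ge_iff]
    intro ε hε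
    exact h ε hε
  exact cauchy_map_iff_exists_tendsto.1 this

open MeasureTheory in
/-- Solutions of Volterra equations converge if the kernels converge uniformly on compact sets. -/
theorem IsVolterra.exists_tendsto [CompleteSpace V] {Z : Type*} {l : Filter Z} [l.NeBot]
    {K : Z → ℝ → ℝ → V →L[ℂ] V} {Y : Z → V} {μ : Z → ℝ → V} {Y₀ : V}
    (hw : Continuous w) (hw0 : ∀ y, 0 ≤ w y) (hwi : IntegrableOn w (Set.Ioi a))
    (h : ∀ᶠ z in l, IsVolterra a w (K z) (fun _ => Y z) (μ z)) (hY : Tendsto Y l (𝓝 Y₀))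
    (hK : ∀ R ε : ℝ, 0 < ε → ∀ᶠ p in l ×ˢ l, ∀ x y, a ≤ x → x ≤ y → y ≤ R →
      ‖K p.1 x y - K p.2 x y‖ ≤ ε) {x : ℝ} (hx : a ≤ x) :
    ∃ L, Tendsto (fun z => μ z x) l (𝓝 L) := by
  set W := ∫ y in Set.Ioi a, w y
  set M := (‖Y₀‖ + 1) * Real.exp W
  have hMpos : 0 < M := by positivity
  have hM : ∀ᶠ z in l, ∀ x, a ≤ x → ‖μ z x‖ ≤ M := by
    have := hY.norm.eventually (gt_mem_nhds (lt_add_one ‖Y₀‖))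
    filter_upwards [h, this] with z hz hYz x hx
    exact hz.norm_le hw hw0 hwi (fun _ _ => hYz.le) x hx
  refine exists_tendsto_of_dist_le fun ε hε => ?_
  set η := ε / Real.exp W
  have hη : 0 < η := by positivity
  obtain ⟨R, hRa, hR⟩ : ∃ R, a < R ∧ ∫ y in Set.Ioi R, w y < η / (6 * M) := by
    have h1 : Tendsto (fun R => ∫ y in Set.Ioi R, w y) atTop (𝓝 0) := by
      have h2 := (intervalIntegral_tendsto_integral_Ioi a hwi tendsto_id).const_sub W
      rw [sub_self] at h2
      refine h2.congr' ?_
      filter_upwards [eventually_ge_atTop a] with R hR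
      rw [sub_eq_iff_eq_add, id, intervalIntegral.integral_of_le hR, add_comm,
        ← setIntegral_union (Set.Ioc_disjoint_Ioi le_rfl) measurableSet_Ioi
        (hwi.mono_set Set.Ioc_subset_Ioi_self) (hwi.mono_set (Set.Ioi_subset_Ioi hR)),
        Set.Ioc_union_Ioi_eq_Ioi hR]
    have h3 := (h1.eventually (gt_mem_nhds (show (0 : ℝ) < η / (6 * M) by positivity))).and
      (eventually_gt_atTop a)
    obtain ⟨R, hR⟩ := h3.exists
    exact ⟨R, hR.2, hR.1⟩
  have hYc : ∀ᶠ p in l ×ˢ l, ‖Y p.1 - Y p.2‖ ≤ η / 3 := by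
    have h1 : Tendsto (fun p : Z × Z => ‖Y p.1 - Y p.2‖) (l ×ˢ l) (𝓝 ‖Y₀ - Y₀‖) :=
      ((hY.comp tendsto_fst).sub (hY.comp tendsto_snd)).norm
    rw [sub_self, norm_zero] at h1
    exact (h1.eventually (gt_mem_nhds (show (0 : ℝ) < η / 3 by positivity))).mono fun _ h => h.le
  set κ := η / (3 * M * (R - a))
  have hRa' : 0 < R - a := by linarith
  have hκ : 0 < κ := by positivity
  filter_upwards [hYc, hK R κ hκ, tendsto_fst.eventually h, tendsto_snd.eventually h,
    tendsto_snd.eventually hM] with p h1 h2 h3 h4 h5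
  have hd := h3.sub hwi h4
  rw [dist_eq_norm]
  have hsrc : ∀ x, a ≤ x → ‖Y p.1 - Y p.2 + ∫ y in Set.Ioi x, (K p.1 x y - K p.2 x y) (μ p.2 y)‖
      ≤ η := by
    intro x hx
    set g : ℝ → ℝ := fun y => (Set.Ioc a R).indicator (fun _ => κ * M) y +
      (Set.Ioi R).indicator (fun y => 2 * w y * M) y with hg
    have hwR : IntegrableOn (fun y => 2 * w y * M) (Set.Ioi R) :=
      ((hwi.mono_set (Set.Ioi_subset_Ioi hRa.le)).const_mul 2).mul_const M
    have hg1 : Integrable ((Set.Ioc a R).indicator (fun _ => κ * M)) :=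
      (integrable_indicator_iff measurableSet_Ioc).2 continuous_const.integrableOn_Ioc
    have hg2 : Integrable ((Set.Ioi R).indicator (fun y => 2 * w y * M)) :=
      (integrable_indicator_iff measurableSet_Ioi).2 hwR
    have hgi : Integrable g := hg1.add hg2
    have hg0 : ∀ y, 0 ≤ g y := fun y => add_nonneg
      (Set.indicator_nonneg (fun _ _ => by positivity) y)
      (Set.indicator_nonneg (fun y _ => by have := hw0 y; positivity) y)
    have hgint : ∫ y, g y ≤ 2 * (η / 3) := by
      rw [hg, integral_add hg1 hg2, integral_indicator measurableSet_Ioc,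
        integral_indicator measurableSet_Ioi, setIntegral_const, integral_mul_const,
        integral_const_mul]
      have e1 : (volume : Measure ℝ).real (Set.Ioc a R) • (κ * M) = η / 3 := by
        rw [measureReal_def, Real.volume_Ioc, ENNReal.toReal_ofReal hRa'.le, smul_eq_mul]
        simp only [κ]
        field_simp
      have e2 : (2 * ∫ y in Set.Ioi R, w y) * M ≤ η / 3 := by
        have := mul_le_mul_of_nonneg_right hR.le (show 0 ≤ 2 * M by positivity)
        calc _ = (∫ y in Set.Ioi R, w y) * (2 * M) := by ring
          _ ≤ _ := this
          _ = η / 3 := by field_simp; norm_num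
      linarith
    have hle : ‖∫ y in Set.Ioi x, (K p.1 x y - K p.2 x y) (μ p.2 y)‖ ≤ ∫ y in Set.Ioi x, g y := by
      refine norm_integral_le_of_norm_le hgi.integrableOn ?_
      filter_upwards [ae_restrict_mem measurableSet_Ioi] with y hy
      have hya : a < y := lt_of_le_of_lt hx hy
      refine (ContinuousLinearMap.le_opNorm _ _).trans ?_
      by_cases hyR : y ≤ R
      · simp only [hg]
        have hyI : y ∈ Set.Ioc a R := ⟨hya, hyR⟩
        rw [Set.indicator_of_mem hyI,
          Set.indicator_of_notMem (by simpa using hyR), add_zero]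
        exact mul_le_mul (h2 x y hx (le_of_lt hy) hyR) (h5 y hya.le) (norm_nonneg _) hκ.le
      · simp only [hg]
        rw [Set.indicator_of_notMem (fun h => hyR h.2),
          Set.indicator_of_mem (by simpa using hyR), zero_add]
        refine mul_le_mul ?_ (h5 y hya.le) (norm_nonneg _) (by have := hw0 y; positivity)
        have := _root_.norm_sub_le (K p.1 x y) (K p.2 x y)
        linarith [h3.kernel_le x y hx (le_of_lt hy), h4.kernel_le x y hx (le_of_lt hy)]
    have := setIntegral_le_integral (s := Set.Ioi x) hgi (Eventually.of_forall hg0)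
    have := norm_add_le (Y p.1 - Y p.2) (∫ y in Set.Ioi x, (K p.1 x y - K p.2 x y) (μ p.2 y))
    linarith
  have := hd.norm_le hw hw0 hwi hsrc x hx
  exact this.trans (le_of_eq (div_mul_cancel₀ ε (Real.exp_pos W).ne'))

theorem norm_dslope_sub_le [CompleteSpace V] {f : ℂ → V} {c : ℂ} {r B : ℝ} (hr : 0 < r)
    (hf : DifferentiableOn ℂ f (Metric.ball c r)) (hB : ∀ z ∈ Metric.ball c r, ‖f z‖ ≤ B) {z : ℂ}
    (hz : z ∈ Metric.ball c r) :
    ‖dslope f c z‖ ≤ 2 * B / r ∧ ‖dslope f c z - dslope f c c‖ ≤ 4 * B / r / r * ‖z - c‖ := by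
  have hc : c ∈ Metric.ball c r := Metric.mem_ball_self hr
  have h1 : ∀ y ∈ Metric.ball c r, ‖dslope f c y‖ ≤ 2 * B / r := fun y hy =>
    norm_dslope_le_div_of_mapsTo_ball hf (fun x hx => by
      rw [Metric.mem_closedBall, dist_eq_norm]
      have := norm_sub_le (f x) (f c)
      linarith [hB x hx, hB c hc]) hy
  refine ⟨h1 z hz, ?_⟩
  have h2 := dist_le_div_mul_dist_of_mapsTo_ball (f := dslope f c) (R₂ := 4 * B / r)
    ((differentiableOn_dslope (Metric.ball_mem_nhds c hr)).2 hf) (fun x hx => by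
      rw [Metric.mem_closedBall, dist_eq_norm]
      have := norm_sub_le (dslope f c x) (dslope f c c)
      have e : 4 * B / r = 2 * B / r + 2 * B / r := by ring
      linarith [h1 x hx, h1 c hc]) hz
  simpa [dist_eq_norm] using h2

open MeasureTheory in
/-- Solutions of Volterra equations depend analytically on a parameter if the kernel does. -/
theorem IsVolterra.differentiableAt [CompleteSpace V] {c : ℂ} {r : ℝ} (hr : 0 < r)
    {K : ℂ → ℝ → ℝ → V →L[ℂ] V} {Y : ℂ → V} {μ : ℂ → ℝ → V}
    (hw : Continuous w) (hw0 : ∀ y, 0 ≤ w y) (hwi : IntegrableOn w (Set.Ioi a))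
    (h : ∀ z ∈ Metric.ball c r, IsVolterra a w (K z) (fun _ => Y z) (μ z))
    (hY : DifferentiableOn ℂ Y (Metric.ball c r))
    (hK : ∀ x y, a ≤ x → x ≤ y → DifferentiableOn ℂ (fun z => K z x y) (Metric.ball c r))
    {x : ℝ} (hx : a ≤ x) : DifferentiableAt ℂ (fun z => μ z x) c := by
  have hc : c ∈ Metric.ball c r := Metric.mem_ball_self hr
  set W := ∫ y in Set.Ioi a, w y
  have hW0 : 0 ≤ W := setIntegral_nonneg measurableSet_Ioi fun y _ => hw0 y
  obtain ⟨ρ, hρ, hρr, BY, hBY⟩ : ∃ ρ, 0 < ρ ∧ ρ ≤ r ∧ ∃ B, ∀ z ∈ Metric.ball c ρ, ‖Y z‖ ≤ B := by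
    have hYc : ContinuousAt Y c := (hY.differentiableAt (Metric.ball_mem_nhds c hr)).continuousAt
    obtain ⟨ρ, hρ, h1⟩ := Metric.eventually_nhds_iff_ball.1
      (hYc.norm.tendsto.eventually (gt_mem_nhds (lt_add_one ‖Y c‖)))
    exact ⟨min ρ r, by positivity, min_le_right _ _, _, fun z hz =>
      (h1 z (Metric.ball_subset_ball (min_le_left _ _) hz)).le⟩
  have hsub : Metric.ball c ρ ⊆ Metric.ball c r := Metric.ball_subset_ball hρr
  have hcρ : c ∈ Metric.ball c ρ := Metric.mem_ball_self hρ
  have hBY0 : 0 ≤ BY := (norm_nonneg _).trans (hBY c hcρ)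
  set M := BY * Real.exp W
  have hM0 : 0 ≤ M := by positivity
  have hM : ∀ z ∈ Metric.ball c ρ, ∀ x, a ≤ x → ‖μ z x‖ ≤ M := fun z hz x hx =>
    (h z (hsub hz)).norm_le hw hw0 hwi (fun _ _ => hBY z hz) x hx
  have hKb : ∀ x y, a ≤ x → x ≤ y → ∀ z ∈ Metric.ball c ρ,
      ‖dslope (fun z => K z x y) c z‖ ≤ 2 * w y / ρ ∧
      ‖dslope (fun z => K z x y) c z - dslope (fun z => K z x y) c c‖ ≤
        4 * w y / ρ / ρ * ‖z - c‖ := fun x y hx hxy z hz =>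
    norm_dslope_sub_le hρ ((hK x y hx hxy).mono hsub)
      (fun z hz => (h z (hsub hz)).kernel_le x y hx hxy) hz
  have hYb : ∀ z ∈ Metric.ball c ρ, ‖dslope Y c z‖ ≤ 2 * BY / ρ ∧
      ‖dslope Y c z - dslope Y c c‖ ≤ 4 * BY / ρ / ρ * ‖z - c‖ := fun z hz =>
    norm_dslope_sub_le hρ (hY.mono hsub) hBY hz
  -- the divided differences solve Volterra equations with the kernel at `c`
  set D : ℂ → ℝ → V := fun z x => (z - c)⁻¹ • (μ z x - μ c x)
  set T : ℂ → ℝ → V := fun z x => dslope Y c z +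
    ∫ y in Set.Ioi x, (dslope (fun z => K z x y) c z) (μ z y)
  have hdK : ∀ z, z ≠ c → ∀ x y, dslope (fun z => K z x y) c z =
      (z - c)⁻¹ • (K z x y - K c x y) := fun z hz x y => by
    rw [dslope_of_ne _ hz, slope_def_module]
  have hD : ∀ z ∈ Metric.ball c ρ, z ≠ c → IsVolterra a w (K c) (T z) (D z) := by
    intro z hz hzc
    have hz' := h z (hsub hz)
    have hc' := h c hc
    refine ⟨hc'.kernel_cont, hc'.kernel_le, (hz'.cont.sub hc'.cont).const_smul _, ?_, ?_⟩
    · refine ⟨‖(z - c)⁻¹‖ * (M + M), fun x hx => ?_⟩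
      rw [norm_smul]
      gcongr
      exact (_root_.norm_sub_le _ _).trans (add_le_add (hM z hz x hx) (hM c hcρ x hx))
    · intro x hx
      have i1 := IsVolterra.integrableOn hwi hz'.kernel_cont hz'.kernel_le hz' hx
      have i2 := IsVolterra.integrableOn hwi hc'.kernel_cont hc'.kernel_le hc' hx
      have i3 := IsVolterra.integrableOn hwi hc'.kernel_cont hc'.kernel_le hz' hx
      simp only [T, D, hdK z hzc, smul_apply, sub_apply, map_smul,
        map_sub]
      rw [integral_smul, integral_smul, integral_sub i1 i3, integral_sub i3 i2, hz'.eq x hx,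
        hc'.eq x hx, dslope_of_ne _ hzc, slope_def_module, add_assoc, ← smul_add, ← smul_add]
      congr 1
      abel
  have hDb : ∃ C, 0 ≤ C ∧ ∀ z ∈ Metric.ball c ρ, z ≠ c → ∀ x, a ≤ x → ‖D z x‖ ≤ C := by
    refine ⟨(2 * BY / ρ + 2 / ρ * M * W) * Real.exp W, by positivity, fun z hz hzc x hx => ?_⟩
    refine (hD z hz hzc).norm_le hw hw0 hwi (fun x hx => ?_) x hx
    refine (norm_add_le _ _).trans (add_le_add (hYb z hz).1 ?_)
    have hle : ‖∫ y in Set.Ioi x, (dslope (fun z => K z x y) c z) (μ z y)‖ ≤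
        ∫ y in Set.Ioi x, 2 / ρ * M * w y := by
      refine norm_integral_le_of_norm_le
        ((hwi.mono_set (Set.Ioi_subset_Ioi hx)).const_mul _) ?_
      filter_upwards [ae_restrict_mem measurableSet_Ioi] with y hy
      have := (hKb x y hx (le_of_lt hy) z hz).1
      calc _ ≤ _ := ContinuousLinearMap.le_opNorm _ _
        _ ≤ (2 * w y / ρ) * M := mul_le_mul this (hM z hz y (hx.trans (le_of_lt hy)))
            (norm_nonneg _) ((norm_nonneg _).trans this)
        _ = _ := by ring
    refine hle.trans ?_
    rw [integral_const_mul]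
    refine mul_le_mul_of_nonneg_left ?_ (by positivity)
    exact setIntegral_mono_set hwi (Eventually.of_forall hw0)
      (Set.Ioi_subset_Ioi hx).eventuallyLE
  obtain ⟨C, hC0, hC⟩ := hDb
  have hlip : ∀ z ∈ Metric.ball c ρ, ∀ x, a ≤ x → ‖μ z x - μ c x‖ ≤ C * ‖z - c‖ := by
    intro z hz x hx
    by_cases hzc : z = c
    · simp [hzc]
    · have h1 := hC z hz hzc x hx
      have h2 : μ z x - μ c x = (z - c) • D z x := by
        simp only [D]
        rw [smul_inv_smul₀ (sub_ne_zero.2 hzc)]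
      rw [h2, norm_smul, mul_comm]
      gcongr
  set B := 4 * BY / ρ / ρ + (4 / ρ / ρ * M + 2 / ρ * C) * W
  have hB0 : 0 ≤ B := by positivity
  have hT : ∀ z ∈ Metric.ball c ρ, z ≠ c → ∀ z' ∈ Metric.ball c ρ, z' ≠ c → ∀ x, a ≤ x →
      ‖T z x - T z' x + ∫ y in Set.Ioi x, (K c x y - K c x y) (D z' y)‖ ≤
        B * (‖z - c‖ + ‖z' - c‖) := by
    intro z hz hzc z' hz' hzc' x hx
    have hi : ∀ z ∈ Metric.ball c ρ, z ≠ c → IntegrableOn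
        (fun y => (dslope (fun z => K z x y) c z) (μ z y)) (Set.Ioi x) := fun z hz hzc => by
      have hz' := h z (hsub hz)
      have hc' := h c hc
      have i1 := IsVolterra.integrableOn hwi hz'.kernel_cont hz'.kernel_le hz' hx
      have i3 := IsVolterra.integrableOn hwi hc'.kernel_cont hc'.kernel_le hz' hx
      simp only [hdK z hzc, smul_apply, sub_apply]
      exact (i1.sub i3).smul (z - c)⁻¹
    have e1 : T z x - T z' x = dslope Y c z - dslope Y c z' + ∫ y in Set.Ioi x,
        ((dslope (fun z => K z x y) c z) (μ z y) - (dslope (fun z => K z x y) c z') (μ z' y)) := by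
      simp only [T]
      rw [integral_sub (hi z hz hzc) (hi z' hz' hzc')]
      abel
    simp only [sub_self, zero_apply, integral_zero, add_zero]
    rw [e1]
    refine (norm_add_le _ _).trans ?_
    have b1 : ‖dslope Y c z - dslope Y c z'‖ ≤ 4 * BY / ρ / ρ * (‖z - c‖ + ‖z' - c‖) := by
      have := _root_.norm_sub_le (dslope Y c z - dslope Y c c) (dslope Y c z' - dslope Y c c)
      rw [sub_sub_sub_cancel_right] at this
      linarith [(hYb z hz).2, (hYb z' hz').2]
    have b2 : ‖∫ y in Set.Ioi x, ((dslope (fun z => K z x y) c z) (μ z y) -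
        (dslope (fun z => K z x y) c z') (μ z' y))‖ ≤ ∫ y in Set.Ioi x,
        (4 / ρ / ρ * M + 2 / ρ * C) * (‖z - c‖ + ‖z' - c‖) * w y := by
      refine norm_integral_le_of_norm_le
        ((hwi.mono_set (Set.Ioi_subset_Ioi hx)).const_mul _) ?_
      filter_upwards [ae_restrict_mem measurableSet_Ioi] with y hy
      have hy' : a ≤ y := hx.trans (le_of_lt hy)
      set G := fun z => dslope (fun z => K z x y) c z with hG
      have e2 : G z (μ z y) - G z' (μ z' y) = (G z - G c) (μ z y) - (G z' - G c) (μ z' y) +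
          (G c (μ z y - μ c y) - G c (μ z' y - μ c y)) := by
        simp only [sub_apply, map_sub]
        abel
      have k1 := (hKb x y hx (le_of_lt hy) z hz).2
      have k2 := (hKb x y hx (le_of_lt hy) z' hz').2
      have k3 := (hKb x y hx (le_of_lt hy) c hcρ).1
      have n1 : ‖(G z - G c) (μ z y)‖ ≤ 4 * w y / ρ / ρ * ‖z - c‖ * M :=
        (ContinuousLinearMap.le_opNorm _ _).trans (mul_le_mul k1 (hM z hz y hy')
          (norm_nonneg _) ((norm_nonneg _).trans k1))
      have n2 : ‖(G z' - G c) (μ z' y)‖ ≤ 4 * w y / ρ / ρ * ‖z' - c‖ * M :=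
        (ContinuousLinearMap.le_opNorm _ _).trans (mul_le_mul k2 (hM z' hz' y hy')
          (norm_nonneg _) ((norm_nonneg _).trans k2))
      have n3 : ‖G c (μ z y - μ c y)‖ ≤ 2 * w y / ρ * (C * ‖z - c‖) :=
        (ContinuousLinearMap.le_opNorm _ _).trans (mul_le_mul k3 (hlip z hz y hy')
          (norm_nonneg _) ((norm_nonneg _).trans k3))
      have n4 : ‖G c (μ z' y - μ c y)‖ ≤ 2 * w y / ρ * (C * ‖z' - c‖) :=
        (ContinuousLinearMap.le_opNorm _ _).trans (mul_le_mul k3 (hlip z' hz' y hy')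
          (norm_nonneg _) ((norm_nonneg _).trans k3))
      show ‖G z (μ z y) - G z' (μ z' y)‖ ≤ _
      rw [e2]
      refine (norm_add_le _ _).trans ((add_le_add (_root_.norm_sub_le _ _)
        (_root_.norm_sub_le _ _)).trans ((add_le_add (add_le_add n1 n2) (add_le_add n3 n4)).trans
        (le_of_eq ?_)))
      ring
    have b3 : ∫ y in Set.Ioi x, (4 / ρ / ρ * M + 2 / ρ * C) * (‖z - c‖ + ‖z' - c‖) * w y ≤
        (4 / ρ / ρ * M + 2 / ρ * C) * (‖z - c‖ + ‖z' - c‖) * W := by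
      rw [integral_const_mul]
      refine mul_le_mul_of_nonneg_left ?_ (by positivity)
      exact setIntegral_mono_set hwi (Eventually.of_forall hw0)
        (Set.Ioi_subset_Ioi hx).eventuallyLE
    refine (add_le_add b1 (b2.trans b3)).trans (le_of_eq ?_)
    simp only [B]
    ring
  have hlim : ∃ L, Tendsto (fun z => D z x) (𝓝[≠] c) (𝓝 L) := by
    refine exists_tendsto_of_dist_le fun ε hε => ?_
    have hsmall : ∀ᶠ z in 𝓝[≠] c, z ∈ Metric.ball c ρ ∧ z ≠ c ∧
        B * Real.exp W * ‖z - c‖ ≤ ε / 2 := by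
      have h1 : Tendsto (fun z => B * Real.exp W * ‖z - c‖) (𝓝 c)
          (𝓝 (B * Real.exp W * ‖c - c‖)) := Continuous.tendsto (by fun_prop) c
      rw [sub_self, norm_zero, mul_zero] at h1
      filter_upwards [nhdsWithin_le_nhds (Metric.ball_mem_nhds c hρ), self_mem_nhdsWithin,
        nhdsWithin_le_nhds (h1.eventually (gt_mem_nhds (half_pos hε)))] with z h1 h2 h3
      exact ⟨h1, h2, h3.le⟩
    filter_upwards [tendsto_fst.eventually hsmall, tendsto_snd.eventually hsmall] with p h1 h2
    have hd := (hD p.1 h1.1 h1.2.1).sub hwi (hD p.2 h2.1 h2.2.1)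
    rw [dist_eq_norm]
    refine (hd.norm_le hw hw0 hwi (hT p.1 h1.1 h1.2.1 p.2 h2.1 h2.2.1) x hx).trans ?_
    have e : B * (‖p.1 - c‖ + ‖p.2 - c‖) * Real.exp W =
      B * Real.exp W * ‖p.1 - c‖ + B * Real.exp W * ‖p.2 - c‖ := by ring
    rw [e]
    linarith [h1.2.2, h2.2.2]
  obtain ⟨L, hL⟩ := hlim
  refine HasDerivAt.differentiableAt (f' := L) ?_
  rw [hasDerivAt_iff_tendsto_slope]
  refine hL.congr fun z => ?_
  rw [slope_def_module]

end Volterra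

end SexticNLS

namespace SexticNLS

/-! ### The uniformization variable -/

theorem lam_sq (q₀ : ℝ) {z : ℂ} (hz : z ≠ 0) : lam q₀ z ^ 2 = kfun q₀ z ^ 2 + q₀ ^ 2 := by
  simp only [lam, kfun]
  field_simp
  ring

theorem kfun_add_lam (q₀ : ℝ) (z : ℂ) : kfun q₀ z + lam q₀ z = z := by
  simp only [lam, kfun]
  ring

theorem kfun_sub_lam (q₀ : ℝ) (z : ℂ) : kfun q₀ z - lam q₀ z = -(q₀ ^ 2 / z) := by
  simp only [lam, kfun]
  ring

theorem im_lam (q₀ : ℝ) (z : ℂ) (hz : z ≠ 0) :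
    (lam q₀ z).im = (‖z‖ ^ 2 - q₀ ^ 2) * z.im / (2 * ‖z‖ ^ 2) := by
  have hn : normSq z ≠ 0 := by simpa using hz
  have e : ((q₀ : ℂ) ^ 2 / z).im = -(q₀ ^ 2 * z.im / normSq z) := by
    have h1 : ((q₀ : ℂ) ^ 2).im = 0 := by rw [← ofReal_pow, ofReal_im]
    have h2 : ((q₀ : ℂ) ^ 2).re = q₀ ^ 2 := by rw [← ofReal_pow, ofReal_re]
    rw [div_im, h1, h2]
    ring
  have e2 : (lam q₀ z).im = 1 / 2 * (z.im + ((q₀ : ℂ) ^ 2 / z).im) := by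
    simp [lam]
  rw [e2, e, ← normSq_eq_norm_sq]
  field_simp
  ring

theorem lam_eq_mul_gam (q₀ : ℝ) {z : ℂ} (hz : z ≠ 0) : lam q₀ z = z * gam q₀ z / 2 := by
  simp only [lam, gam]
  field_simp

theorem gam_eq (q₀ : ℝ) {z : ℂ} (hz : z ≠ 0) :
    gam q₀ z = (z - I * q₀) * (z + I * q₀) / z ^ 2 := by
  simp only [gam]
  field_simp
  linear_combination ((q₀ : ℂ) ^ 2) * I_sq

theorem gam_ne_zero {q₀ : ℝ} {z : ℂ} (hz : z ≠ 0) (h1 : z ≠ I * q₀) (h2 : z ≠ -(I * q₀)) :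
    gam q₀ z ≠ 0 := by
  rw [gam_eq q₀ hz]
  refine div_ne_zero (mul_ne_zero (sub_ne_zero.2 h1) ?_) (pow_ne_zero _ hz)
  intro h
  exact h2 (eq_neg_of_add_eq_zero_left h)

theorem norm_branch {q₀ : ℝ} (hq₀ : 0 < q₀) : ‖I * (q₀ : ℂ)‖ = q₀ := by
  simp [abs_of_pos hq₀]

/-- The closed region `D⁺ ∪ Σ`. -/
def closedPlus (q₀ : ℝ) : Set ℂ := DPlus q₀ ∪ contour q₀

/-- The closed region `D⁻ ∪ Σ`. -/
def closedMinus (q₀ : ℝ) : Set ℂ := DMinus q₀ ∪ contour q₀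

theorem mem_closedPlus_iff {q₀ : ℝ} (hq₀ : 0 < q₀) {z : ℂ} : z ∈ closedPlus q₀ ↔
    0 ≤ (‖z‖ ^ 2 - q₀ ^ 2) * z.im ∧ z ≠ 0 ∧ z ≠ I * q₀ ∧ z ≠ -(I * q₀) := by
  constructor
  · rintro (h | ⟨h | h, h0⟩)
    · have h' : 0 < (‖z‖ ^ 2 - q₀ ^ 2) * z.im := h
      refine ⟨h'.le, ?_, ?_, ?_⟩ <;> rintro rfl
      · simp at h'
      · rw [norm_branch hq₀] at h'
        simp at h'
      · rw [norm_neg, norm_branch hq₀] at h'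
        simp at h'
    · exact ⟨by simp [h], h0⟩
    · exact ⟨by simp [h], h0⟩
  · rintro ⟨h, h0⟩
    rcases h.lt_or_eq with h | h
    · exact Or.inl h
    · refine Or.inr ⟨?_, h0⟩
      rcases mul_eq_zero.1 h.symm with h | h
      · right
        have := norm_nonneg z
        nlinarith
      · exact Or.inl h

theorem neg_mem_closedPlus_iff {q₀ : ℝ} {z : ℂ} : -z ∈ closedPlus q₀ ↔ z ∈ closedMinus q₀ := by
  simp only [closedPlus, closedMinus, DPlus, DMinus, contour, Set.mem_union, Set.mem_ofPred_eq,
    norm_neg, neg_im, mul_neg, neg_eq_zero, ne_eq, neg_inj, Left.neg_pos_iff]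
  have : (-z = I * q₀) ↔ (z = -(I * q₀)) := neg_eq_iff_eq_neg
  tauto

theorem mem_closedMinus_iff {q₀ : ℝ} (hq₀ : 0 < q₀) {z : ℂ} : z ∈ closedMinus q₀ ↔
    (‖z‖ ^ 2 - q₀ ^ 2) * z.im ≤ 0 ∧ z ≠ 0 ∧ z ≠ I * q₀ ∧ z ≠ -(I * q₀) := by
  rw [← neg_mem_closedPlus_iff, mem_closedPlus_iff hq₀]
  have : (-z = I * q₀) ↔ (z = -(I * q₀)) := neg_eq_iff_eq_neg
  simp only [norm_neg, neg_im, mul_neg, neg_eq_zero, ne_eq, neg_inj, Left.nonneg_neg_iff]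
  tauto

theorem isOpen_DPlus (q₀ : ℝ) : IsOpen (DPlus q₀) :=
  isOpen_lt continuous_const (by fun_prop)

theorem isOpen_DMinus (q₀ : ℝ) : IsOpen (DMinus q₀) :=
  isOpen_lt (by fun_prop) continuous_const

/-! ### The propagator of the constant background -/

theorem norm_exp_sub_exp_le {w w' : ℂ} (h : w.re ≤ 0) (h' : w'.re ≤ 0) :
    ‖exp w - exp w'‖ ≤ ‖w - w'‖ := by
  have := (convex_halfSpace_re_le 0).norm_image_sub_le_of_norm_hasDerivWithin_le (f := exp)
    (f' := exp) (C := 1) (fun x _ => (hasDerivAt_exp x).hasDerivWithinAt)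
    (fun x hx => by
      rw [norm_exp]
      exact Real.exp_le_one_iff.2 hx) h' h
  simpa using this

/-- The diagonal part of the propagator. -/
noncomputable def propA (l : ℂ) (s : ℝ) : ℂ := (1 + exp (-(2 * I * l * s))) / 2

/-- The coefficient of the off-diagonal part of the propagator. -/
noncomputable def propB (l : ℂ) (s : ℝ) : ℂ := (1 - exp (-(2 * I * l * s))) / (2 * l)

theorem re_phase_nonpos {l : ℂ} (hl : 0 ≤ l.im) {s : ℝ} (hs : s ≤ 0) :
    (-(2 * I * l * s)).re ≤ 0 := by
  have : (-(2 * I * l * s)).re = 2 * (l.im * s) := by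
    simp
    ring
  rw [this]
  nlinarith

theorem norm_exp_phase_le {l : ℂ} (hl : 0 ≤ l.im) {s : ℝ} (hs : s ≤ 0) :
    ‖exp (-(2 * I * l * s))‖ ≤ 1 := by
  rw [norm_exp]
  exact Real.exp_le_one_iff.2 (re_phase_nonpos hl hs)

theorem norm_exp_phase_sub_le {l l' : ℂ} (hl : 0 ≤ l.im) (hl' : 0 ≤ l'.im) {s : ℝ} (hs : s ≤ 0) :
    ‖exp (-(2 * I * l * s)) - exp (-(2 * I * l' * s))‖ ≤ 2 * |s| * ‖l - l'‖ := by
  refine (norm_exp_sub_exp_le (re_phase_nonpos hl hs) (re_phase_nonpos hl' hs)).trans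
    (le_of_eq ?_)
  have : -(2 * I * l * s) - -(2 * I * l' * s) = -(2 * I * s) * (l - l') := by ring
  rw [this]
  simp

theorem norm_propA_le {l : ℂ} (hl : 0 ≤ l.im) {s : ℝ} (hs : s ≤ 0) : ‖propA l s‖ ≤ 1 := by
  rw [propA, norm_div]
  have := norm_add_le 1 (exp (-(2 * I * l * s)))
  have h2 := norm_exp_phase_le hl hs
  simp only [norm_one] at this
  rw [RCLike.norm_ofNat, div_le_iff₀ two_pos]
  linarith

theorem norm_propB_le_inv {l : ℂ} (hl : 0 ≤ l.im) {s : ℝ} (hs : s ≤ 0) :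
    ‖propB l s‖ ≤ 1 / ‖l‖ := by
  rw [propB, norm_div, norm_mul, RCLike.norm_ofNat]
  have := norm_sub_le 1 (exp (-(2 * I * l * s)))
  have h2 := norm_exp_phase_le hl hs
  simp only [norm_one] at this
  calc _ ≤ 2 / (2 * ‖l‖) := by gcongr; linarith
    _ = _ := by rw [← div_div, div_self two_ne_zero]

theorem hasDerivAt_phase (l : ℂ) (s : ℝ) : HasDerivAt (fun s : ℝ => exp (-(2 * I * l * s)))
    (-(2 * I * l) * exp (-(2 * I * l * s))) s := by
  have h1 : HasDerivAt (fun s : ℝ => -(2 * I * l * (s : ℂ))) (-(2 * I * l * 1)) s :=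
    ((hasDerivAt_id s).ofReal_comp.const_mul (2 * I * l)).neg
  refine h1.cexp.congr_deriv ?_
  ring

theorem hasDerivAt_propA (l : ℂ) (s : ℝ) :
    HasDerivAt (propA l) (-(I * l) * exp (-(2 * I * l * s))) s := by
  refine (((hasDerivAt_phase l s).const_add 1).div_const 2).congr_deriv ?_
  ring

theorem hasDerivAt_propB {l : ℂ} (hl : l ≠ 0) (s : ℝ) :
    HasDerivAt (propB l) (I * exp (-(2 * I * l * s))) s := by
  refine (((hasDerivAt_phase l s).const_sub 1).div_const (2 * l)).congr_deriv ?_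
  field_simp

theorem norm_propB_le {l : ℂ} (hl : 0 ≤ l.im) (hl0 : l ≠ 0) {s : ℝ} (hs : s ≤ 0) :
    ‖propB l s‖ ≤ |s| := by
  have := (convex_Iic (0 : ℝ)).norm_image_sub_le_of_norm_hasDerivWithin_le (f := propB l)
    (C := 1) (fun x _ => (hasDerivAt_propB hl0 x).hasDerivWithinAt)
    (fun x hx => by
      rw [norm_mul, norm_I, one_mul]
      exact norm_exp_phase_le hl hx) (Set.self_mem_Iic) hs
  simpa [propB] using this

theorem norm_propA_sub_le {l l' : ℂ} (hl : 0 ≤ l.im) (hl' : 0 ≤ l'.im) {s : ℝ} (hs : s ≤ 0) :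
    ‖propA l s - propA l' s‖ ≤ |s| * ‖l - l'‖ := by
  have e : propA l s - propA l' s =
      (exp (-(2 * I * l * s)) - exp (-(2 * I * l' * s))) / 2 := by
    simp only [propA]
    ring
  rw [e, norm_div, RCLike.norm_ofNat, div_le_iff₀ two_pos]
  linarith [norm_exp_phase_sub_le hl hl' hs]

theorem norm_propB_sub_le {l l' : ℂ} (hl : 0 ≤ l.im) (hl' : 0 ≤ l'.im) (hl0 : l ≠ 0)
    (hl0' : l' ≠ 0) {s : ℝ} (hs : s ≤ 0) :
    ‖propB l s - propB l' s‖ ≤ 2 * |s| ^ 2 * ‖l - l'‖ := by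
  have := (convex_Icc s (0 : ℝ)).norm_image_sub_le_of_norm_hasDerivWithin_le
    (f := fun s => propB l s - propB l' s) (C := 2 * |s| * ‖l - l'‖)
    (fun x _ => ((hasDerivAt_propB hl0 x).sub (hasDerivAt_propB hl0' x)).hasDerivWithinAt)
    (fun x hx => by
      rw [← mul_sub, norm_mul, norm_I, one_mul]
      refine (norm_exp_phase_sub_le hl hl' hx.2).trans ?_
      have : |x| ≤ |s| := by
        rw [abs_of_nonpos hx.2, abs_of_nonpos hs]
        linarith [hx.1]
      gcongr) (Set.right_mem_Icc.2 hs) (Set.left_mem_Icc.2 hs)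
  simp only [propB, sub_self, ofReal_zero, mul_zero, neg_zero, exp_zero, zero_div, sub_zero,
    Real.norm_eq_abs] at this ⊢
  refine this.trans (le_of_eq ?_)
  ring

/-- A `2 × 2` matrix as a continuous linear map. -/
noncomputable def matCLM (a b c d : ℂ) : (Fin 2 → ℂ) →L[ℂ] (Fin 2 → ℂ) :=
  a • ContinuousLinearMap.pi ![ContinuousLinearMap.proj 0, 0] +
  b • ContinuousLinearMap.pi ![ContinuousLinearMap.proj 1, 0] +
  c • ContinuousLinearMap.pi ![0, ContinuousLinearMap.proj 0] +
  d • ContinuousLinearMap.pi ![0, ContinuousLinearMap.proj 1]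

theorem matCLM_apply_zero (a b c d : ℂ) (v : Fin 2 → ℂ) :
    matCLM a b c d v 0 = a * v 0 + b * v 1 := by
  simp [matCLM]

theorem matCLM_apply_one (a b c d : ℂ) (v : Fin 2 → ℂ) :
    matCLM a b c d v 1 = c * v 0 + d * v 1 := by
  simp [matCLM]

theorem matCLM_sub (a b c d a' b' c' d' : ℂ) :
    matCLM a b c d - matCLM a' b' c' d' = matCLM (a - a') (b - b') (c - c') (d - d') := by
  simp only [matCLM]
  module

theorem norm_matCLM_le (a b c d : ℂ) : ‖matCLM a b c d‖ ≤ ‖a‖ + ‖b‖ + ‖c‖ + ‖d‖ := by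
  refine ContinuousLinearMap.opNorm_le_bound _ (by positivity) fun v => ?_
  rw [pi_norm_le_iff_of_nonneg (by positivity)]
  have h0 := norm_le_pi_norm v 0
  have h1 := norm_le_pi_norm v 1
  have main : ∀ x y : ℂ, ‖x * v 0 + y * v 1‖ ≤ (‖x‖ + ‖y‖) * ‖v‖ := fun x y => by
    refine (norm_add_le _ _).trans ?_
    rw [norm_mul, norm_mul, add_mul]
    gcongr
  intro i
  fin_cases i
  · refine (le_of_eq (congrArg norm (matCLM_apply_zero a b c d v))).trans ((main a b).trans ?_)
    exact mul_le_mul_of_nonneg_right (by linarith [norm_nonneg c, norm_nonneg d]) (norm_nonneg _)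
  · refine (le_of_eq (congrArg norm (matCLM_apply_one a b c d v))).trans ((main c d).trans ?_)
    exact mul_le_mul_of_nonneg_right (by linarith [norm_nonneg a, norm_nonneg b]) (norm_nonneg _)

end SexticNLS

namespace SexticNLS

/-! ### Jost solutions on a half-line -/

/-- A potential that tends to `c` at `+∞`, with the first moment of the difference finite. -/
structure IsPotential (q₀ : ℝ) (q : ℝ → ℂ) (c : ℂ) : Prop where
  pos : 0 < q₀
  smooth : ContDiff ℝ 1 q
  norm_eq : ‖c‖ = q₀
  integrableOn : MeasureTheory.IntegrableOn (fun x => (1 + |x|) * ‖q x - c‖) (Set.Ici 0)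

/-- The spatial part of the Lax pair for the first column of `μ`, normalized at `+∞`. -/
structure IsJostOne (q₀ : ℝ) (q : ℝ → ℂ) (c z : ℂ) (m : ℝ → Fin 2 → ℂ) : Prop where
  deriv_zero : ∀ x, HasDerivAt (fun y => m y 0)
    (-(I * (q₀ ^ 2 / z)) * m x 0 + I * conj (q x) * m x 1) x
  deriv_one : ∀ x, HasDerivAt (fun y => m y 1) (I * q x * m x 0 - I * z * m x 1) x
  lim : Tendsto m atTop (𝓝 ![1, c / z])

/-- The kernel of the Volterra equation for the first column of `μ`. -/
noncomputable def jostKernel (q₀ : ℝ) (q : ℝ → ℂ) (c z : ℂ) (x y : ℝ) :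
    (Fin 2 → ℂ) →L[ℂ] (Fin 2 → ℂ) :=
  matCLM (-(propB (lam q₀ z) (x - y) * conj c * (I * (q y - c))))
    (-((propA (lam q₀ z) (x - y) + propB (lam q₀ z) (x - y) * kfun q₀ z) * (I * conj (q y - c))))
    (-((propA (lam q₀ z) (x - y) - propB (lam q₀ z) (x - y) * kfun q₀ z) * (I * (q y - c))))
    (-(propB (lam q₀ z) (x - y) * c * (I * conj (q y - c))))

/-- A bound for the kernel of the Volterra equation. -/
noncomputable def jostWeight (q : ℝ → ℂ) (c : ℂ) (a B : ℝ) (y : ℝ) : ℝ :=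
  2 * (1 + B) * (1 + |a|) * ((1 + |y|) * ‖q y - c‖)

variable {q₀ : ℝ} {q : ℝ → ℂ} {c z : ℂ} {m : ℝ → Fin 2 → ℂ}

theorem lam_ne_zero (h : z ∈ closedPlus q₀) (hq₀ : 0 < q₀) : lam q₀ z ≠ 0 := by
  obtain ⟨_, h0, h1, h2⟩ := (mem_closedPlus_iff hq₀).1 h
  rw [lam_eq_mul_gam q₀ h0]
  exact div_ne_zero (mul_ne_zero h0 (gam_ne_zero h0 h1 h2)) two_ne_zero

theorem im_lam_nonneg (h : z ∈ closedPlus q₀) (hq₀ : 0 < q₀) : 0 ≤ (lam q₀ z).im := by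
  obtain ⟨h, h0, _, _⟩ := (mem_closedPlus_iff hq₀).1 h
  rw [im_lam q₀ z h0]
  positivity

theorem IsPotential.continuous (hq : IsPotential q₀ q c) : Continuous q := hq.smooth.continuous

theorem IsPotential.continuous_jostWeight (hq : IsPotential q₀ q c) (a B : ℝ) :
    Continuous (jostWeight q c a B) := by
  have := hq.continuous
  unfold jostWeight
  fun_prop

theorem jostWeight_nonneg {a B : ℝ} (hB : 0 ≤ B) (y : ℝ) : 0 ≤ jostWeight q c a B y := by
  unfold jostWeight
  positivity

theorem IsPotential.integrableOn_jostWeight (hq : IsPotential q₀ q c) (a B : ℝ) :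
    MeasureTheory.IntegrableOn (jostWeight q c a B) (Set.Ioi a) := by
  have h1 := (hq.continuous_jostWeight a B).integrableOn_Icc (μ := MeasureTheory.volume)
    (a := a) (b := 0)
  have h2 : MeasureTheory.IntegrableOn (jostWeight q c a B) (Set.Ici 0) :=
    hq.integrableOn.const_mul _
  refine (h1.union h2).mono_set fun x hx => ?_
  rcases le_total x 0 with h | h
  · exact Or.inl ⟨le_of_lt hx, h⟩
  · exact Or.inr h

theorem one_add_abs_mul_le {a x y B : ℝ} (hB : 0 ≤ B) (hx : a ≤ x) (hxy : x ≤ y) :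
    1 + |x - y| * B ≤ (1 + B) * (1 + |a|) * (1 + |y|) := by
  have h1 : |x - y| ≤ |a| + |y| := by
    rw [abs_of_nonpos (by linarith)]
    linarith [neg_abs_le a, le_abs_self y]
  have h2 := mul_le_mul_of_nonneg_right h1 hB
  have ha := abs_nonneg a
  have hy := abs_nonneg y
  have : 0 ≤ |a| + |y| + |a| * |y| + B * (1 + |a| * |y|) := by positivity
  nlinarith

theorem norm_jostKernel_le (hq : IsPotential q₀ q c) {a B : ℝ} (hz : z ∈ closedPlus q₀)
    (hB : ‖kfun q₀ z‖ + q₀ ≤ B ∨ ‖kfun q₀ z‖ + q₀ ≤ B * ‖lam q₀ z‖) {x y : ℝ} (hx : a ≤ x)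
    (hxy : x ≤ y) : ‖jostKernel q₀ q c z x y‖ ≤ jostWeight q c a B y := by
  have hs : x - y ≤ 0 := by linarith
  have hl := im_lam_nonneg hz hq.pos
  have hl0 := lam_ne_zero hz hq.pos
  have hlp : 0 < ‖lam q₀ z‖ := norm_pos_iff.2 hl0
  have hk := norm_nonneg (kfun q₀ z)
  have hB0 : 0 ≤ B := by
    have := hq.pos
    rcases hB with h | h
    · linarith
    · by_contra hneg
      nlinarith
  have hA1 := norm_propA_le hl hs
  have hβ : 1 + ‖propB (lam q₀ z) (x - y)‖ * (‖kfun q₀ z‖ + q₀) ≤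
      (1 + B) * (1 + |a|) * (1 + |y|) := by
    rcases hB with h | h
    · refine le_trans ?_ (one_add_abs_mul_le hB0 hx hxy)
      have := norm_propB_le hl hl0 hs
      have := mul_le_mul this h (by linarith [hq.pos]) (abs_nonneg _)
      linarith
    · have h1 := norm_propB_le_inv hl hs
      have h2 := mul_le_mul h1 h (by linarith [hq.pos]) (by positivity)
      have h3 : 1 / ‖lam q₀ z‖ * (B * ‖lam q₀ z‖) = B := by field_simp
      rw [h3] at h2
      have ha := abs_nonneg a
      have hy := abs_nonneg y
      have : 0 ≤ (1 + B) * (|a| + |y| + |a| * |y|) := by positivity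
      nlinarith
  set β := propB (lam q₀ z) (x - y)
  set α := propA (lam q₀ z) (x - y)
  refine (norm_matCLM_le _ _ _ _).trans ?_
  simp only [norm_neg, norm_mul, norm_I, one_mul, RCLike.norm_conj, hq.norm_eq]
  have n1 : ‖α + β * kfun q₀ z‖ ≤ 1 + ‖β‖ * ‖kfun q₀ z‖ := by
    refine (norm_add_le _ _).trans ?_
    rw [norm_mul]
    linarith
  have n2 : ‖α - β * kfun q₀ z‖ ≤ 1 + ‖β‖ * ‖kfun q₀ z‖ := by
    refine (norm_sub_le _ _).trans ?_
    rw [norm_mul]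
    linarith
  have hd := norm_nonneg (q y - c)
  have m1 := mul_le_mul_of_nonneg_right n1 hd
  have m2 := mul_le_mul_of_nonneg_right n2 hd
  have m3 := mul_le_mul_of_nonneg_right hβ hd
  unfold jostWeight
  nlinarith

theorem continuous_jostKernel (hq : IsPotential q₀ q c) (x : ℝ) :
    Continuous (jostKernel q₀ q c z x) := by
  have := hq.continuous
  have hc : Continuous fun y => conj (q y - c) := continuous_conj.comp (by fun_prop)
  unfold jostKernel matCLM propA propB
  fun_prop

theorem IsJostOne.hasDerivAt (h : IsJostOne q₀ q c z m) (x : ℝ) :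
    HasDerivAt m ![-(I * (q₀ ^ 2 / z)) * m x 0 + I * conj (q x) * m x 1,
      I * q x * m x 0 - I * z * m x 1] x := by
  rw [hasDerivAt_pi]
  intro i
  fin_cases i
  · exact h.deriv_zero x
  · exact h.deriv_one x

theorem IsJostOne.continuous (h : IsJostOne q₀ q c z m) : Continuous m :=
  continuous_iff_continuousAt.2 fun x => (h.hasDerivAt x).continuousAt

theorem IsJostOne.bounded (h : IsJostOne q₀ q c z m) (a : ℝ) : ∃ M, ∀ x, a ≤ x → ‖m x‖ ≤ M := by
  obtain ⟨R, hR⟩ := eventually_atTop.1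
    (h.lim.norm.eventually (gt_mem_nhds (lt_add_one ‖![1, c / z]‖)))
  obtain ⟨C, hC⟩ := (isCompact_Icc (a := a) (b := R)).exists_bound_of_continuousOn
    h.continuous.continuousOn
  refine ⟨max C (‖![1, c / z]‖ + 1), fun x hx => ?_⟩
  rcases le_total x R with h | h
  · exact (hC x ⟨hx, h⟩).trans (le_max_left _ _)
  · exact (hR x h).le.trans (le_max_right _ _)

theorem mul_conj_eq_sq (hq : IsPotential q₀ q c) : c * conj c = (q₀ : ℂ) ^ 2 := by
  rw [mul_conj, normSq_eq_norm_sq, hq.norm_eq]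
  norm_cast

open MeasureTheory in
/-- The Volterra integral equation for Jost solutions. -/
theorem IsJostOne.isVolterra (hq : IsPotential q₀ q c) {a B : ℝ} (hz : z ∈ closedPlus q₀)
    (hB : ‖kfun q₀ z‖ + q₀ ≤ B ∨ ‖kfun q₀ z‖ + q₀ ≤ B * ‖lam q₀ z‖)
    (h : IsJostOne q₀ q c z m) :
    IsVolterra a (jostWeight q c a B) (jostKernel q₀ q c z) (fun _ => ![1, c / z]) m where
  kernel_cont := continuous_jostKernel hq
  kernel_le := fun x y => norm_jostKernel_le hq hz hB
  cont := h.continuous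
  bdd := h.bounded a
  eq := by
    intro x hx
    have hz0 : z ≠ 0 := ((mem_closedPlus_iff hq.pos).1 hz).2.1
    have hl := im_lam_nonneg hz hq.pos
    have hl0 := lam_ne_zero hz hq.pos
    have hcc := mul_conj_eq_sq hq
    have hkz : z = kfun q₀ z + lam q₀ z := (kfun_add_lam q₀ z).symm
    have hqz : (q₀ : ℂ) ^ 2 / z = lam q₀ z - kfun q₀ z := by
      linear_combination kfun_sub_lam q₀ z
    have hll := lam_sq q₀ hz0
    have hcz : c / z * (kfun q₀ z + lam q₀ z) = c := by rw [← hkz]; field_simp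
    have hcz' : conj c * (c / z) = lam q₀ z - kfun q₀ z := by
      rw [← hqz, ← hcc]
      ring
    set k := kfun q₀ z
    set l := lam q₀ z
    set G : ℝ → (Fin 2 → ℂ) := fun y =>
      matCLM (propA l (x - y) + propB l (x - y) * k) (propB l (x - y) * conj c)
        (propB l (x - y) * c) (propA l (x - y) - propB l (x - y) * k) (m y) with hG
    have hAd : ∀ y, HasDerivAt (fun y : ℝ => propA l (x - y))
        (I * l * exp (-(2 * I * l * (x - y : ℝ)))) y := fun y => by
      refine ((hasDerivAt_propA l (x - y)).scomp y
        ((hasDerivAt_id y).const_sub x)).congr_deriv ?_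
      simp
    have hBd : ∀ y, HasDerivAt (fun y : ℝ => propB l (x - y))
        (-(I * exp (-(2 * I * l * (x - y : ℝ))))) y := fun y => by
      refine ((hasDerivAt_propB hl0 (x - y)).scomp y
        ((hasDerivAt_id y).const_sub x)).congr_deriv ?_
      simp
    have hexp : ∀ y : ℝ, exp (-(2 * I * l * (x - y : ℝ))) = 1 - 2 * l * propB l (x - y) :=
      fun y => by
        simp only [propB]
        field_simp
        ring
    have hA : ∀ y : ℝ, propA l (x - y) = 1 - l * propB l (x - y) := fun y => by
      simp only [propA, hexp]
      ring
    have hGd : ∀ y, HasDerivAt G (-(jostKernel q₀ q c z x y (m y))) y := by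
      intro y
      rw [hasDerivAt_pi]
      have hm0 := h.deriv_zero y
      have hm1 := h.deriv_one y
      rw [hqz] at hm0
      rw [hkz] at hm1
      intro i
      fin_cases i
      · simp only [hG, Fin.zero_eta, matCLM_apply_zero, Pi.neg_apply, jostKernel]
        refine ((((hAd y).add ((hBd y).mul_const k)).mul hm0).add
          (((hBd y).mul_const (conj c)).mul hm1)).congr_deriv ?_
        simp only [Pi.add_apply]
        rw [hexp, hA, map_sub]
        linear_combination (I * m y 0 * propB l (x - y)) * (hcc - hll)
      · simp only [hG, Fin.mk_one, matCLM_apply_one, Pi.neg_apply, jostKernel]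
        refine ((((hBd y).mul_const c).mul hm0).add
          (((hAd y).sub ((hBd y).mul_const k)).mul hm1)).congr_deriv ?_
        simp only [Pi.sub_apply]
        rw [hexp, hA, map_sub]
        linear_combination (I * m y 1 * propB l (x - y)) * (hcc - hll)
    have hlim : Tendsto G atTop (𝓝 ![1, c / z]) := by
      have hfix : ∀ y, G y - ![1, c / z] =
          matCLM (propA l (x - y) + propB l (x - y) * k) (propB l (x - y) * conj c)
          (propB l (x - y) * c) (propA l (x - y) - propB l (x - y) * k) (m y - ![1, c / z]) := by
        intro y
        rw [map_sub]
        congr 1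
        funext i
        fin_cases i
        · simp only [Fin.zero_eta, matCLM_apply_zero]
          simp
          rw [hA]
          linear_combination -(propB l (x - y)) * hcz'
        · simp only [Fin.mk_one, matCLM_apply_one]
          simp
          rw [hA]
          linear_combination (propB l (x - y)) * hcz
      rw [tendsto_iff_norm_sub_tendsto_zero]
      set C := 2 * (1 + 1 / ‖l‖ * (‖k‖ + ‖c‖))
      have h0 : Tendsto (fun y => C * ‖m y - ![1, c / z]‖) atTop (𝓝 (C * 0)) :=
        (tendsto_iff_norm_sub_tendsto_zero.1 h.lim).const_mul C
      rw [mul_zero] at h0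
      refine squeeze_zero' (Eventually.of_forall fun _ => norm_nonneg _) ?_ h0
      filter_upwards [eventually_ge_atTop x] with y hy
      rw [hfix]
      refine (ContinuousLinearMap.le_opNorm _ _).trans ?_
      refine mul_le_mul_of_nonneg_right ((norm_matCLM_le _ _ _ _).trans ?_) (norm_nonneg _)
      have hs : x - y ≤ 0 := by linarith
      have hA1 := norm_propA_le hl hs
      have hB1 := norm_propB_le_inv hl hs
      have n1 := norm_add_le (propA l (x - y)) (propB l (x - y) * k)
      have n2 := norm_sub_le (propA l (x - y)) (propB l (x - y) * k)
      have hk := mul_le_mul_of_nonneg_right hB1 (norm_nonneg k)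
      have hc := mul_le_mul_of_nonneg_right hB1 (norm_nonneg c)
      simp only [norm_mul, RCLike.norm_conj] at n1 n2 ⊢
      simp only [C]
      linarith
    have hint : IntegrableOn (fun y => jostKernel q₀ q c z x y (m y)) (Set.Ioi x) := by
      obtain ⟨M, hM⟩ := h.bounded a
      refine (((hq.integrableOn_jostWeight a B).mono_set (Set.Ioi_subset_Ioi hx)).mul_const M).mono'
        ((continuous_jostKernel hq x).clm_apply h.continuous).aestronglyMeasurable ?_
      filter_upwards [ae_restrict_mem measurableSet_Ioi] with y hy
      have h1 := norm_jostKernel_le (a := a) hq hz hB hx (le_of_lt hy)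
      exact (ContinuousLinearMap.le_opNorm _ _).trans (mul_le_mul h1
        (hM y (hx.trans (le_of_lt hy))) (norm_nonneg _) ((norm_nonneg _).trans h1))
    have := integral_Ioi_of_hasDerivAt_of_tendsto (hGd x).continuousAt.continuousWithinAt
      (fun y _ => hGd y) hint.neg hlim
    rw [integral_neg] at this
    have hGx : G x = m x := by
      funext i
      fin_cases i
      · simp [hG, matCLM_apply_zero, propA, propB]
      · simp [hG, matCLM_apply_one, propA, propB]
    rw [hGx] at this
    rw [neg_eq_iff_eq_neg.1 this]
    abel

end SexticNLS

namespace SexticNLS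

variable {q₀ : ℝ} {q : ℝ → ℂ} {c z : ℂ} {m : ℝ → Fin 2 → ℂ}

theorem zero_notMem_closedPlus (hq₀ : 0 < q₀) : (0 : ℂ) ∉ closedPlus q₀ := fun h =>
  ((mem_closedPlus_iff hq₀).1 h).2.1 rfl

theorem IsJostOne.unique (hq : IsPotential q₀ q c) (hz : z ∈ closedPlus q₀) {m' : ℝ → Fin 2 → ℂ}
    (h : IsJostOne q₀ q c z m) (h' : IsJostOne q₀ q c z m') : m = m' := by
  funext x
  have hB : (0 : ℝ) ≤ ‖kfun q₀ z‖ + q₀ := by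
    have := hq.pos
    positivity
  have h1 := h.isVolterra hq (a := x) hz (Or.inl le_rfl)
  have h2 := h'.isVolterra hq (a := x) hz (Or.inl le_rfl)
  have := (h1.sub (hq.integrableOn_jostWeight _ _) h2).norm_le (hq.continuous_jostWeight _ _)
    (jostWeight_nonneg hB) (hq.integrableOn_jostWeight _ _) (ε := 0) (fun y _ => by simp) x le_rfl
  rw [zero_mul] at this
  exact sub_eq_zero.1 (norm_le_zero_iff.1 this)

theorem continuousAt_kfun (hz : z ≠ 0) : ContinuousAt (kfun q₀) z := by
  unfold kfun
  fun_prop (disch := exact hz)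

theorem continuousAt_lam (hz : z ≠ 0) : ContinuousAt (lam q₀) z := by
  unfold lam
  fun_prop (disch := exact hz)

theorem differentiableAt_kfun (hz : z ≠ 0) : DifferentiableAt ℂ (kfun q₀) z := by
  unfold kfun
  fun_prop (disch := exact hz)

theorem differentiableAt_lam (hz : z ≠ 0) : DifferentiableAt ℂ (lam q₀) z := by
  unfold lam
  fun_prop (disch := exact hz)

theorem eventually_norm_kfun_le (hz : z ≠ 0) :
    ∀ᶠ y in 𝓝 z, ‖kfun q₀ y‖ + q₀ ≤ ‖kfun q₀ z‖ + q₀ + 1 := by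
  have := (continuousAt_kfun (q₀ := q₀) hz).norm.tendsto.eventually (gt_mem_nhds (lt_add_one _))
  exact this.mono fun y hy => by linarith

theorem differentiableAt_jostKernel (hz : z ≠ 0) (hl : lam q₀ z ≠ 0) (x y : ℝ) :
    DifferentiableAt ℂ (fun z => jostKernel q₀ q c z x y) z := by
  have h1 := differentiableAt_kfun (q₀ := q₀) hz
  have h2 := differentiableAt_lam (q₀ := q₀) hz
  have hA : DifferentiableAt ℂ (fun z => propA (lam q₀ z) (x - y)) z := by
    unfold propA
    fun_prop
  have hB : DifferentiableAt ℂ (fun z => propB (lam q₀ z) (x - y)) z := by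
    unfold propB
    exact DifferentiableAt.div (by fun_prop) (by fun_prop) (mul_ne_zero two_ne_zero hl)
  unfold jostKernel matCLM
  fun_prop

/-- Jost solutions are analytic in `D⁺`. -/
theorem IsJostOne.differentiableAt (hq : IsPotential q₀ q c) {m : ℂ → ℝ → Fin 2 → ℂ}
    (hm : ∀ z ∈ closedPlus q₀, IsJostOne q₀ q c z (m z)) (hz : z ∈ DPlus q₀) (x : ℝ) :
    DifferentiableAt ℂ (fun z => m z x) z := by
  have hz0 : z ≠ 0 := fun h => zero_notMem_closedPlus hq.pos (h ▸ Or.inl hz)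
  obtain ⟨r, hr, h⟩ := Metric.eventually_nhds_iff_ball.1
    (((isOpen_DPlus q₀).eventually_mem hz).and (eventually_norm_kfun_le (q₀ := q₀) hz0))
  have hB : (0 : ℝ) ≤ ‖kfun q₀ z‖ + q₀ + 1 := by
    have := hq.pos
    positivity
  have hne : ∀ y ∈ Metric.ball z r, y ≠ 0 := fun y hy h0 =>
    zero_notMem_closedPlus hq.pos (h0 ▸ Or.inl (h y hy).1)
  refine IsVolterra.differentiableAt hr (hq.continuous_jostWeight x _) (jostWeight_nonneg hB)
    (hq.integrableOn_jostWeight x _) (K := jostKernel q₀ q c) (Y := fun z => ![1, c / z])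
    (fun y hy => (hm y (Or.inl (h y hy).1)).isVolterra hq (Or.inl (h y hy).1)
      (Or.inl (h y hy).2)) ?_ ?_ le_rfl
  · intro y hy
    refine DifferentiableAt.differentiableWithinAt (differentiableAt_pi.2 fun i => ?_)
    have := hne y hy
    fin_cases i
    · simp
    · simp only [Fin.mk_one, Matrix.cons_val_one, Matrix.cons_val_fin_one]
      fun_prop (disch := exact this)
  · intro x' y' _ _ y hy
    exact (differentiableAt_jostKernel (hne y hy)
      (lam_ne_zero (Or.inl (h y hy).1) hq.pos) x' y').differentiableWithinAt

theorem tendsto_normalization (hz : z ≠ 0) (c : ℂ) :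
    Tendsto (fun z => ![1, c / z]) (𝓝 z) (𝓝 ![1, c / z]) := by
  rw [tendsto_pi_nhds]
  intro i
  fin_cases i
  · simp
  · have : ContinuousAt (fun z => c / z) z := by fun_prop (disch := exact hz)
    exact this

/-- Jost solutions extend continuously to the boundary of `D⁺`, including the branch points. -/
theorem IsJostOne.exists_tendsto (hq : IsPotential q₀ q c) {m : ℂ → ℝ → Fin 2 → ℂ}
    (hm : ∀ z ∈ closedPlus q₀, IsJostOne q₀ q c z (m z)) (hz0 : z ≠ 0)
    [(𝓝[closedPlus q₀] z).NeBot] (a : ℝ) :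
    ∃ L, Tendsto (fun z => m z a) (𝓝[closedPlus q₀] z) (𝓝 L) := by
  have hB : (0 : ℝ) ≤ ‖kfun q₀ z‖ + q₀ + 1 := by
    have := hq.pos
    positivity
  set B := ‖kfun q₀ z‖ + q₀ + 1
  have hev : ∀ᶠ y in 𝓝[closedPlus q₀] z, y ∈ closedPlus q₀ ∧ ‖kfun q₀ y‖ + q₀ ≤ B := by
    filter_upwards [self_mem_nhdsWithin, nhdsWithin_le_nhds (eventually_norm_kfun_le hz0)]
      with y h1 h2
    exact ⟨h1, h2⟩
  refine IsVolterra.exists_tendsto (hq.continuous_jostWeight a B) (jostWeight_nonneg hB)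
    (hq.integrableOn_jostWeight a B) (K := jostKernel q₀ q c) (Y := fun z => ![1, c / z])
    (hev.mono fun y hy => (hm y hy.1).isVolterra hq hy.1 (Or.inl hy.2))
    ((tendsto_normalization hz0 c).mono_left nhdsWithin_le_nhds) ?_ le_rfl
  intro R ε hε
  obtain ⟨D, hD⟩ := (isCompact_Icc (a := a) (b := R)).exists_bound_of_continuousOn
    (f := fun y => q y - c) (hq.continuous.sub continuous_const).continuousOn
  set S := |R - a|
  set C := |D| * (4 * S ^ 2 * q₀ + 2 * S + 2 * S + 4 * B * S ^ 2)
  have hlk : Tendsto (fun p : ℂ × ℂ => C * (‖lam q₀ p.1 - lam q₀ p.2‖ +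
      ‖kfun q₀ p.1 - kfun q₀ p.2‖)) (𝓝[closedPlus q₀] z ×ˢ 𝓝[closedPlus q₀] z) (𝓝 0) := by
    have hl := (continuousAt_lam (q₀ := q₀) hz0).tendsto.mono_left
      (nhdsWithin_le_nhds (s := closedPlus q₀))
    have hk := (continuousAt_kfun (q₀ := q₀) hz0).tendsto.mono_left
      (nhdsWithin_le_nhds (s := closedPlus q₀))
    have := ((((hl.comp tendsto_fst).sub (hl.comp tendsto_snd)).norm).add
      (((hk.comp tendsto_fst).sub (hk.comp tendsto_snd)).norm)).const_mul C
    simpa using this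
  filter_upwards [tendsto_fst.eventually hev, tendsto_snd.eventually hev,
    hlk.eventually (gt_mem_nhds hε)] with p h1 h2 h3 x y hx hxy hy
  refine le_trans ?_ h3.le
  have hs : x - y ≤ 0 := by linarith
  have hsS : |x - y| ≤ S := by
    rw [abs_of_nonpos hs]
    refine le_trans ?_ (le_abs_self _)
    linarith
  have hS0 : 0 ≤ S := abs_nonneg _
  have l1 := im_lam_nonneg h1.1 hq.pos
  have l2 := im_lam_nonneg h2.1 hq.pos
  have n1 := lam_ne_zero h1.1 hq.pos
  have n2 := lam_ne_zero h2.1 hq.pos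
  have hd : ‖q y - c‖ ≤ |D| := (hD y ⟨hx.trans hxy, hy⟩).trans (le_abs_self _)
  have hA := norm_propA_sub_le l1 l2 hs
  have hB1 := norm_propB_sub_le l1 l2 n1 n2 hs
  have hB2 := norm_propB_le l1 n1 hs
  have hk2 : ‖kfun q₀ p.2‖ ≤ B := by linarith [h2.2, hq.pos]
  rw [jostKernel, jostKernel, matCLM_sub]
  refine (norm_matCLM_le _ _ _ _).trans ?_
  set β₁ := propB (lam q₀ p.1) (x - y)
  set β₂ := propB (lam q₀ p.2) (x - y)
  set α₁ := propA (lam q₀ p.1) (x - y)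
  set α₂ := propA (lam q₀ p.2) (x - y)
  set k₁ := kfun q₀ p.1
  set k₂ := kfun q₀ p.2
  set dl := ‖lam q₀ p.1 - lam q₀ p.2‖
  have hdl : 0 ≤ dl := norm_nonneg _
  set d := q y - c
  have e1 : -(β₁ * conj c * (I * d)) - -(β₂ * conj c * (I * d)) =
      -((β₁ - β₂) * conj c * (I * d)) := by ring
  have e2 : -((α₁ + β₁ * k₁) * (I * conj d)) - -((α₂ + β₂ * k₂) * (I * conj d)) =
      -(((α₁ - α₂) + (β₁ * (k₁ - k₂) + (β₁ - β₂) * k₂)) * (I * conj d)) := by ring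
  have e3 : -((α₁ - β₁ * k₁) * (I * d)) - -((α₂ - β₂ * k₂) * (I * d)) =
      -(((α₁ - α₂) - (β₁ * (k₁ - k₂) + (β₁ - β₂) * k₂)) * (I * d)) := by ring
  have e4 : -(β₁ * c * (I * conj d)) - -(β₂ * c * (I * conj d)) =
      -((β₁ - β₂) * c * (I * conj d)) := by ring
  rw [e1, e2, e3, e4]
  simp only [norm_neg, norm_mul, norm_I, one_mul, RCLike.norm_conj, hq.norm_eq]
  have hA' : ‖α₁ - α₂‖ ≤ S * dl := hA.trans (by gcongr)
  have hB1' : ‖β₁ - β₂‖ ≤ 2 * S ^ 2 * dl := hB1.trans (by gcongr)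
  have hBk : ‖β₁ * (k₁ - k₂) + (β₁ - β₂) * k₂‖ ≤ S * ‖k₁ - k₂‖ + 2 * S ^ 2 * dl * B := by
    refine (norm_add_le _ _).trans ?_
    rw [norm_mul, norm_mul]
    gcongr
    exact hB2.trans hsS
  have g1 := norm_add_le (α₁ - α₂) (β₁ * (k₁ - k₂) + (β₁ - β₂) * k₂)
  have g2 := norm_sub_le (α₁ - α₂) (β₁ * (k₁ - k₂) + (β₁ - β₂) * k₂)
  have hq0 := hq.pos.le
  have hdk := norm_nonneg (k₁ - k₂)
  calc _ ≤ (2 * S ^ 2 * dl) * q₀ * |D| +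
        (S * dl + (S * ‖k₁ - k₂‖ + 2 * S ^ 2 * dl * B)) * |D| +
        (S * dl + (S * ‖k₁ - k₂‖ + 2 * S ^ 2 * dl * B)) * |D| +
        (2 * S ^ 2 * dl) * q₀ * |D| := by
        gcongr
        · linarith
        · linarith
    _ = |D| * ((4 * S ^ 2 * q₀ + 2 * S + 4 * B * S ^ 2) * dl + 2 * S * ‖k₁ - k₂‖) := by ring
    _ ≤ _ := by
        have : 0 ≤ |D| * (2 * S * dl + (4 * S ^ 2 * q₀ + 2 * S + 4 * B * S ^ 2) * ‖k₁ - k₂‖) := by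
          positivity
        simp only [C]
        linarith

theorem IsJostOne.continuousWithinAt (hq : IsPotential q₀ q c) {m : ℂ → ℝ → Fin 2 → ℂ}
    (hm : ∀ z ∈ closedPlus q₀, IsJostOne q₀ q c z (m z)) (hz : z ∈ closedPlus q₀) (a : ℝ) :
    ContinuousWithinAt (fun z => m z a) (closedPlus q₀) z := by
  have : (𝓝[closedPlus q₀] z).NeBot := mem_closure_iff_nhdsWithin_neBot.1 (subset_closure hz)
  obtain ⟨L, hL⟩ := IsJostOne.exists_tendsto hq hm ((mem_closedPlus_iff hq.pos).1 hz).2.1 a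
  have h1 : Tendsto (fun z => m z a) (pure z) (𝓝 L) := hL.mono_left (pure_le_nhdsWithin hz)
  have h2 : m z a = L := tendsto_nhds_unique (tendsto_pure_nhds _ _) h1
  rw [ContinuousWithinAt, h2]
  exact hL

theorem one_le_norm_normalization (w : ℂ) : 1 ≤ ‖(![1, w] : Fin 2 → ℂ)‖ := by
  have := norm_le_pi_norm (![1, w] : Fin 2 → ℂ) 0
  simpa using this

theorem exists_tail_lt {w : ℝ → ℝ} {a : ℝ}
    (hwi : MeasureTheory.IntegrableOn w (Set.Ioi a)) {η : ℝ} (hη : 0 < η) :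
    ∀ᶠ R in atTop, ∫ y in Set.Ioi R, w y < η := by
  have h2 := (MeasureTheory.intervalIntegral_tendsto_integral_Ioi a hwi tendsto_id).const_sub
    (∫ y in Set.Ioi a, w y)
  rw [sub_self] at h2
  filter_upwards [h2.eventually (gt_mem_nhds hη), eventually_ge_atTop a] with R h hR
  refine lt_of_eq_of_lt ?_ h
  rw [eq_comm, sub_eq_iff_eq_add, id, intervalIntegral.integral_of_le hR, add_comm,
    ← MeasureTheory.setIntegral_union (Set.Ioc_disjoint_Ioi le_rfl) measurableSet_Ioi
    (hwi.mono_set Set.Ioc_subset_Ioi_self) (hwi.mono_set (Set.Ioi_subset_Ioi hR)),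
    Set.Ioc_union_Ioi_eq_Ioi hR]

theorem IsJostOne.norm_deriv_le {Q : ℝ} {x : ℝ} (hQ : ‖q x‖ ≤ Q) :
    ‖(![-(I * (q₀ ^ 2 / z)) * m x 0 + I * conj (q x) * m x 1,
      I * q x * m x 0 - I * z * m x 1] : Fin 2 → ℂ)‖ ≤ (q₀ ^ 2 / ‖z‖ + Q + ‖z‖) * ‖m x‖ := by
  have hQ0 : 0 ≤ Q := (norm_nonneg _).trans hQ
  have h0 := norm_le_pi_norm (m x) 0
  have h1 := norm_le_pi_norm (m x) 1
  rw [pi_norm_le_iff_of_nonneg (by positivity)]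
  intro i
  fin_cases i
  · refine (norm_add_le _ _).trans ?_
    simp only [norm_neg, norm_mul, norm_I, one_mul, RCLike.norm_conj, norm_div, norm_pow,
      norm_real, Real.norm_eq_abs, sq_abs]
    have : 0 ≤ ‖z‖ * ‖m x‖ := by positivity
    calc _ ≤ q₀ ^ 2 / ‖z‖ * ‖m x‖ + Q * ‖m x‖ := by gcongr
      _ ≤ _ := by linarith
  · refine (norm_sub_le _ _).trans ?_
    simp only [norm_mul, norm_I, one_mul]
    have : 0 ≤ q₀ ^ 2 / ‖z‖ * ‖m x‖ := by positivity
    calc _ ≤ Q * ‖m x‖ + ‖z‖ * ‖m x‖ := by gcongr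
      _ ≤ _ := by linarith

/-- Limits of Jost solutions at the boundary of `D⁺` do not vanish. -/
theorem IsJostOne.limit_ne_zero (hq : IsPotential q₀ q c) {m : ℂ → ℝ → Fin 2 → ℂ}
    (hm : ∀ z ∈ closedPlus q₀, IsJostOne q₀ q c z (m z)) (hz0 : z ≠ 0)
    [(𝓝[closedPlus q₀] z).NeBot] {a : ℝ} {L : Fin 2 → ℂ}
    (hL : Tendsto (fun z => m z a) (𝓝[closedPlus q₀] z) (𝓝 L)) : L ≠ 0 := by
  rintro rfl
  have hB : (0 : ℝ) ≤ ‖kfun q₀ z‖ + q₀ + 1 := by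
    have := hq.pos
    positivity
  set B := ‖kfun q₀ z‖ + q₀ + 1
  set w := jostWeight q c a B
  have hwi : MeasureTheory.IntegrableOn w (Set.Ioi a) := hq.integrableOn_jostWeight a B
  set M := (‖![1, c / z]‖ + 1) * Real.exp (∫ y in Set.Ioi a, w y)
  have hM : 0 < M := by positivity
  obtain ⟨R, hR, hRa⟩ := ((exists_tail_lt hwi (show 0 < 1 / (2 * M) by positivity)).and
    (eventually_ge_atTop a)).exists
  obtain ⟨Q, hQ⟩ := (isCompact_Icc (a := a) (b := R)).exists_bound_of_continuousOn
    (f := q) hq.continuous.continuousOn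
  have hQ0 : 0 ≤ Q := (norm_nonneg _).trans (hQ a ⟨le_rfl, hRa⟩)
  set C := q₀ ^ 2 / ‖z‖ + 1 + Q + (‖z‖ + 1)
  have hev : ∀ᶠ y in 𝓝[closedPlus q₀] z, 1 / 2 ≤ Real.exp (C * (R - a)) * ‖m y a‖ := by
    have e1 := ((tendsto_normalization hz0 c).norm.eventually
      (gt_mem_nhds (lt_add_one _))).filter_mono (nhdsWithin_le_nhds (s := closedPlus q₀))
    have e2 : ∀ᶠ y in 𝓝 z, q₀ ^ 2 / ‖y‖ < q₀ ^ 2 / ‖z‖ + 1 := by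
      have : ContinuousAt (fun y : ℂ => q₀ ^ 2 / ‖y‖) z :=
        continuousAt_const.div continuous_norm.continuousAt (norm_ne_zero_iff.2 hz0)
      exact this.tendsto.eventually (gt_mem_nhds (lt_add_one _))
    have e3 : ∀ᶠ y in 𝓝 z, ‖y‖ < ‖z‖ + 1 :=
      (continuous_norm.tendsto z).eventually (gt_mem_nhds (lt_add_one _))
    filter_upwards [self_mem_nhdsWithin, nhdsWithin_le_nhds (eventually_norm_kfun_le hz0), e1,
      nhdsWithin_le_nhds e2, nhdsWithin_le_nhds e3] with y h1 h2 h3 h4 h5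
    have hV := (hm y h1).isVolterra hq (a := a) h1 (Or.inl h2)
    have hbd := hV.norm_le (hq.continuous_jostWeight a B) (jostWeight_nonneg hB) hwi
      (fun _ _ => h3.le)
    have hdev := hV.norm_sub_le hwi hbd R hRa
    have h6 : M * ∫ y in Set.Ioi R, w y ≤ 1 / 2 := by
      calc _ ≤ M * (1 / (2 * M)) := by gcongr
        _ = 1 / 2 := by field_simp
    have h7 : 1 / 2 ≤ ‖m y R‖ := by
      have := norm_sub_norm_le (![1, c / y] : Fin 2 → ℂ) (m y R)
      rw [norm_sub_rev] at hdev
      linarith [one_le_norm_normalization (c / y)]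
    refine h7.trans ?_
    refine norm_le_exp_mul_norm (a := a) (b := R) (by positivity)
      (fun x _ => (hm y h1).hasDerivAt x) (fun x hx => ?_) ⟨le_rfl, hRa⟩ ⟨hRa, le_rfl⟩
    refine (IsJostOne.norm_deriv_le (hQ x hx)).trans (mul_le_mul_of_nonneg_right ?_ (norm_nonneg _))
    show _ ≤ q₀ ^ 2 / ‖z‖ + 1 + Q + (‖z‖ + 1)
    linarith
  have hlim : Tendsto (fun y => Real.exp (C * (R - a)) * ‖m y a‖) (𝓝[closedPlus q₀] z) (𝓝 0) := by
    simpa using hL.norm.const_mul (Real.exp (C * (R - a)))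
  have := ge_of_tendsto hlim hev
  norm_num at this

end SexticNLS

namespace SexticNLS

variable {q₀ : ℝ} {q : ℝ → ℂ} {c z : ℂ} {m : ℝ → Fin 2 → ℂ}

/-! ### Jost solutions for large `z` -/

/-- The derivative of `q μ₁`. -/
noncomputable def sourceDeriv (q₀ : ℝ) (q : ℝ → ℂ) (z : ℂ) (m : ℝ → Fin 2 → ℂ) (y : ℝ) : ℂ :=
  deriv q y * m y 0 + q y * (-(I * (q₀ ^ 2 / z)) * m y 0 + I * conj (q y) * m y 1)

theorem IsJostOne.continuous_sourceDeriv (hq : IsPotential q₀ q c) (h : IsJostOne q₀ q c z m) :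
    Continuous (sourceDeriv q₀ q z m) := by
  have h1 := hq.continuous
  have h2 : Continuous (deriv q) := hq.smooth.continuous_deriv le_rfl
  have h3 := h.continuous
  have h4 : Continuous fun y => conj (q y) := continuous_conj.comp h1
  unfold sourceDeriv
  fun_prop

theorem IsJostOne.integration_by_parts (hq : IsPotential q₀ q c) (h : IsJostOne q₀ q c z m)
    (x R : ℝ) :
    z * m x 1 - q x * m x 0 = exp (I * z * (R - x : ℝ)) * (z * m R 1 - q R * m R 0) +
      ∫ y in x..R, exp (I * z * (y - x : ℝ)) * sourceDeriv q₀ q z m y := by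
  have hd : ∀ y, HasDerivAt (fun y : ℝ => exp (I * z * (y - x : ℝ)) * (z * m y 1 - q y * m y 0))
      (-(exp (I * z * (y - x : ℝ)) * sourceDeriv q₀ q z m y)) y := by
    intro y
    have e1 : HasDerivAt (fun y : ℝ => exp (I * z * (y - x : ℝ)))
        (exp (I * z * (y - x : ℝ)) * (I * z * (1 : ℝ))) y :=
      (((hasDerivAt_id y).sub_const x).ofReal_comp.const_mul (I * z)).cexp
    have hqd := (hq.smooth.differentiable one_ne_zero y).hasDerivAt
    refine (e1.mul (((h.deriv_one y).const_mul z).sub (hqd.mul (h.deriv_zero y)))).congr_deriv ?_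
    simp only [sourceDeriv, Pi.sub_apply, Pi.mul_apply]
    push_cast
    ring
  have hc : Continuous fun y : ℝ => -(exp (I * z * (y - x : ℝ)) * sourceDeriv q₀ q z m y) := by
    have := h.continuous_sourceDeriv hq
    fun_prop
  have := intervalIntegral.integral_eq_sub_of_hasDerivAt (fun y _ => hd y)
    (hc.intervalIntegrable x R)
  rw [intervalIntegral.integral_neg] at this
  simp only [sub_self, ofReal_zero, mul_zero, exp_zero, one_mul] at this
  linear_combination this

theorem norm_exp_I_mul_le (hz : 0 ≤ z.im) {s : ℝ} (hs : 0 ≤ s) : ‖exp (I * z * s)‖ ≤ 1 := by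
  rw [norm_exp]
  refine Real.exp_le_one_iff.2 ?_
  simp
  positivity

theorem IsJostOne.norm_sourceDeriv_le {Q Q' M : ℝ} {y : ℝ} (hQ : ‖q y‖ ≤ Q)
    (hQ' : ‖deriv q y‖ ≤ Q') (hM : ‖m y‖ ≤ M) (hz : 1 ≤ ‖z‖) :
    ‖sourceDeriv q₀ q z m y‖ ≤ (Q' + Q * (q₀ ^ 2 + Q)) * M := by
  have h0 := (norm_le_pi_norm (m y) 0).trans hM
  have h1 := (norm_le_pi_norm (m y) 1).trans hM
  have hQ0 : 0 ≤ Q := (norm_nonneg _).trans hQ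
  have hQ0' : 0 ≤ Q' := (norm_nonneg _).trans hQ'
  have hM0 : 0 ≤ M := (norm_nonneg _).trans hM
  have h2 : q₀ ^ 2 / ‖z‖ ≤ q₀ ^ 2 := div_le_self (sq_nonneg _) hz
  have h3 : ‖-(I * (q₀ ^ 2 / z)) * m y 0 + I * conj (q y) * m y 1‖ ≤ (q₀ ^ 2 + Q) * M := by
    refine (norm_add_le _ _).trans ?_
    simp only [norm_neg, norm_mul, norm_I, one_mul, RCLike.norm_conj, norm_div, norm_pow,
      norm_real, Real.norm_eq_abs, sq_abs]
    rw [add_mul]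
    gcongr
  unfold sourceDeriv
  refine (norm_add_le _ _).trans ?_
  rw [norm_mul, norm_mul, add_mul, mul_assoc Q]
  gcongr

/-- Neighbourhoods of infinity in `D⁺ ∪ Σ`. -/
noncomputable def infPlus (q₀ : ℝ) : Filter ℂ := cocompact ℂ ⊓ 𝓟 (closedPlus q₀)

theorem eventually_infPlus (hq₀ : 0 < q₀) (r : ℝ) : ∀ᶠ z in infPlus q₀,
    z ∈ closedPlus q₀ ∧ r ≤ ‖z‖ ∧ 0 ≤ z.im ∧ ‖kfun q₀ z‖ + q₀ ≤ 3 * ‖lam q₀ z‖ := by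
  have h1 : ∀ᶠ z in cocompact ℂ, max r (2 * q₀) ≤ ‖z‖ :=
    (tendsto_norm_cocompact_atTop (E := ℂ)).eventually (eventually_ge_atTop _)
  refine (eventually_inf_principal.2 (h1.mono fun z hz hzp => ?_))
  have h2 : 2 * q₀ ≤ ‖z‖ := (le_max_right _ _).trans hz
  have hzpos : 0 < ‖z‖ := by linarith
  obtain ⟨h3, _⟩ := (mem_closedPlus_iff hq₀).1 hzp
  refine ⟨hzp, (le_max_left _ _).trans hz, ?_, ?_⟩
  · by_contra hneg
    have : 0 < ‖z‖ ^ 2 - q₀ ^ 2 := by nlinarith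
    nlinarith
  · have h4 : ‖(q₀ : ℂ) ^ 2 / z‖ ≤ ‖z‖ / 4 := by
      rw [norm_div, norm_pow, norm_real, Real.norm_eq_abs, sq_abs, div_le_iff₀ hzpos]
      nlinarith
    have h5 : ‖kfun q₀ z‖ ≤ 1 / 2 * (‖z‖ + ‖z‖ / 4) := by
      rw [kfun, norm_mul]
      have := norm_sub_le z ((q₀ : ℂ) ^ 2 / z)
      have e : ‖(1 / 2 : ℂ)‖ = 1 / 2 := by simp
      rw [e]
      gcongr
      linarith
    have h6 : 1 / 2 * (‖z‖ - ‖z‖ / 4) ≤ ‖lam q₀ z‖ := by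
      rw [lam, norm_mul]
      have := norm_sub_le (z + (q₀ : ℂ) ^ 2 / z) ((q₀ : ℂ) ^ 2 / z)
      rw [add_sub_cancel_right] at this
      have e : ‖(1 / 2 : ℂ)‖ = 1 / 2 := by simp
      rw [e]
      gcongr
      linarith
    linarith

theorem norm_normalization_le (hq₀ : 0 < q₀) (hc : ‖c‖ = q₀) (hz : q₀ ≤ ‖z‖) :
    ‖(![1, c / z] : Fin 2 → ℂ)‖ ≤ 1 := by
  have hzpos : 0 < ‖z‖ := by linarith
  rw [pi_norm_le_iff_of_nonneg zero_le_one]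
  intro i
  fin_cases i
  · simp
  · simp only [Fin.mk_one, Matrix.cons_val_one, Matrix.cons_val_fin_one, norm_div, hc]
    exact (div_le_one hzpos).2 hz

/-- Uniform control of Jost solutions for large `z`. -/
theorem IsJostOne.uniform_infPlus (hq : IsPotential q₀ q c) {m : ℂ → ℝ → Fin 2 → ℂ}
    (hm : ∀ z ∈ closedPlus q₀, IsJostOne q₀ q c z (m z)) (a : ℝ) :
    ∃ M, 0 < M ∧ (∀ᶠ z in infPlus q₀, ∀ x, a ≤ x → ‖m z x‖ ≤ M) ∧
      ∀ η > 0, ∃ R₀, ∀ R, R₀ ≤ R → ∀ᶠ z in infPlus q₀, ‖m z R - ![1, c / z]‖ ≤ η := by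
  set w := jostWeight q c a 3
  have hw := hq.continuous_jostWeight a 3
  have hwi : MeasureTheory.IntegrableOn w (Set.Ioi a) := hq.integrableOn_jostWeight a 3
  set M := 1 * Real.exp (∫ y in Set.Ioi a, w y)
  have hM : 0 < M := by positivity
  have hb : ∀ᶠ z in infPlus q₀, IsVolterra a w (jostKernel q₀ q c z) (fun _ => ![1, c / z]) (m z) ∧
      ∀ x, a ≤ x → ‖m z x‖ ≤ M := by
    filter_upwards [eventually_infPlus hq.pos q₀] with z hz
    have hV := (hm z hz.1).isVolterra hq (a := a) hz.1 (Or.inr hz.2.2.2)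
    exact ⟨hV, hV.norm_le hw (jostWeight_nonneg (by norm_num)) hwi
      (fun _ _ => norm_normalization_le hq.pos hq.norm_eq hz.2.1)⟩
  refine ⟨M, hM, hb.mono fun z h => h.2, fun η hη => ?_⟩
  obtain ⟨R₀, hR₀⟩ := eventually_atTop.1
    ((exists_tail_lt hwi (show 0 < η / M by positivity)).and (eventually_ge_atTop a))
  refine ⟨R₀, fun R hR => hb.mono fun z h => ?_⟩
  refine (h.1.norm_sub_le hwi h.2 R (hR₀ R hR).2).trans ?_
  calc _ ≤ M * (η / M) := by
        have := (hR₀ R hR).1.le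
        gcongr
    _ = η := by field_simp

theorem tendsto_div_infPlus (C : ℝ) : Tendsto (fun z : ℂ => C / ‖z‖) (infPlus q₀) (𝓝 0) :=
  ((tendsto_norm_cocompact_atTop (E := ℂ)).mono_left inf_le_left).const_div_atTop C

theorem IsJostOne.second_small (hq : IsPotential q₀ q c) {m : ℂ → ℝ → Fin 2 → ℂ}
    (hm : ∀ z ∈ closedPlus q₀, IsJostOne q₀ q c z (m z)) (a b : ℝ) {η : ℝ} (hη : 0 < η) :
    ∀ᶠ z in infPlus q₀, ∀ x ∈ Set.Icc a b, ‖m z x 1‖ ≤ η := by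
  obtain ⟨M, hM, hbd, hR⟩ := IsJostOne.uniform_infPlus hq hm a
  obtain ⟨R₀, hR₀⟩ := hR (η / 2) (half_pos hη)
  set R := max (max R₀ b) a
  have hRb : b ≤ R := (le_max_right _ _).trans (le_max_left _ _)
  have hRa : a ≤ R := le_max_right _ _
  obtain ⟨Q, hQ⟩ := (isCompact_Icc (a := a) (b := R)).exists_bound_of_continuousOn
    (f := q) hq.continuous.continuousOn
  obtain ⟨Q', hQ'⟩ := (isCompact_Icc (a := a) (b := R)).exists_bound_of_continuousOn
    (f := deriv q) (hq.smooth.continuous_deriv le_rfl).continuousOn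
  have hQ0 : 0 ≤ Q := (norm_nonneg _).trans (hQ a ⟨le_rfl, hRa⟩)
  have hQ0' : 0 ≤ Q' := (norm_nonneg _).trans (hQ' a ⟨le_rfl, hRa⟩)
  set C := q₀ + 2 * (Q * M) + (Q' + Q * (q₀ ^ 2 + Q)) * M * (R - a)
  filter_upwards [hbd, hR₀ R ((le_max_left _ _).trans (le_max_left _ _)),
    eventually_infPlus hq.pos 1,
    (tendsto_div_infPlus (q₀ := q₀) C).eventually (gt_mem_nhds (half_pos hη))]
    with z h1 h2 h3 h4 x hx
  have hzpos : 0 < ‖z‖ := by linarith [h3.2.1]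
  have hz0 : z ≠ 0 := norm_pos_iff.1 hzpos
  have hxR : x ≤ R := hx.2.trans hRb
  have key := (hm z h3.1).integration_by_parts hq x R
  have e1 : ‖m z R 1‖ ≤ q₀ / ‖z‖ + η / 2 := by
    have := (norm_le_pi_norm (m z R - ![1, c / z]) 1).trans h2
    simp only [Pi.sub_apply, Matrix.cons_val_one, Matrix.cons_val_fin_one] at this
    have h5 := norm_sub_norm_le (m z R 1) (c / z)
    rw [norm_div, hq.norm_eq] at h5
    linarith
  have e2 : ‖∫ y in x..R, exp (I * z * (y - x : ℝ)) * sourceDeriv q₀ q z (m z) y‖ ≤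
      (Q' + Q * (q₀ ^ 2 + Q)) * M * (R - a) := by
    have : ‖∫ y in x..R, exp (I * z * (y - x : ℝ)) * sourceDeriv q₀ q z (m z) y‖ ≤
        (Q' + Q * (q₀ ^ 2 + Q)) * M * |R - x| := by
      refine intervalIntegral.norm_integral_le_of_norm_le_const fun y hy => ?_
      rw [Set.uIoc_of_le hxR] at hy
      have hya : a ≤ y := hx.1.trans hy.1.le
      rw [norm_mul]
      calc _ ≤ 1 * ((Q' + Q * (q₀ ^ 2 + Q)) * M) := by
            gcongr
            · exact norm_exp_I_mul_le h3.2.2.1 (by linarith [hy.1])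
            · exact IsJostOne.norm_sourceDeriv_le (hQ y ⟨hya, hy.2⟩) (hQ' y ⟨hya, hy.2⟩)
                (h1 y hya) h3.2.1
        _ = _ := one_mul _
    refine this.trans ?_
    rw [abs_of_nonneg (by linarith)]
    have := hx.1
    gcongr
  have e3 : ∀ y ∈ Set.Icc a R, ‖q y * m z y 0‖ ≤ Q * M := fun y hy => by
    rw [norm_mul]
    have := (norm_le_pi_norm (m z y) 0).trans (h1 y hy.1)
    have := hQ y hy
    gcongr
  have e4 : ‖exp (I * z * (R - x : ℝ)) * (z * m z R 1 - q R * m z R 0)‖ ≤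
      ‖z‖ * (q₀ / ‖z‖ + η / 2) + Q * M := by
    rw [norm_mul]
    calc _ ≤ 1 * ‖z * m z R 1 - q R * m z R 0‖ := by
          gcongr
          exact norm_exp_I_mul_le h3.2.2.1 (by linarith)
      _ ≤ _ := by
          rw [one_mul]
          refine (norm_sub_le _ _).trans (add_le_add ?_ (e3 R ⟨hRa, le_rfl⟩))
          rw [norm_mul]
          gcongr
  have e5 : ‖z‖ * ‖m z x 1‖ ≤ ‖z‖ * (q₀ / ‖z‖ + η / 2) + Q * M +
      (Q' + Q * (q₀ ^ 2 + Q)) * M * (R - a) + Q * M := by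
    rw [← norm_mul, sub_eq_iff_eq_add.1 key]
    exact (norm_add_le _ _).trans (add_le_add ((norm_add_le _ _).trans (add_le_add e4 e2))
      (e3 x ⟨hx.1, hxR⟩))
  have e6 : ‖z‖ * (q₀ / ‖z‖ + η / 2) = q₀ + ‖z‖ * (η / 2) := by
    field_simp
  rw [div_lt_iff₀ hzpos] at h4
  have : ‖z‖ * ‖m z x 1‖ ≤ ‖z‖ * η := by
    rw [e6] at e5
    simp only [C] at h4
    linarith
  exact le_of_mul_le_mul_left this hzpos

/-- Jost solutions tend to the first unit vector as `z → ∞` in `D⁺ ∪ Σ`. -/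
theorem IsJostOne.tendsto_infPlus (hq : IsPotential q₀ q c) {m : ℂ → ℝ → Fin 2 → ℂ}
    (hm : ∀ z ∈ closedPlus q₀, IsJostOne q₀ q c z (m z)) (a : ℝ) :
    Tendsto (fun z => m z a) (infPlus q₀) (𝓝 ![1, 0]) := by
  rw [tendsto_pi_nhds]
  obtain ⟨M, hM, hbd, hR⟩ := IsJostOne.uniform_infPlus hq hm a
  have h0 : Tendsto (fun z => m z a 0) (infPlus q₀) (𝓝 1) := by
    rw [Metric.tendsto_nhds]
    intro ε hε
    obtain ⟨R₀, hR₀⟩ := hR (ε / 4) (by positivity)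
    set R := max R₀ a
    have hRa : a ≤ R := le_max_right _ _
    obtain ⟨Q, hQ⟩ := (isCompact_Icc (a := a) (b := R)).exists_bound_of_continuousOn
      (f := q) hq.continuous.continuousOn
    have hQ0 : 0 ≤ Q := (norm_nonneg _).trans (hQ a ⟨le_rfl, hRa⟩)
    have hRa' : 0 ≤ R - a := by linarith
    set η := ε / 4 / (Q * (R - a) + 1)
    have hη : 0 < η := by positivity
    filter_upwards [hbd, hR₀ R (le_max_left _ _), eventually_infPlus hq.pos 1,
      IsJostOne.second_small hq hm a R hη,
      (tendsto_div_infPlus (q₀ := q₀) (q₀ ^ 2 * M * (R - a))).eventually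
        (gt_mem_nhds (show 0 < ε / 4 by positivity))] with z h1 h2 h3 h4 h5
    have hd : ‖m z R 0 - m z a 0‖ ≤ (q₀ ^ 2 / ‖z‖ * M + Q * η) * ‖R - a‖ := by
      refine (convex_Icc a R).norm_image_sub_le_of_norm_hasDerivWithin_le
        (fun x _ => ((hm z h3.1).deriv_zero x).hasDerivWithinAt) (fun x hx => ?_)
        ⟨le_rfl, hRa⟩ ⟨hRa, le_rfl⟩
      refine (norm_add_le _ _).trans ?_
      simp only [norm_neg, norm_mul, norm_I, one_mul, RCLike.norm_conj, norm_div, norm_pow,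
        norm_real, Real.norm_eq_abs, sq_abs]
      have := (norm_le_pi_norm (m z x) 0).trans (h1 x hx.1)
      have := hQ x hx
      have := h4 x hx
      gcongr
    have e1 := (norm_le_pi_norm (m z R - ![1, c / z]) 0).trans h2
    simp only [Pi.sub_apply, Matrix.cons_val_zero] at e1
    rw [Real.norm_of_nonneg hRa'] at hd
    have e2 : Q * η * (R - a) ≤ ε / 4 := by
      have : η * (Q * (R - a) + 1) = ε / 4 := div_mul_cancel₀ _ (by positivity)
      linarith
    have e3 : q₀ ^ 2 / ‖z‖ * M * (R - a) = q₀ ^ 2 * M * (R - a) / ‖z‖ := by ring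
    rw [dist_eq_norm, ← norm_neg]
    have e4 : -(m z a 0 - 1) = (m z R 0 - m z a 0) - (m z R 0 - 1) := by ring
    rw [e4]
    refine (norm_sub_le _ _).trans_lt ?_
    rw [add_mul, e3] at hd
    linarith
  have h1 : Tendsto (fun z => m z a 1) (infPlus q₀) (𝓝 0) := by
    rw [Metric.tendsto_nhds]
    intro ε hε
    filter_upwards [IsJostOne.second_small hq hm a a (half_pos hε)] with z hz
    rw [dist_zero_right]
    linarith [hz a ⟨le_rfl, le_rfl⟩]
  intro i
  fin_cases i
  · exact h0
  · exact h1

theorem I_mul_mem_closedPlus (hq₀ : 0 < q₀) {τ : ℝ} (hτ : q₀ < τ) : I * τ ∈ closedPlus q₀ := by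
  refine Or.inl ?_
  have : 0 < (‖I * (τ : ℂ)‖ ^ 2 - q₀ ^ 2) * (I * (τ : ℂ)).im := by
    have h1 : ‖I * (τ : ℂ)‖ = τ := by simp [abs_of_pos (hq₀.trans hτ)]
    rw [h1]
    simp only [mul_im, I_re, ofReal_im, I_im, ofReal_re, zero_mul, one_mul, zero_add]
    have : 0 < τ ^ 2 - q₀ ^ 2 := by nlinarith
    have := hq₀.trans hτ
    positivity
  exact this

theorem tendsto_I_mul_infPlus (hq₀ : 0 < q₀) :
    Tendsto (fun τ : ℝ => I * (τ : ℂ)) atTop (infPlus q₀) := by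
  refine tendsto_inf.2 ⟨?_, tendsto_principal.2 ?_⟩
  · rw [← Metric.cobounded_eq_cocompact, ← tendsto_norm_atTop_iff_cobounded]
    have : ∀ τ : ℝ, ‖I * (τ : ℂ)‖ = |τ| := fun τ => by simp
    simp only [this]
    exact tendsto_abs_atTop_atTop
  · filter_upwards [eventually_gt_atTop q₀] with τ hτ
    exact I_mul_mem_closedPlus hq₀ hτ

/-- The potential is recovered from the behaviour of the Jost solutions for large `z`. -/
theorem IsJostOne.tendsto_potential (hq : IsPotential q₀ q c) {m : ℂ → ℝ → Fin 2 → ℂ}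
    (hm : ∀ z ∈ closedPlus q₀, IsJostOne q₀ q c z (m z)) (a : ℝ) :
    Tendsto (fun τ : ℝ => I * τ * m (I * τ) a 1) atTop (𝓝 (q a)) := by
  have hI := tendsto_I_mul_infPlus hq.pos
  obtain ⟨M, hM, hbd, -⟩ := IsJostOne.uniform_infPlus hq hm a
  obtain ⟨Q, hQ⟩ := (isCompact_Icc (a := a) (b := a + 1)).exists_bound_of_continuousOn
    (f := q) hq.continuous.continuousOn
  obtain ⟨Q', hQ'⟩ := (isCompact_Icc (a := a) (b := a + 1)).exists_bound_of_continuousOn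
    (f := deriv q) (hq.smooth.continuous_deriv le_rfl).continuousOn
  have hQ0 : 0 ≤ Q := (norm_nonneg _).trans (hQ a ⟨le_rfl, by linarith⟩)
  have hev : ∀ᶠ τ : ℝ in atTop, (∀ x, a ≤ x → ‖m (I * τ) x‖ ≤ M) ∧ I * (τ : ℂ) ∈ closedPlus q₀ ∧
      1 ≤ ‖I * (τ : ℂ)‖ ∧ 0 ≤ (I * (τ : ℂ)).im := by
    filter_upwards [hI.eventually hbd, hI.eventually (eventually_infPlus hq.pos 1)] with τ h1 h2
    exact ⟨h1, h2.1, h2.2.1, h2.2.2.1⟩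
  have hexp : ∀ τ s : ℝ, exp (I * (I * τ) * s) = (Real.exp (-(τ * s)) : ℝ) := fun τ s => by
    rw [← mul_assoc, I_mul_I]
    push_cast
    ring_nf
  have l1 : Tendsto (fun τ : ℝ => q a * m (I * τ) a 0) atTop (𝓝 (q a)) := by
    have := (((tendsto_pi_nhds.1 (IsJostOne.tendsto_infPlus hq hm a)) 0).comp hI).const_mul (q a)
    simpa using this
  have l2 : Tendsto (fun τ : ℝ => exp (I * (I * τ) * (a + 1 - a : ℝ)) *
      (I * τ * m (I * τ) (a + 1) 1 - q (a + 1) * m (I * τ) (a + 1) 0)) atTop (𝓝 0) := by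
    have h0 : Tendsto (fun τ : ℝ => Real.exp (-τ) * (τ * M) + Real.exp (-τ) * (Q * M)) atTop
        (𝓝 0) := by
      have e1 := (Real.tendsto_pow_mul_exp_neg_atTop_nhds_zero 1).mul_const M
      have e2 := (Real.tendsto_exp_neg_atTop_nhds_zero).mul_const (Q * M)
      have := e1.add e2
      simp only [zero_mul, add_zero] at this
      refine this.congr fun τ => ?_
      ring
    refine squeeze_zero_norm' ?_ h0
    filter_upwards [hev, eventually_ge_atTop 0] with τ h1 hτ
    rw [hexp, norm_mul, norm_real, Real.norm_of_nonneg (Real.exp_pos _).le, ← mul_add]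
    have e3 : τ * (a + 1 - a) = τ := by ring
    rw [e3]
    gcongr
    have b0 := (norm_le_pi_norm (m (I * τ) (a + 1)) 0).trans (h1.1 _ (by linarith))
    have b1 := (norm_le_pi_norm (m (I * τ) (a + 1)) 1).trans (h1.1 _ (by linarith))
    have b2 := hQ (a + 1) ⟨by linarith, le_rfl⟩
    refine (norm_sub_le _ _).trans ?_
    simp only [norm_mul, norm_I, one_mul, norm_real, Real.norm_of_nonneg hτ]
    gcongr
  have l3 : Tendsto (fun τ : ℝ => ∫ y in a..(a + 1), exp (I * (I * τ) * (y - a : ℝ)) *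
      sourceDeriv q₀ q (I * τ) (m (I * τ)) y) atTop (𝓝 (∫ _ in a..(a + 1), (0 : ℂ))) := by
    refine intervalIntegral.tendsto_integral_filter_of_dominated_convergence
      (fun _ => (Q' + Q * (q₀ ^ 2 + Q)) * M) ?_ ?_ (by simp) ?_
    · filter_upwards [hev] with τ h1
      have := (hm _ h1.2.1).continuous_sourceDeriv hq
      exact Continuous.aestronglyMeasurable (by fun_prop)
    · filter_upwards [hev] with τ h1
      refine Eventually.of_forall fun y hy => ?_
      rw [Set.uIoc_of_le (by linarith)] at hy
      rw [norm_mul]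
      have hs := IsJostOne.norm_sourceDeriv_le (q₀ := q₀) (hQ y ⟨hy.1.le, hy.2⟩)
        (hQ' y ⟨hy.1.le, hy.2⟩) (h1.1 y hy.1.le) h1.2.2.1
      calc _ ≤ 1 * ((Q' + Q * (q₀ ^ 2 + Q)) * M) := by
            gcongr
            exact norm_exp_I_mul_le h1.2.2.2 (by linarith [hy.1])
        _ = _ := one_mul _
    · refine Eventually.of_forall fun y hy => ?_
      rw [Set.uIoc_of_le (by linarith)] at hy
      have h0 : Tendsto (fun τ : ℝ => Real.exp (-(τ * (y - a))) *
          ((Q' + Q * (q₀ ^ 2 + Q)) * M)) atTop (𝓝 0) := by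
        have e1 : Tendsto (fun τ : ℝ => τ * (y - a)) atTop atTop :=
          tendsto_id.atTop_mul_const (by linarith [hy.1])
        simpa using (Real.tendsto_exp_neg_atTop_nhds_zero.comp e1).mul_const
          ((Q' + Q * (q₀ ^ 2 + Q)) * M)
      refine squeeze_zero_norm' ?_ h0
      filter_upwards [hev] with τ h1
      rw [hexp, norm_mul, norm_real, Real.norm_of_nonneg (Real.exp_pos _).le]
      gcongr
      exact IsJostOne.norm_sourceDeriv_le (q₀ := q₀) (hQ y ⟨hy.1.le, hy.2⟩)
        (hQ' y ⟨hy.1.le, hy.2⟩) (h1.1 y hy.1.le) h1.2.2.1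
  simp only [intervalIntegral.integral_zero] at l3
  have := (l1.add l2).add l3
  simp only [add_zero] at this
  refine this.congr' ?_
  filter_upwards [hev] with τ h1
  have hz0 : I * (τ : ℂ) ≠ 0 := fun h => by
    have := h1.2.2.1
    rw [h, norm_zero] at this
    linarith
  have := (hm _ h1.2.1).integration_by_parts hq a (a + 1)
  linear_combination -this

end SexticNLS

namespace SexticNLS

variable {q₀ : ℝ} {q : ℝ → ℂ} {c z : ℂ} {m : ℝ → Fin 2 → ℂ}

/-! ### Jost solutions at both ends and their symmetries -/

/-- The spatial part of the Lax pair for the first column of `μ`, normalized along `l`. -/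
structure IsJostAt (l : Filter ℝ) (q₀ : ℝ) (q : ℝ → ℂ) (c z : ℂ) (m : ℝ → Fin 2 → ℂ) : Prop where
  deriv_zero : ∀ x, HasDerivAt (fun y => m y 0)
    (-(I * (q₀ ^ 2 / z)) * m x 0 + I * conj (q x) * m x 1) x
  deriv_one : ∀ x, HasDerivAt (fun y => m y 1) (I * q x * m x 0 - I * z * m x 1) x
  lim : Tendsto m l (𝓝 ![1, c / z])

theorem IsJostAt.isJostOne (h : IsJostAt atTop q₀ q c z m) : IsJostOne q₀ q c z m :=
  ⟨h.deriv_zero, h.deriv_one, h.lim⟩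

/-- Multiplication by `σ₃`. -/
def sigmaThree (v : Fin 2 → ℂ) : Fin 2 → ℂ := ![v 0, -v 1]

theorem sigmaThree_sigmaThree (v : Fin 2 → ℂ) : sigmaThree (sigmaThree v) = v := by
  funext i
  fin_cases i <;> simp [sigmaThree]

theorem continuous_sigmaThree : Continuous sigmaThree := by
  unfold sigmaThree
  fun_prop

/-- The reflection `x ↦ -x` exchanges the two ends. -/
theorem IsJostAt.reflect (h : IsJostAt atBot q₀ q c z m) :
    IsJostOne q₀ (fun x => q (-x)) c (-z) (fun x => sigmaThree (m (-x))) where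
  deriv_zero := fun x => by
    refine ((h.deriv_zero (-x)).scomp x (hasDerivAt_neg x)).congr_deriv ?_
    simp [sigmaThree]
    ring
  deriv_one := fun x => by
    refine ((h.deriv_one (-x)).scomp x (hasDerivAt_neg x)).neg.congr_deriv ?_
    simp [sigmaThree]
  lim := by
    have := (continuous_sigmaThree.tendsto _).comp (h.lim.comp tendsto_neg_atTop_atBot)
    simpa [sigmaThree, Function.comp_def, div_neg] using this

/-- The antiunitary map `(a, b) ↦ (-b*, a*)`. -/
def antiRot (v : Fin 2 → ℂ) : Fin 2 → ℂ := ![-conj (v 1), conj (v 0)]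

theorem continuous_antiRot : Continuous antiRot := by
  have h0 : Continuous fun v : Fin 2 → ℂ => conj (v 0) := continuous_conj.comp (by fun_prop)
  have h1 : Continuous fun v : Fin 2 → ℂ => conj (v 1) := continuous_conj.comp (by fun_prop)
  unfold antiRot
  fun_prop

/-- The reflected point `- q₀² / z`. -/
noncomputable def refl (q₀ : ℝ) (z : ℂ) : ℂ := -(q₀ ^ 2 / z)

/-- The reflected point `- q₀² / z*`. -/
noncomputable def antiRefl (q₀ : ℝ) (z : ℂ) : ℂ := -(q₀ ^ 2 / conj z)

theorem hasDerivAt_conj' {f : ℝ → ℂ} {f' : ℂ} {x : ℝ} (h : HasDerivAt f f' x) :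
    HasDerivAt (fun y => conj (f y)) (conj f') x := h.star

theorem IsJostAt.symm {l : Filter ℝ} (hq₀ : 0 < q₀) (hc : ‖c‖ = q₀) (hz : z ≠ 0)
    (h : IsJostAt l q₀ q c (antiRefl q₀ z) m) :
    IsJostAt l q₀ q c z (fun x => (c / z) • antiRot (m x)) := by
  have hq' : (q₀ : ℂ) ≠ 0 := by exact_mod_cast hq₀.ne'
  have hcz : conj z ≠ 0 := by simpa using hz
  have e1 : conj ((q₀ : ℂ) ^ 2 / antiRefl q₀ z) = -z := by
    simp [antiRefl]
    field_simp
  have e2 : conj (antiRefl q₀ z) = -(q₀ ^ 2 / z) := by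
    simp [antiRefl]
  refine ⟨fun x => ?_, fun x => ?_, ?_⟩
  · have := ((hasDerivAt_conj' (h.deriv_one x)).neg).const_mul (c / z)
    refine this.congr_deriv ?_
    simp only [map_sub, map_mul, conj_I, e2, antiRot, Pi.smul_apply, smul_eq_mul,
      Matrix.cons_val_zero, Matrix.cons_val_one, Matrix.cons_val_fin_one]
    ring
  · have := (hasDerivAt_conj' (h.deriv_zero x)).const_mul (c / z)
    refine this.congr_deriv ?_
    simp only [map_add, map_neg, map_mul, conj_I, e1, antiRot, Pi.smul_apply, smul_eq_mul,
      Matrix.cons_val_zero, Matrix.cons_val_one, Matrix.cons_val_fin_one, conj_conj]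
    ring
  · have h1 := ((continuous_antiRot.tendsto _).comp h.lim).const_smul (c / z)
    have hcc : c * conj c = (q₀ : ℂ) ^ 2 := by
      rw [mul_conj, normSq_eq_norm_sq, hc]
      norm_cast
    have e : (c / z) • antiRot ![1, c / antiRefl q₀ z] = ![1, c / z] := by
      funext i
      fin_cases i
      · simp [antiRot, antiRefl]
        field_simp
        exact hcc
      · simp [antiRot]
    rw [e] at h1
    exact h1

variable {q₀ : ℝ} {q : ℝ → ℂ} {c : ℂ} {m : ℂ → ℝ → Fin 2 → ℂ}

theorem isPotential_of_bot (hq₀ : 0 < q₀) (hq : ContDiff ℝ 1 q) (hc : ‖c‖ = q₀)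
    (hi : MeasureTheory.IntegrableOn (fun x => (1 + |x|) * ‖q x - c‖) (Set.Iic 0)) :
    IsPotential q₀ (fun x => q (-x)) c := by
  refine ⟨hq₀, hq.comp contDiff_neg, hc, ?_⟩
  have := (MeasureTheory.Measure.measurePreserving_neg MeasureTheory.volume).integrableOn_comp_preimage
    (MeasurableEquiv.neg ℝ).measurableEmbedding (f := fun x => (1 + |x|) * ‖q x - c‖)
    (s := Set.Iic 0)
  have h2 := this.2 hi
  simpa [Function.comp_def] using h2

theorem mem_DMinus_iff_neg {z : ℂ} : -z ∈ DPlus q₀ ↔ z ∈ DMinus q₀ := by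
  simp [DPlus, DMinus]

theorem tendsto_neg_closedMinus (z : ℂ) :
    Tendsto (fun z : ℂ => -z) (𝓝[closedMinus q₀] z) (𝓝[closedPlus q₀] (-z)) :=
  tendsto_nhdsWithin_of_tendsto_nhds_of_eventually_within _
    ((continuous_neg.tendsto z).mono_left nhdsWithin_le_nhds)
    (eventually_mem_nhdsWithin.mono fun _ h => neg_mem_closedPlus_iff.2 h)

/-- Neighbourhoods of infinity in `D⁻ ∪ Σ`. -/
noncomputable def infMinus (q₀ : ℝ) : Filter ℂ := cocompact ℂ ⊓ 𝓟 (closedMinus q₀)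

theorem tendsto_neg_infMinus : Tendsto (fun z : ℂ => -z) (infMinus q₀) (infPlus q₀) := by
  refine tendsto_inf.2 ⟨?_, tendsto_principal.2 ?_⟩
  · exact ((Homeomorph.neg ℂ).isClosedEmbedding.tendsto_cocompact).mono_left inf_le_left
  · exact mem_inf_of_right fun z hz => neg_mem_closedPlus_iff.2 hz

theorem IsJostAt.family (hm : ∀ z ∈ closedMinus q₀, IsJostAt atBot q₀ q c z (m z)) :
    ∀ z ∈ closedPlus q₀, IsJostOne q₀ (fun x => q (-x)) c z
      (fun x => sigmaThree (m (-z) (-x))) := fun z hz => by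
  have h := (hm (-z) (neg_mem_closedPlus_iff.1 (by simpa using hz))).reflect
  rwa [neg_neg] at h

theorem eq_sigmaThree (m : ℂ → ℝ → Fin 2 → ℂ) (x : ℝ) :
    (fun z => m z x) = sigmaThree ∘ (fun z => sigmaThree (m (-z) (-(-x)))) ∘ fun z => -z := by
  funext z
  simp [sigmaThree_sigmaThree]

theorem IsJostAt.unique_bot (hq : IsPotential q₀ (fun x => q (-x)) c) {z : ℂ}
    (hz : z ∈ closedMinus q₀) {m m' : ℝ → Fin 2 → ℂ} (h : IsJostAt atBot q₀ q c z m)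
    (h' : IsJostAt atBot q₀ q c z m') : m = m' := by
  have := h.reflect.unique hq (neg_mem_closedPlus_iff.2 hz) h'.reflect
  funext x
  have h1 := congrArg sigmaThree (congrFun this (-x))
  simpa [sigmaThree_sigmaThree] using h1

theorem IsJostAt.differentiableAt_bot (hq : IsPotential q₀ (fun x => q (-x)) c)
    (hm : ∀ z ∈ closedMinus q₀, IsJostAt atBot q₀ q c z (m z)) {z : ℂ} (hz : z ∈ DMinus q₀)
    (x : ℝ) : DifferentiableAt ℂ (fun z => m z x) z := by
  have h1 := IsJostOne.differentiableAt hq (IsJostAt.family hm) (mem_DMinus_iff_neg.2 hz) (-x)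
  rw [eq_sigmaThree m x]
  have hs : Differentiable ℂ sigmaThree := by
    unfold sigmaThree
    refine differentiable_pi.2 fun i => ?_
    fin_cases i <;> simp <;> fun_prop
  exact (hs _).comp z (h1.comp z differentiableAt_id.neg)

theorem IsJostAt.exists_tendsto_bot (hq : IsPotential q₀ (fun x => q (-x)) c)
    (hm : ∀ z ∈ closedMinus q₀, IsJostAt atBot q₀ q c z (m z)) {z : ℂ} (hz0 : z ≠ 0)
    [hne : (𝓝[closedMinus q₀] z).NeBot] (x : ℝ) :
    ∃ L, L ≠ 0 ∧ Tendsto (fun z => m z x) (𝓝[closedMinus q₀] z) (𝓝 L) := by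
  have : (𝓝[closedPlus q₀] (-z)).NeBot := hne.map _ |>.mono (tendsto_neg_closedMinus z)
  obtain ⟨L, hL⟩ := IsJostOne.exists_tendsto hq (IsJostAt.family hm) (neg_ne_zero.2 hz0) (-x)
  have hL0 := IsJostOne.limit_ne_zero hq (IsJostAt.family hm) (neg_ne_zero.2 hz0) hL
  refine ⟨sigmaThree L, fun h => hL0 ?_, ?_⟩
  · rw [← sigmaThree_sigmaThree L, h]
    simp [sigmaThree]
  · rw [eq_sigmaThree m x]
    exact (continuous_sigmaThree.tendsto _).comp (hL.comp (tendsto_neg_closedMinus z))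

theorem IsJostAt.continuousWithinAt_bot (hq : IsPotential q₀ (fun x => q (-x)) c)
    (hm : ∀ z ∈ closedMinus q₀, IsJostAt atBot q₀ q c z (m z)) {z : ℂ}
    (hz : z ∈ closedMinus q₀) (x : ℝ) :
    ContinuousWithinAt (fun z => m z x) (closedMinus q₀) z := by
  have h1 := IsJostOne.continuousWithinAt hq (IsJostAt.family hm)
    (neg_mem_closedPlus_iff.2 hz) (-x)
  have h2 := (continuous_sigmaThree.tendsto _).comp (h1.tendsto.comp (tendsto_neg_closedMinus z))
  rw [eq_sigmaThree m x]
  exact h2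

theorem IsJostAt.tendsto_infMinus (hq : IsPotential q₀ (fun x => q (-x)) c)
    (hm : ∀ z ∈ closedMinus q₀, IsJostAt atBot q₀ q c z (m z)) (x : ℝ) :
    Tendsto (fun z => m z x) (infMinus q₀) (𝓝 ![1, 0]) := by
  have h1 := (continuous_sigmaThree.tendsto _).comp
    ((IsJostOne.tendsto_infPlus hq (IsJostAt.family hm) (-x)).comp tendsto_neg_infMinus)
  rw [eq_sigmaThree m x]
  simpa [sigmaThree, Function.comp_def] using h1

theorem IsJostAt.tendsto_potential_bot (hq : IsPotential q₀ (fun x => q (-x)) c)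
    (hm : ∀ z ∈ closedMinus q₀, IsJostAt atBot q₀ q c z (m z)) (x : ℝ) :
    Tendsto (fun τ : ℝ => -(I * τ) * m (-(I * τ)) x 1) atTop (𝓝 (q x)) := by
  have := IsJostOne.tendsto_potential hq (IsJostAt.family hm) (-x)
  simpa [sigmaThree] using this

end SexticNLS

namespace SexticNLS

variable {q₀ : ℝ} {c Q : ℂ}

/-! ### The reflection `z ↦ - q₀² / z` -/

theorem refl_refl (hq₀ : 0 < q₀) (z : ℂ) : refl q₀ (refl q₀ z) = z := by
  have hq' : (q₀ : ℂ) ≠ 0 := by exact_mod_cast hq₀.ne'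
  rcases eq_or_ne z 0 with rfl | hz
  · simp [refl]
  · simp only [refl]
    field_simp

theorem refl_ne_zero (hq₀ : 0 < q₀) {z : ℂ} (hz : z ≠ 0) : refl q₀ z ≠ 0 := by
  have hq' : (q₀ : ℂ) ≠ 0 := by exact_mod_cast hq₀.ne'
  simp [refl, hq', hz]

theorem refl_eq_iff (hq₀ : 0 < q₀) {z w : ℂ} : refl q₀ z = w ↔ z = refl q₀ w :=
  ⟨fun h => by rw [← h, refl_refl hq₀], fun h => by rw [h, refl_refl hq₀]⟩

theorem refl_branch (q₀ : ℝ) : refl q₀ (I * q₀) = I * q₀ := by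
  rcases eq_or_ne (q₀ : ℂ) 0 with h | h
  · simp [refl, h]
  · simp only [refl]
    field_simp
    simp

theorem refl_neg (q₀ : ℝ) (z : ℂ) : refl q₀ (-z) = -refl q₀ z := by
  simp [refl, div_neg]

theorem refl_neg_branch (q₀ : ℝ) : refl q₀ (-(I * q₀)) = -(I * q₀) := by
  rw [refl_neg, refl_branch]

theorem hasDerivAt_refl {z : ℂ} (hz : z ≠ 0) : HasDerivAt (refl q₀) (q₀ ^ 2 / z ^ 2) z := by
  have := ((hasDerivAt_const z ((q₀ : ℂ) ^ 2)).div (hasDerivAt_id z) hz).neg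
  refine this.congr_deriv ?_
  simp [neg_div]

theorem tendsto_refl_punctured (hq₀ : 0 < q₀) {z : ℂ} (hz : z ≠ 0) :
    Tendsto (refl q₀) (𝓝[≠] z) (𝓝[≠] (refl q₀ z)) := by
  refine tendsto_nhdsWithin_of_tendsto_nhds_of_eventually_within _
    ((hasDerivAt_refl hz).continuousAt.tendsto.mono_left nhdsWithin_le_nhds) ?_
  filter_upwards [self_mem_nhdsWithin] with w hw h
  exact hw (by simpa [refl_refl hq₀] using congrArg (refl q₀) h)

theorem tendsto_refl_zero (hq₀ : 0 < q₀) : Tendsto (refl q₀) (𝓝[≠] 0) (cocompact ℂ) := by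
  have hq' : (q₀ : ℂ) ^ 2 ≠ 0 := pow_ne_zero _ (by exact_mod_cast hq₀.ne')
  have h := tendsto_inv₀_nhdsNE_zero (α := ℂ)
  rw [Metric.cobounded_eq_cocompact] at h
  have h2 := ((Homeomorph.mulLeft₀ (-((q₀ : ℂ) ^ 2)) (neg_ne_zero.2 hq')).isClosedEmbedding.tendsto_cocompact).comp h
  refine h2.congr fun z => ?_
  simp [refl, div_eq_mul_inv]

theorem tendsto_refl_cocompact (hq₀ : 0 < q₀) : Tendsto (refl q₀) (cocompact ℂ) (𝓝[≠] 0) := by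
  have h := tendsto_inv₀_cobounded' (α := ℂ)
  rw [Metric.cobounded_eq_cocompact] at h
  have hq' : (q₀ : ℂ) ^ 2 ≠ 0 := pow_ne_zero _ (by exact_mod_cast hq₀.ne')
  refine tendsto_nhdsWithin_of_tendsto_nhds_of_eventually_within _ ?_ ?_
  · have h2 := (h.mono_right nhdsWithin_le_nhds).const_mul (-((q₀ : ℂ) ^ 2))
    rw [mul_zero] at h2
    refine h2.congr fun z => ?_
    simp [refl, div_eq_mul_inv]
  · filter_upwards [(Set.finite_singleton (0 : ℂ)).isCompact.compl_mem_cocompact] with z hz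
    exact refl_ne_zero hq₀ hz

theorem norm_refl (q₀ : ℝ) (z : ℂ) : ‖refl q₀ z‖ = q₀ ^ 2 / ‖z‖ := by
  simp [refl]

theorem im_refl (q₀ : ℝ) (z : ℂ) : (refl q₀ z).im = q₀ ^ 2 * z.im / ‖z‖ ^ 2 := by
  have h1 : ((q₀ : ℂ) ^ 2).im = 0 := by rw [← ofReal_pow, ofReal_im]
  have h2 : ((q₀ : ℂ) ^ 2).re = q₀ ^ 2 := by rw [← ofReal_pow, ofReal_re]
  simp [refl, div_im, h1, h2, normSq_eq_norm_sq]

theorem region_refl (hq₀ : 0 < q₀) {z : ℂ} (hz : z ≠ 0) :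
    (‖refl q₀ z‖ ^ 2 - q₀ ^ 2) * (refl q₀ z).im =
      -((q₀ / ‖z‖) ^ 4 * ((‖z‖ ^ 2 - q₀ ^ 2) * z.im)) := by
  have : ‖z‖ ≠ 0 := norm_ne_zero_iff.2 hz
  rw [norm_refl q₀, im_refl]
  field_simp
  ring

theorem zero_notMem_DPlus : (0 : ℂ) ∉ DPlus q₀ := by simp [DPlus]

theorem refl_mem_DMinus_iff (hq₀ : 0 < q₀) {z : ℂ} : refl q₀ z ∈ DMinus q₀ ↔ z ∈ DPlus q₀ := by
  rcases eq_or_ne z 0 with rfl | hz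
  · simp [refl, DMinus, DPlus]
  · have h0 : 0 < (q₀ / ‖z‖) ^ 4 := by
      have := norm_pos_iff.2 hz
      positivity
    have h : refl q₀ z ∈ DMinus q₀ ↔ (‖refl q₀ z‖ ^ 2 - q₀ ^ 2) * (refl q₀ z).im < 0 := Iff.rfl
    rw [h, region_refl hq₀ hz, neg_lt_zero, mul_pos_iff_of_pos_left h0]
    rfl

theorem refl_mem_DPlus_iff (hq₀ : 0 < q₀) {z : ℂ} : refl q₀ z ∈ DPlus q₀ ↔ z ∈ DMinus q₀ := by
  rw [← refl_mem_DMinus_iff hq₀, refl_refl hq₀]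

theorem refl_ne_branch (hq₀ : 0 < q₀) {z : ℂ} (h1 : z ≠ I * q₀) (h2 : z ≠ -(I * q₀)) :
    refl q₀ z ≠ I * q₀ ∧ refl q₀ z ≠ -(I * q₀) := by
  rw [Ne, Ne, refl_eq_iff hq₀, refl_eq_iff hq₀, refl_branch, refl_neg_branch]
  exact ⟨h1, h2⟩

theorem refl_mem_closedMinus_iff (hq₀ : 0 < q₀) {z : ℂ} :
    refl q₀ z ∈ closedMinus q₀ ↔ z ∈ closedPlus q₀ := by
  rcases eq_or_ne z 0 with rfl | hz
  · have : refl q₀ 0 = 0 := by simp [refl]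
    rw [this, mem_closedMinus_iff hq₀, mem_closedPlus_iff hq₀]
    simp
  · have h0 : 0 < (q₀ / ‖z‖) ^ 4 := by
      have := norm_pos_iff.2 hz
      positivity
    rw [mem_closedMinus_iff hq₀, mem_closedPlus_iff hq₀, region_refl hq₀ hz, Left.neg_nonpos_iff,
      mul_nonneg_iff_of_pos_left h0, Ne, Ne, Ne, refl_eq_iff hq₀, refl_eq_iff hq₀, refl_eq_iff hq₀,
      refl_branch, refl_neg_branch]
    simp [refl]

theorem lam_refl (hq₀ : 0 < q₀) (z : ℂ) : lam q₀ (refl q₀ z) = -lam q₀ z := by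
  have hq' : (q₀ : ℂ) ≠ 0 := by exact_mod_cast hq₀.ne'
  rcases eq_or_ne z 0 with rfl | hz
  · simp [refl, lam]
  · simp only [lam, refl]
    field_simp
    ring

theorem kfun_refl (hq₀ : 0 < q₀) (z : ℂ) : kfun q₀ (refl q₀ z) = kfun q₀ z := by
  have hq' : (q₀ : ℂ) ≠ 0 := by exact_mod_cast hq₀.ne'
  rcases eq_or_ne z 0 with rfl | hz
  · simp [refl, kfun]
  · simp only [kfun, refl]
    field_simp
    ring

theorem gam_refl (hq₀ : 0 < q₀) {z : ℂ} (hz : z ≠ 0) :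
    gam q₀ (refl q₀ z) = z ^ 2 / q₀ ^ 2 * gam q₀ z := by
  have hq' : (q₀ : ℂ) ≠ 0 := by exact_mod_cast hq₀.ne'
  simp only [gam, refl]
  field_simp
  ring

/-- The transform `f(z) ↦ -(c* / z) f(-q₀² / z)`. -/
noncomputable def dual (q₀ : ℝ) (c : ℂ) (f : ℂ → ℂ) (z : ℂ) : ℂ := -(conj c / z) * f (refl q₀ z)

theorem mul_conj_of_norm (hc : ‖c‖ = q₀) : c * conj c = (q₀ : ℂ) ^ 2 := by
  rw [mul_conj, normSq_eq_norm_sq, hc]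
  norm_cast

theorem conj_ne_zero_of_norm (hq₀ : 0 < q₀) (hc : ‖c‖ = q₀) : conj c ≠ 0 := by
  rw [Ne, map_eq_zero, ← norm_eq_zero, hc]
  exact hq₀.ne'

theorem dual_refl (hq₀ : 0 < q₀) (f : ℂ → ℂ) {z : ℂ} (hz : z ≠ 0) :
    dual q₀ c f (refl q₀ z) = conj c * z / q₀ ^ 2 * f z := by
  have hq' : (q₀ : ℂ) ≠ 0 := by exact_mod_cast hq₀.ne'
  rw [dual, refl_refl hq₀, refl]
  field_simp

theorem eq_neg_mul_dual (hq₀ : 0 < q₀) (hc : ‖c‖ = q₀) (f : ℂ → ℂ) {z : ℂ} (hz : z ≠ 0) :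
    f (refl q₀ z) = -(z / conj c) * dual q₀ c f z := by
  have := conj_ne_zero_of_norm hq₀ hc
  rw [dual]
  field_simp

theorem differentiableAt_dual {f : ℂ → ℂ} {z : ℂ} (hz : z ≠ 0)
    (h : DifferentiableAt ℂ f (refl q₀ z)) : DifferentiableAt ℂ (dual q₀ c f) z := by
  have h1 : DifferentiableAt ℂ (fun z => f (refl q₀ z)) z :=
    h.comp z (hasDerivAt_refl hz).differentiableAt
  have h2 : DifferentiableAt ℂ (fun z : ℂ => -(conj c / z)) z := by
    fun_prop (disch := exact hz)
  exact h2.mul h1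

/-- The values of `f` and `f'` at the reflection of `z`, in terms of the dual function. -/
theorem deriv_eq_dual (hq₀ : 0 < q₀) (hc : ‖c‖ = q₀) {f : ℂ → ℂ} {z : ℂ} (hz : z ≠ 0)
    (h : DifferentiableAt ℂ f (refl q₀ z)) :
    f (refl q₀ z) = -(z / conj c * dual q₀ c f z) ∧
    deriv f (refl q₀ z) = -(z ^ 2 / (q₀ ^ 2 * conj c) * dual q₀ c f z +
      z ^ 3 / (q₀ ^ 2 * conj c) * deriv (dual q₀ c f) z) := by
  have hq' : (q₀ : ℂ) ≠ 0 := by exact_mod_cast hq₀.ne'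
  have hc' := conj_ne_zero_of_norm hq₀ hc
  refine ⟨by rw [eq_neg_mul_dual hq₀ hc f hz]; ring, ?_⟩
  have h1 : HasDerivAt (dual q₀ c f) _ z :=
    (((hasDerivAt_const z (conj c)).div (hasDerivAt_id z) hz).neg).mul
      (h.hasDerivAt.comp z (hasDerivAt_refl hz))
  rw [h1.deriv, eq_neg_mul_dual hq₀ hc f hz]
  simp only [id, zero_mul, mul_one, zero_sub, Pi.neg_apply, Pi.div_apply]
  field_simp
  ring

end SexticNLS

namespace SexticNLS

variable {q₀ : ℝ} {c Q : ℂ} {ι : Type*} {ξ a D X X' : ι → ℂ}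

/-! ### The reflectionless Riemann–Hilbert problem -/

/-- A principal part in which the Taylor polynomial of `n` is replaced by `n`. -/
theorem tendsto_principalPart {n : ℂ → ℂ} {w α d : ℂ} (hn : DifferentiableAt ℂ n w) :
    Tendsto (fun z => (z - w) * (α * (1 / (z - w) ^ 2 + d / (z - w)) * n z -
      α / (z - w) * (deriv n w + (d + 1 / (z - w)) * n w))) (𝓝[≠] w) (𝓝 0) := by
  have h1 := hasDerivAt_iff_tendsto_slope.1 hn.hasDerivAt
  have h2 : Tendsto n (𝓝[≠] w) (𝓝 (n w)) :=
    hn.continuousAt.tendsto.mono_left nhdsWithin_le_nhds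
  have h3 := ((h1.sub_const (deriv n w)).add ((h2.sub_const (n w)).const_mul d)).const_mul α
  simp only [sub_self, mul_zero, add_zero] at h3
  refine h3.congr' ?_
  filter_upwards [self_mem_nhdsWithin] with z hz
  have h0 : z - w ≠ 0 := sub_ne_zero.2 hz
  rw [slope_def_field]
  field_simp
  ring

/-- The function `F` (one column of the sectionally meromorphic matrix) in the reflectionless
case: it has double poles at the points `ξ n` and no jump. -/
structure IsReflectionless (q₀ : ℝ) (c Q : ℂ) (ξ a D : ι → ℂ) (F : ℂ → Fin 2 → ℂ) : Prop where
  pos : 0 < q₀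
  norm_eq : ‖c‖ = q₀
  injective : Function.Injective ξ
  mem : ∀ n, ξ n ∈ DPlus q₀
  differentiableAt : ∀ z, z ≠ 0 → z ≠ I * q₀ → z ≠ -(I * q₀) → (∀ n, z ≠ ξ n) →
    ∀ i, DifferentiableAt ℂ (fun z => F z i) z
  wronskian_eq : ∀ z, z ≠ 0 → z ≠ I * q₀ → z ≠ -(I * q₀) → (∀ n, z ≠ ξ n) →
    (∀ n, refl q₀ z ≠ ξ n) →
    F z 0 * dual q₀ c (F · 1) z - F z 1 * dual q₀ c (F · 0) z = gam q₀ z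
  tendsto_inf : Tendsto F (cocompact ℂ) (𝓝 ![1, 0])
  tendsto_zero : Tendsto (fun z => z • F z) (𝓝[≠] 0) (𝓝 ![0, c])
  tendsto_branch : ∀ p, p = I * q₀ ∨ p = -(I * q₀) → ∃ L, Tendsto F (𝓝[≠] p) (𝓝 L)
  tendsto_pole : ∀ n i, Tendsto (fun z => (z - ξ n) * (F z i -
    a n * (1 / (z - ξ n) ^ 2 + D n / (z - ξ n)) * dual q₀ c (F · i) z)) (𝓝[≠] (ξ n)) (𝓝 0)
  tendsto_potential : Tendsto (fun τ : ℝ => -(I * τ) * F (-(I * τ)) 1) atTop (𝓝 Q)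

variable {F : ℂ → Fin 2 → ℂ}

namespace IsReflectionless

theorem ne_zero (h : IsReflectionless q₀ c Q ξ a D F) (n : ι) : ξ n ≠ 0 := fun h0 =>
  zero_notMem_DPlus (h0 ▸ h.mem n)

theorem refl_ne (h : IsReflectionless q₀ c Q ξ a D F) (k n : ι) : refl q₀ (ξ k) ≠ ξ n := by
  intro e
  have h1 : ξ n ∈ DMinus q₀ := e ▸ (refl_mem_DMinus_iff h.pos).2 (h.mem k)
  have h2 : 0 < (‖ξ n‖ ^ 2 - q₀ ^ 2) * (ξ n).im := h.mem n
  exact lt_asymm h2 h1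

theorem ne_branch (h : IsReflectionless q₀ c Q ξ a D F) (n : ι) :
    ξ n ≠ I * q₀ ∧ ξ n ≠ -(I * q₀) :=
  ((mem_closedPlus_iff h.pos).1 (Or.inl (h.mem n))).2.2

theorem differentiableAt_refl (h : IsReflectionless q₀ c Q ξ a D F) (n : ι) (i : Fin 2) :
    DifferentiableAt ℂ (fun z => F z i) (refl q₀ (ξ n)) :=
  have := refl_ne_branch h.pos (h.ne_branch n).1 (h.ne_branch n).2
  h.differentiableAt _ (refl_ne_zero h.pos (h.ne_zero n)) this.1 this.2 (h.refl_ne n) i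

theorem differentiableAt_dual (h : IsReflectionless q₀ c Q ξ a D F) (n : ι) (i : Fin 2) :
    DifferentiableAt ℂ (dual q₀ c (F · i)) (ξ n) :=
  SexticNLS.differentiableAt_dual (h.ne_zero n) (h.differentiableAt_refl n i)

end IsReflectionless

variable [Fintype ι]

/-- The sum of the principal parts at the double poles `ξ n`. -/
noncomputable def poleSum (ξ a D X X' : ι → ℂ) (z : ℂ) : ℂ :=
  ∑ n, a n / (z - ξ n) * (X' n + (D n + 1 / (z - ξ n)) * X n)

theorem hasDerivAt_poleSum {z : ℂ} (hz : ∀ n, z ≠ ξ n) : HasDerivAt (poleSum ξ a D X X')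
    (-∑ n, a n / (z - ξ n) / (z - ξ n) * (X' n + (D n + 2 / (z - ξ n)) * X n)) z := by
  unfold poleSum
  rw [← Finset.sum_neg_distrib]
  refine HasDerivAt.fun_sum fun n _ => ?_
  have h0 : z - ξ n ≠ 0 := sub_ne_zero.2 (hz n)
  have h1 : HasDerivAt (fun z => z - ξ n) 1 z := (hasDerivAt_id z).sub_const _
  have h2 := ((hasDerivAt_const z (a n)).fun_div h1 h0).fun_mul
    (((((hasDerivAt_const z (1 : ℂ)).fun_div h1 h0).const_add (D n)).mul_const (X n)).const_add
      (X' n))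
  refine h2.congr_deriv ?_
  field_simp
  ring

theorem differentiableAt_poleSum {z : ℂ} (hz : ∀ n, z ≠ ξ n) :
    DifferentiableAt ℂ (poleSum ξ a D X X') z := (hasDerivAt_poleSum hz).differentiableAt

theorem tendsto_poleSum : Tendsto (poleSum ξ a D X X') (cocompact ℂ) (𝓝 0) := by
  unfold poleSum
  rw [← Finset.sum_const_zero (s := (Finset.univ : Finset ι))]
  refine tendsto_finsetSum _ fun n _ => ?_
  have h1 : Tendsto (fun z => (z - ξ n)⁻¹) (cocompact ℂ) (𝓝 0) := by
    have := (tendsto_inv₀_cobounded' (α := ℂ)).mono_right nhdsWithin_le_nhds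
    rw [Metric.cobounded_eq_cocompact] at this
    exact this.comp ((Homeomorph.subRight (ξ n)).isClosedEmbedding.tendsto_cocompact)
  have h2 := (h1.const_mul (a n)).mul (((h1.const_add (D n)).mul_const (X n)).const_add (X' n))
  rw [mul_zero, zero_mul] at h2
  refine h2.congr fun z => ?_
  simp [div_eq_mul_inv]

/-- `z f(z)` at infinity. -/
theorem tendsto_mul_poleSum : Tendsto (fun z => z * poleSum ξ a D X X' z) (cocompact ℂ)
    (𝓝 (∑ n, a n * (X' n + D n * X n))) := by
  unfold poleSum
  simp only [Finset.mul_sum]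
  refine tendsto_finsetSum _ fun n _ => ?_
  have h1 : Tendsto (fun z => (z - ξ n)⁻¹) (cocompact ℂ) (𝓝 0) := by
    have := (tendsto_inv₀_cobounded' (α := ℂ)).mono_right nhdsWithin_le_nhds
    rw [Metric.cobounded_eq_cocompact] at this
    exact this.comp ((Homeomorph.subRight (ξ n)).isClosedEmbedding.tendsto_cocompact)
  have h2 := (((h1.const_mul (ξ n)).const_add 1).const_mul (a n)).mul
    (((h1.const_add (D n)).mul_const (X n)).const_add (X' n))
  rw [mul_zero, add_zero, add_zero, mul_one] at h2
  refine h2.congr' ?_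
  filter_upwards [(Set.finite_singleton (ξ n)).isCompact.compl_mem_cocompact] with z hz
  have h0 : z - ξ n ≠ 0 := sub_ne_zero.2 hz
  field_simp
  ring

theorem tendsto_poleSum_sub (hξ : Function.Injective ξ) (k : ι) :
    Tendsto (fun z => (z - ξ k) * (poleSum ξ a D X X' z -
      a k / (z - ξ k) * (X' k + (D k + 1 / (z - ξ k)) * X k))) (𝓝[≠] (ξ k)) (𝓝 0) := by
  classical
  have h1 : Tendsto (fun z => (z - ξ k) * ∑ n ∈ Finset.univ.erase k,
      a n / (z - ξ n) * (X' n + (D n + 1 / (z - ξ n)) * X n)) (𝓝[≠] (ξ k)) (𝓝 0) := by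
    have : ContinuousAt (fun z => (z - ξ k) * ∑ n ∈ Finset.univ.erase k,
        a n / (z - ξ n) * (X' n + (D n + 1 / (z - ξ n)) * X n)) (ξ k) := by
      refine ContinuousAt.mul (by fun_prop) (tendsto_finsetSum _ fun n hn => ?_)
      have h0 : ξ k - ξ n ≠ 0 :=
        sub_ne_zero.2 fun h => Finset.ne_of_mem_erase hn (hξ h).symm
      have : ContinuousAt (fun z => a n / (z - ξ n) * (X' n + (D n + 1 / (z - ξ n)) * X n))
          (ξ k) := by fun_prop (disch := exact h0)
      exact this
    simpa using this.tendsto.mono_left nhdsWithin_le_nhds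
  refine h1.congr fun z => ?_
  rw [poleSum, ← Finset.add_sum_erase _ _ (Finset.mem_univ k), add_sub_cancel_left]

namespace IsReflectionless

/-- The partial fraction expansion of the second row. -/
theorem eq_poleSum (h : IsReflectionless q₀ c Q ξ a D F) {z : ℂ} (h0 : z ≠ 0) (h1 : z ≠ I * q₀)
    (h2 : z ≠ -(I * q₀)) (h3 : ∀ n, z ≠ ξ n) :
    F z 1 = c / z + poleSum ξ a D (fun n => dual q₀ c (F · 1) (ξ n))
      (fun n => deriv (dual q₀ c (F · 1)) (ξ n)) z := by
  set P := poleSum ξ a D (fun n => dual q₀ c (F · 1) (ξ n))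
      (fun n => deriv (dual q₀ c (F · 1)) (ξ n)) with hP
  set S : Set ℂ := {0, I * q₀, -(I * q₀)} ∪ Set.range ξ with hS
  have hmem : ∀ w ∉ S, w ≠ 0 ∧ w ≠ I * q₀ ∧ w ≠ -(I * q₀) ∧ ∀ n, w ≠ ξ n := by
    intro w hw
    simp only [hS, Set.mem_union, Set.mem_insert_iff, Set.mem_singleton_iff, Set.mem_range,
      not_or, not_exists] at hw
    exact ⟨hw.1.1, hw.1.2.1, hw.1.2.2, fun n e => hw.2 n e.symm⟩
  have hq' : (q₀ : ℂ) ≠ 0 := by exact_mod_cast h.pos.ne'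
  have key := eq_zero_of_removable_of_tendsto_zero (h := fun z => F z 1 - (c / z + P z)) (S := S)
    ((Set.toFinite _).union (Set.finite_range ξ)) ?_ ?_ ?_ z ?_
  · exact sub_eq_zero.1 key
  · intro w hw
    obtain ⟨w0, w1, w2, w3⟩ := hmem w hw
    have d1 : DifferentiableAt ℂ (fun z => c / z) w := by fun_prop (disch := exact w0)
    exact (h.differentiableAt w w0 w1 w2 w3 1).sub (d1.add (differentiableAt_poleSum w3))
  · have regular : ∀ w, (∀ n, w ≠ ξ n) → Tendsto (fun z => (z - w) * P z) (𝓝[≠] w) (𝓝 0) := by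
      intro w hw
      have : ContinuousAt (fun z => (z - w) * P z) w :=
        ContinuousAt.mul (by fun_prop) (differentiableAt_poleSum hw).continuousAt
      simpa using this.tendsto.mono_left nhdsWithin_le_nhds
    rintro w (hw | ⟨n, rfl⟩)
    · rcases hw with rfl | hw
      · have r := regular 0 fun n => (h.ne_zero n).symm
        have t := ((tendsto_pi_nhds.1 h.tendsto_zero 1).sub_const c).sub r
        simp only [Matrix.cons_val_one, Matrix.cons_val_fin_one, sub_self] at t
        refine t.congr' ?_
        filter_upwards [self_mem_nhdsWithin] with z (hz : z ≠ 0)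
        simp only [Pi.smul_apply, smul_eq_mul]
        field_simp
        ring
      · have hw' : w = I * q₀ ∨ w = -(I * q₀) := hw
        have hw0 : w ≠ 0 := by rcases hw' with rfl | rfl <;> simp [hq']
        have hwn : ∀ n, w ≠ ξ n := fun n e => by
          have := h.ne_branch n
          rcases hw' with rfl | rfl
          exacts [this.1 e.symm, this.2 e.symm]
        obtain ⟨L, hL⟩ := h.tendsto_branch w hw'
        have t1 : Tendsto (fun z : ℂ => z - w) (𝓝[≠] w) (𝓝 0) := by
          have : ContinuousAt (fun z : ℂ => z - w) w := by fun_prop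
          simpa using this.tendsto.mono_left nhdsWithin_le_nhds
        have t2 := t1.mul (tendsto_pi_nhds.1 hL 1)
        have t3 : Tendsto (fun z => c / z) (𝓝[≠] w) (𝓝 (c / w)) := by
          have : ContinuousAt (fun z => c / z) w := by fun_prop (disch := exact hw0)
          exact this.tendsto.mono_left nhdsWithin_le_nhds
        have t4 := (t2.sub (t1.mul t3)).sub (regular w hwn)
        simp only [zero_mul, sub_zero] at t4
        exact t4.congr fun z => by ring
    · have t1 := h.tendsto_pole n 1
      have t2 := tendsto_principalPart (α := a n) (d := D n) (h.differentiableAt_dual n 1)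
      have t3 := tendsto_poleSum_sub (a := a) (D := D) (X := fun n => dual q₀ c (F · 1) (ξ n))
        (X' := fun n => deriv (dual q₀ c (F · 1)) (ξ n)) h.injective n
      have t4 : Tendsto (fun z => (z - ξ n) * (c / z)) (𝓝[≠] (ξ n)) (𝓝 0) := by
        have h0 := h.ne_zero n
        have : ContinuousAt (fun z => (z - ξ n) * (c / z)) (ξ n) := by
          fun_prop (disch := exact h0)
        simpa using this.tendsto.mono_left nhdsWithin_le_nhds
      have t5 := ((t1.add t2).sub t3).sub t4
      simp only [add_zero, sub_zero] at t5
      refine t5.congr fun z => ?_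
      simp only [← hP]
      ring
  · have t1 := tendsto_pi_nhds.1 h.tendsto_inf 1
    have t2 : Tendsto (fun z => c / z) (cocompact ℂ) (𝓝 0) := by
      have := (tendsto_inv₀_cobounded' (α := ℂ)).mono_right nhdsWithin_le_nhds
      rw [Metric.cobounded_eq_cocompact] at this
      simpa [div_eq_mul_inv] using this.const_mul c
    have t3 := t1.sub (t2.add (tendsto_poleSum (ξ := ξ) (a := a) (D := D)
      (X := fun n => dual q₀ c (F · 1) (ξ n)) (X' := fun n => deriv (dual q₀ c (F · 1)) (ξ n))))
    simpa using t3
  · simp only [hS, Set.mem_union, Set.mem_insert_iff, Set.mem_singleton_iff, Set.mem_range,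
      not_or, not_exists]
    exact ⟨⟨h0, h1, h2⟩, fun n e => h3 n e.symm⟩

/-- The linear system. -/
theorem linear_system (h : IsReflectionless q₀ c Q ξ a D F) (k : ι) :
    (poleSum ξ a D (fun n => dual q₀ c (F · 1) (ξ n)) (fun n => deriv (dual q₀ c (F · 1)) (ξ n))
        (refl q₀ (ξ k)) + ξ k / conj c * dual q₀ c (F · 1) (ξ k) = -(c / refl q₀ (ξ k))) ∧
    (-deriv (poleSum ξ a D (fun n => dual q₀ c (F · 1) (ξ n))
        (fun n => deriv (dual q₀ c (F · 1)) (ξ n))) (refl q₀ (ξ k))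
        - ξ k ^ 2 / (q₀ ^ 2 * conj c) * dual q₀ c (F · 1) (ξ k)
        - ξ k ^ 3 / (q₀ ^ 2 * conj c) * deriv (dual q₀ c (F · 1)) (ξ k) =
      -(c / refl q₀ (ξ k) ^ 2)) := by
  set P := poleSum ξ a D (fun n => dual q₀ c (F · 1) (ξ n))
      (fun n => deriv (dual q₀ c (F · 1)) (ξ n)) with hP
  have hz := refl_ne_zero h.pos (h.ne_zero k)
  have hb := refl_ne_branch h.pos (h.ne_branch k).1 (h.ne_branch k).2
  obtain ⟨e1, e2⟩ := deriv_eq_dual h.pos h.norm_eq (h.ne_zero k) (h.differentiableAt_refl k 1)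
  have e3 := h.eq_poleSum hz hb.1 hb.2 (h.refl_ne k)
  have ev : (fun z => F z 1) =ᶠ[𝓝 (refl q₀ (ξ k))] fun z => c / z + P z := by
    have f1 := eventually_ne_nhds hz
    have f2 := eventually_ne_nhds hb.1
    have f3 := eventually_ne_nhds hb.2
    have f4 : ∀ᶠ z in 𝓝 (refl q₀ (ξ k)), ∀ n, z ≠ ξ n :=
      eventually_all.2 fun n => eventually_ne_nhds (h.refl_ne k n)
    filter_upwards [f1, f2, f3, f4] with z z1 z2 z3 z4
    exact h.eq_poleSum z1 z2 z3 z4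
  have hPd : DifferentiableAt ℂ P (refl q₀ (ξ k)) := differentiableAt_poleSum (h.refl_ne k)
  have hd : HasDerivAt (fun z => c / z + P z) (-(c / refl q₀ (ξ k) ^ 2) +
      deriv P (refl q₀ (ξ k))) (refl q₀ (ξ k)) := by
    refine (((hasDerivAt_const _ c).fun_div (hasDerivAt_id _) hz).add hPd.hasDerivAt).congr_deriv ?_
    simp only [id, zero_mul, mul_one, zero_sub, neg_div, refl]
  have e4 : deriv (fun z => F z 1) (refl q₀ (ξ k)) = -(c / refl q₀ (ξ k) ^ 2) +
      deriv P (refl q₀ (ξ k)) := by rw [ev.deriv_eq, hd.deriv]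
  rw [← hP] at e3
  constructor
  · linear_combination e1 - e3
  · linear_combination e4 - e2

/-- The reconstruction formula. -/
theorem potential_eq (h : IsReflectionless q₀ c Q ξ a D F) :
    Q = c + ∑ n, a n * (deriv (dual q₀ c (F · 1)) (ξ n) + D n * dual q₀ c (F · 1) (ξ n)) := by
  set P := poleSum ξ a D (fun n => dual q₀ c (F · 1) (ξ n))
      (fun n => deriv (dual q₀ c (F · 1)) (ξ n)) with hP
  have t1 : Tendsto (fun z => z * F z 1) (cocompact ℂ)
      (𝓝 (c + ∑ n, a n * (deriv (dual q₀ c (F · 1)) (ξ n) + D n * dual q₀ c (F · 1) (ξ n)))) := by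
    refine ((tendsto_mul_poleSum (ξ := ξ)).const_add c).congr' ?_
    have hfin : (({0, I * q₀, -(I * q₀)} : Set ℂ) ∪ Set.range ξ).Finite :=
      (Set.toFinite _).union (Set.finite_range ξ)
    filter_upwards [hfin.isCompact.compl_mem_cocompact] with z hz
    simp only [Set.mem_compl_iff, Set.mem_union, Set.mem_insert_iff, Set.mem_singleton_iff,
      Set.mem_range, not_or, not_exists] at hz
    rw [h.eq_poleSum hz.1.1 hz.1.2.1 hz.1.2.2 fun n e => hz.2 n e.symm, mul_add,
      mul_div_cancel₀ _ hz.1.1]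
  have t2 : Tendsto (fun τ : ℝ => -(I * (τ : ℂ))) atTop (cocompact ℂ) := by
    have := (tendsto_I_mul_infPlus h.pos).mono_right inf_le_left
    exact (Homeomorph.neg ℂ).isClosedEmbedding.tendsto_cocompact.comp this
  exact tendsto_nhds_unique h.tendsto_potential (t1.comp t2)

end IsReflectionless

end SexticNLS

namespace SexticNLS

variable {q₀ : ℝ} {c Q : ℂ} {ι : Type*} {ξ a D X X' : ι → ℂ} {F : ℂ → Fin 2 → ℂ}

/-! ### Unique solvability of the linear system -/

namespace IsReflectionless

/-- The exceptional points of the quotient of Wronskians. -/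
def exceptional (q₀ : ℝ) (ξ : ι → ℂ) : Set ℂ :=
  {0, I * (q₀ : ℂ), -(I * (q₀ : ℂ))} ∪ (Set.range ξ ∪ Set.range fun n => refl q₀ (ξ n))

/-- A Wronskian of the homogeneous solution and `F`, divided by `γ`. -/
noncomputable def quotient (q₀ : ℝ) (c : ℂ) (f g : ℂ → ℂ) (z : ℂ) : ℂ :=
  (f z * dual q₀ c g z - dual q₀ c f z * g z) / gam q₀ z

theorem quotient_refl (hq₀ : 0 < q₀) (hc : ‖c‖ = q₀) (f g : ℂ → ℂ) {z : ℂ} (hz : z ≠ 0) :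
    quotient q₀ c f g (refl q₀ z) = quotient q₀ c f g z := by
  have hq' : (q₀ : ℂ) ≠ 0 := by exact_mod_cast hq₀.ne'
  have hc' := conj_ne_zero_of_norm hq₀ hc
  have e : f (refl q₀ z) * dual q₀ c g (refl q₀ z) - dual q₀ c f (refl q₀ z) * g (refl q₀ z) =
      z ^ 2 / q₀ ^ 2 * (f z * dual q₀ c g z - dual q₀ c f z * g z) := by
    rw [eq_neg_mul_dual hq₀ hc f hz, eq_neg_mul_dual hq₀ hc g hz, dual_refl hq₀ f hz,
      dual_refl hq₀ g hz]
    field_simp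
    ring
  rw [quotient, e, gam_refl hq₀ hz, quotient, mul_div_mul_left]
  exact div_ne_zero (pow_ne_zero _ hz) (pow_ne_zero _ hq')

theorem mem_exceptional {z : ℂ} (hz : z ∉ exceptional q₀ ξ) : z ≠ 0 ∧ z ≠ I * q₀ ∧
    z ≠ -(I * q₀) ∧ (∀ n, z ≠ ξ n) ∧ ∀ n, z ≠ refl q₀ (ξ n) := by
  simp only [exceptional, Set.mem_union, Set.mem_insert_iff, Set.mem_singleton_iff, Set.mem_range,
    not_or, not_exists] at hz
  exact ⟨hz.1.1, hz.1.2.1, hz.1.2.2, fun n e => hz.2.1 n e.symm, fun n e => hz.2.2 n e.symm⟩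

theorem tendsto_dual_inf (h : IsReflectionless q₀ c Q ξ a D F) (i : Fin 2) :
    Tendsto (dual q₀ c (F · i)) (cocompact ℂ) (𝓝 (![0, 1] i)) := by
  have hq' : (q₀ : ℂ) ≠ 0 := by exact_mod_cast h.pos.ne'
  have t := ((tendsto_pi_nhds.1 h.tendsto_zero i).comp (tendsto_refl_cocompact h.pos)).const_mul
    (conj c / q₀ ^ 2)
  have e : conj c / (q₀ : ℂ) ^ 2 * (![0, c] : Fin 2 → ℂ) i = ![0, 1] i := by
    fin_cases i
    · simp
    · have := mul_conj_of_norm h.norm_eq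
      simp
      field_simp
      linear_combination this
  rw [e] at t
  refine t.congr' ?_
  filter_upwards [(Set.finite_singleton (0 : ℂ)).isCompact.compl_mem_cocompact] with z hz
  have hz0 : z ≠ 0 := hz
  simp only [Function.comp_apply, Pi.smul_apply, smul_eq_mul, dual]
  rw [refl]
  field_simp

variable [Fintype ι]

/-- A solution of the homogeneous system is the vector of values at the points `ξ n` of the dual
of the sum of principal parts. -/
theorem dual_poleSum_eq (h : IsReflectionless q₀ c Q ξ a D F) {k : ι}
    (e1 : poleSum ξ a D X X' (refl q₀ (ξ k)) + ξ k / conj c * X k = 0)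
    (e2 : -deriv (poleSum ξ a D X X') (refl q₀ (ξ k)) - ξ k ^ 2 / (q₀ ^ 2 * conj c) * X k
        - ξ k ^ 3 / (q₀ ^ 2 * conj c) * X' k = 0) :
    dual q₀ c (poleSum ξ a D X X') (ξ k) = X k ∧
      deriv (dual q₀ c (poleSum ξ a D X X')) (ξ k) = X' k := by
  have hq' : (q₀ : ℂ) ≠ 0 := by exact_mod_cast h.pos.ne'
  have hc := conj_ne_zero_of_norm h.pos h.norm_eq
  have h0 := h.ne_zero k
  obtain ⟨d1, d2⟩ := deriv_eq_dual h.pos h.norm_eq h0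
    (differentiableAt_poleSum (a := a) (D := D) (X := X) (X' := X') (h.refl_ne k))
  have f1 : dual q₀ c (poleSum ξ a D X X') (ξ k) = X k := by
    rw [d1] at e1
    have : ξ k / conj c * (X k - dual q₀ c (poleSum ξ a D X X') (ξ k)) = 0 := by
      linear_combination e1
    rcases mul_eq_zero.1 this with h1 | h1
    · exact absurd h1 (div_ne_zero h0 hc)
    · exact (sub_eq_zero.1 h1).symm
  refine ⟨f1, ?_⟩
  rw [d2, f1] at e2
  have : ξ k ^ 3 / (q₀ ^ 2 * conj c) * (X' k - deriv (dual q₀ c (poleSum ξ a D X X')) (ξ k)) = 0 := by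
    linear_combination -e2
  rcases mul_eq_zero.1 this with h1 | h1
  · exact absurd h1 (div_ne_zero (pow_ne_zero _ h0) (mul_ne_zero (pow_ne_zero _ hq') hc))
  · exact (sub_eq_zero.1 h1).symm

theorem quotient_eq_zero (h : IsReflectionless q₀ c Q ξ a D F)
    (e1 : ∀ k, poleSum ξ a D X X' (refl q₀ (ξ k)) + ξ k / conj c * X k = 0)
    (e2 : ∀ k, -deriv (poleSum ξ a D X X') (refl q₀ (ξ k)) - ξ k ^ 2 / (q₀ ^ 2 * conj c) * X k
        - ξ k ^ 3 / (q₀ ^ 2 * conj c) * X' k = 0) (i : Fin 2) :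
    ∀ z ∉ exceptional q₀ ξ, quotient q₀ c (poleSum ξ a D X X') (F · i) z = 0 := by
  set f := poleSum ξ a D X X' with hf
  have hq' : (q₀ : ℂ) ≠ 0 := by exact_mod_cast h.pos.ne'
  have hgam : ∀ {w : ℂ}, w ≠ 0 → ContinuousAt (gam q₀) w := fun {w} hw => by
    have : w ^ 2 ≠ 0 := pow_ne_zero _ hw
    unfold gam
    fun_prop (disch := assumption)
  have hinf : Tendsto (quotient q₀ c f (F · i)) (cocompact ℂ) (𝓝 0) := by
    have t1 : Tendsto f (cocompact ℂ) (𝓝 0) := tendsto_poleSum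
    have t2 := h.tendsto_dual_inf i
    have t4 := tendsto_pi_nhds.1 h.tendsto_inf i
    have ti : Tendsto (fun z : ℂ => z⁻¹) (cocompact ℂ) (𝓝 0) := by
      have := (tendsto_inv₀_cobounded' (α := ℂ)).mono_right nhdsWithin_le_nhds
      rwa [Metric.cobounded_eq_cocompact] at this
    have t3 : Tendsto (dual q₀ c f) (cocompact ℂ) (𝓝 0) := by
      have hf0 : ContinuousAt f 0 :=
        (differentiableAt_poleSum fun n => (h.ne_zero n).symm).continuousAt
      have t5 := hf0.tendsto.comp ((tendsto_refl_cocompact h.pos).mono_right nhdsWithin_le_nhds)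
      have t6 := (ti.const_mul (-conj c)).mul t5
      rw [mul_zero, zero_mul] at t6
      refine t6.congr fun z => ?_
      simp only [dual, Function.comp_apply]
      ring
    have t7 : Tendsto (gam q₀) (cocompact ℂ) (𝓝 1) := by
      have := ((ti.pow 2).const_mul ((q₀ : ℂ) ^ 2)).const_add 1
      norm_num at this
      refine this.congr fun z => ?_
      simp [gam, div_eq_mul_inv]
    have t8 := ((t1.mul t2).sub (t3.mul t4)).div t7 one_ne_zero
    rw [zero_mul, zero_mul, sub_zero, zero_div] at t8
    exact t8
  have hpole : ∀ n, Tendsto (fun z => (z - ξ n) * quotient q₀ c f (F · i) z) (𝓝[≠] (ξ n)) (𝓝 0) := by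
    intro n
    have df : DifferentiableAt ℂ (dual q₀ c f) (ξ n) :=
      SexticNLS.differentiableAt_dual (h.ne_zero n) (differentiableAt_poleSum (h.refl_ne n))
    have dF := h.differentiableAt_dual n i
    have cf : Tendsto (dual q₀ c f) (𝓝[≠] (ξ n)) (𝓝 (dual q₀ c f (ξ n))) :=
      df.continuousAt.tendsto.mono_left nhdsWithin_le_nhds
    have cF : Tendsto (dual q₀ c (F · i)) (𝓝[≠] (ξ n)) (𝓝 (dual q₀ c (F · i) (ξ n))) :=
      dF.continuousAt.tendsto.mono_left nhdsWithin_le_nhds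
    have cg : Tendsto (gam q₀) (𝓝[≠] (ξ n)) (𝓝 (gam q₀ (ξ n))) :=
      (hgam (h.ne_zero n)).tendsto.mono_left nhdsWithin_le_nhds
    obtain ⟨v1, v2⟩ := h.dual_poleSum_eq (e1 n) (e2 n)
    rw [← hf] at v1 v2
    have p1 := tendsto_poleSum_sub (a := a) (D := D) (X := X) (X' := X') h.injective n
    have p2 := tendsto_principalPart (α := a n) (d := D n) df
    rw [v1, v2] at p2
    have p3 := h.tendsto_pole n i
    have p4 := ((p1.sub p2).mul cF).sub (p3.mul cf)
    have p5 := p4.div cg (gam_ne_zero (h.ne_zero n) (h.ne_branch n).1 (h.ne_branch n).2)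
    simp only [sub_self, zero_mul, zero_div] at p5
    refine p5.congr fun z => ?_
    simp only [quotient, ← hf, Pi.div_apply]
    ring
  refine eq_zero_of_removable_of_tendsto_zero
    ((Set.toFinite _).union ((Set.finite_range _).union (Set.finite_range _))) ?_ ?_ hinf
  · intro w hw
    obtain ⟨w0, w1, w2, w3, w4⟩ := mem_exceptional hw
    have r1 := refl_ne_branch h.pos w1 w2
    have r2 : ∀ n, refl q₀ w ≠ ξ n := fun n e => w4 n ((refl_eq_iff h.pos).1 e)
    have d1 : DifferentiableAt ℂ f w := differentiableAt_poleSum w3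
    have d2 : DifferentiableAt ℂ f (refl q₀ w) := differentiableAt_poleSum r2
    have d3 := h.differentiableAt w w0 w1 w2 w3 i
    have d4 := h.differentiableAt _ (refl_ne_zero h.pos w0) r1.1 r1.2 r2 i
    have d5 : DifferentiableAt ℂ (gam q₀) w := by
      have : w ^ 2 ≠ 0 := pow_ne_zero _ w0
      unfold gam
      fun_prop (disch := assumption)
    exact ((d1.mul (SexticNLS.differentiableAt_dual w0 d4)).sub
      ((SexticNLS.differentiableAt_dual w0 d2).mul d3)).div d5 (gam_ne_zero w0 w1 w2)
  · rintro w (hw | ⟨n, rfl⟩ | ⟨n, rfl⟩)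
    · rcases hw with rfl | hw
      · have t1 : Tendsto (fun z : ℂ => z - 0) (𝓝[≠] 0) (𝓝 0) := by
          have : ContinuousAt (fun z : ℂ => z - 0) 0 := by fun_prop
          simpa using this.tendsto.mono_left (nhdsWithin_le_nhds (s := {0}ᶜ))
        have t2 := t1.mul (hinf.comp (tendsto_refl_zero h.pos))
        rw [mul_zero] at t2
        refine t2.congr' ?_
        filter_upwards [self_mem_nhdsWithin] with z hz
        rw [Function.comp_apply, quotient_refl h.pos h.norm_eq _ _ hz]
      · have hw' : w = I * q₀ ∨ w = -(I * q₀) := hw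
        have hw0 : w ≠ 0 := by rcases hw' with rfl | rfl <;> simp [hq']
        have hwr : refl q₀ w = w := by
          rcases hw' with rfl | rfl
          exacts [refl_branch q₀, refl_neg_branch q₀]
        have hwn : ∀ n, w ≠ ξ n := fun n e => by
          have := h.ne_branch n
          rcases hw' with rfl | rfl
          exacts [this.1 e.symm, this.2 e.symm]
        have hg : ∀ z : ℂ, z ≠ 0 → gam q₀ z = (z - w) * (z + w) / z ^ 2 := fun z hz => by
          rw [gam_eq q₀ hz]
          rcases hw' with rfl | rfl <;> ring
        obtain ⟨L, hL⟩ := h.tendsto_branch w hw'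
        have tL := tendsto_pi_nhds.1 hL i
        have tr := tendsto_refl_punctured h.pos hw0
        rw [hwr] at tr
        have tc : Tendsto (fun z => -(conj c / z)) (𝓝[≠] w) (𝓝 (-(conj c / w))) := by
          have : ContinuousAt (fun z => -(conj c / z)) w := by fun_prop (disch := exact hw0)
          exact this.tendsto.mono_left nhdsWithin_le_nhds
        have cf : Tendsto f (𝓝[≠] w) (𝓝 (f w)) :=
          (differentiableAt_poleSum hwn).continuousAt.tendsto.mono_left nhdsWithin_le_nhds
        have t1 := (cf.mul (tc.mul (tL.comp tr))).sub ((tc.mul (cf.comp tr)).mul tL)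
        have t2 : Tendsto (fun z => z ^ 2 / (z + w)) (𝓝[≠] w) (𝓝 (w ^ 2 / (w + w))) := by
          have : w + w ≠ 0 := by rw [← two_mul]; exact mul_ne_zero two_ne_zero hw0
          have : ContinuousAt (fun z => z ^ 2 / (z + w)) w := by fun_prop (disch := exact this)
          exact this.tendsto.mono_left nhdsWithin_le_nhds
        have t3 := t1.mul t2
        have e0 : (f w * (-(conj c / w) * L i) - -(conj c / w) * f w * L i) * (w ^ 2 / (w + w))
            = 0 := by ring
        rw [e0] at t3
        refine t3.congr' ?_
        filter_upwards [self_mem_nhdsWithin, nhdsWithin_le_nhds (eventually_ne_nhds hw0)]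
          with z hz hz0
        have hzw : z - w ≠ 0 := sub_ne_zero.2 hz
        simp only [quotient, dual, Function.comp_apply, hg z hz0]
        field_simp
    · exact hpole n
    · have hz0 := refl_ne_zero h.pos (h.ne_zero n)
      have tr := tendsto_refl_punctured h.pos hz0
      rw [refl_refl h.pos] at tr
      have t1 := (hpole n).comp tr
      have t2 : Tendsto (fun z => z * (-(ξ n))⁻¹) (𝓝[≠] (refl q₀ (ξ n)))
          (𝓝 (refl q₀ (ξ n) * (-(ξ n))⁻¹)) := by
        have : ContinuousAt (fun z => z * (-(ξ n))⁻¹) (refl q₀ (ξ n)) := by fun_prop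
        exact this.tendsto.mono_left nhdsWithin_le_nhds
      have t3 := t2.mul t1
      rw [mul_zero] at t3
      refine t3.congr' ?_
      filter_upwards [nhdsWithin_le_nhds (eventually_ne_nhds hz0)] with z hz
      have hn := h.ne_zero n
      simp only [Function.comp_apply]
      rw [quotient_refl h.pos h.norm_eq _ _ hz, ← mul_assoc]
      congr 1
      simp only [refl]
      field_simp
      ring

/-- The homogeneous linear system has only the trivial solution. -/
theorem eq_zero_of_homogeneous (h : IsReflectionless q₀ c Q ξ a D F)
    (e1 : ∀ k, poleSum ξ a D X X' (refl q₀ (ξ k)) + ξ k / conj c * X k = 0)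
    (e2 : ∀ k, -deriv (poleSum ξ a D X X') (refl q₀ (ξ k)) - ξ k ^ 2 / (q₀ ^ 2 * conj c) * X k
        - ξ k ^ 3 / (q₀ ^ 2 * conj c) * X' k = 0) (k : ι) : X k = 0 ∧ X' k = 0 := by
  set f := poleSum ξ a D X X' with hf
  have hfin : (exceptional q₀ ξ).Finite :=
    (Set.toFinite _).union ((Set.finite_range _).union (Set.finite_range _))
  have key : ∀ z ∉ exceptional q₀ ξ, dual q₀ c f z = 0 := by
    intro z hz
    obtain ⟨w0, w1, w2, w3, w4⟩ := mem_exceptional hz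
    have r2 : ∀ n, refl q₀ z ≠ ξ n := fun n e => w4 n ((refl_eq_iff h.pos).1 e)
    have hg := gam_ne_zero w0 w1 w2
    have q1 := (div_eq_zero_iff.1 (h.quotient_eq_zero e1 e2 0 z hz)).resolve_right hg
    have q2 := (div_eq_zero_iff.1 (h.quotient_eq_zero e1 e2 1 z hz)).resolve_right hg
    rw [← hf] at q1 q2
    have w := h.wronskian_eq z w0 w1 w2 w3 r2
    have : dual q₀ c f z * gam q₀ z = 0 := by
      rw [← w]
      linear_combination dual q₀ c (F · 0) z * q2 - dual q₀ c (F · 1) z * q1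
    exact (mul_eq_zero.1 this).resolve_right hg
  have df : DifferentiableAt ℂ (dual q₀ c f) (ξ k) :=
    SexticNLS.differentiableAt_dual (h.ne_zero k) (differentiableAt_poleSum (h.refl_ne k))
  have ev : ∀ᶠ z in 𝓝[≠] (ξ k), dual q₀ c f z = 0 := by
    have : ((exceptional q₀ ξ) \ {ξ k})ᶜ ∈ 𝓝 (ξ k) :=
      (hfin.subset Set.sdiff_subset).isClosed.isOpen_compl.mem_nhds (by simp)
    filter_upwards [nhdsWithin_le_nhds this, self_mem_nhdsWithin] with z hz hz'
    exact key z fun hm => hz ⟨hm, hz'⟩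
  have v0 : dual q₀ c f (ξ k) = 0 := by
    have t1 : Tendsto (dual q₀ c f) (𝓝[≠] (ξ k)) (𝓝 (dual q₀ c f (ξ k))) :=
      df.continuousAt.tendsto.mono_left nhdsWithin_le_nhds
    exact tendsto_nhds_unique t1 (tendsto_const_nhds.congr' (ev.mono fun z hz => hz.symm))
  have ev2 : dual q₀ c f =ᶠ[𝓝 (ξ k)] fun _ => 0 := by
    rw [eventually_nhdsWithin_iff] at ev
    filter_upwards [ev] with z hz
    by_cases hzk : z = ξ k
    · rw [hzk, v0]
    · exact hz hzk
  obtain ⟨v1, v2⟩ := h.dual_poleSum_eq (e1 k) (e2 k)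
  rw [← hf] at v1 v2
  rw [← v1, ← v2, v0, ev2.deriv_eq]
  simp

end IsReflectionless

end SexticNLS

namespace SexticNLS

variable {δ q₀ x t : ℝ} {qm Q : ℂ} {N : ℕ} {zn : Fin N → ℂ} {A B : Fin N ⊕ Fin N → ℂ}
  {F : ℂ → Fin 2 → ℂ}

/-! ### The linear system in matrix form -/

/-- The residue factor `A_n exp(-2 i θ(ξ_n))`. -/
noncomputable def residueFactor (δ q₀ : ℝ) (zn : Fin N → ℂ) (A : Fin N ⊕ Fin N → ℂ) (x t : ℝ)
    (n : Fin N ⊕ Fin N) : ℂ := A n * exp (-(2 * I * theta δ q₀ x t (xi q₀ zn n)))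

theorem sysM_mulVec_inl (X X' : Fin N ⊕ Fin N → ℂ) (k : Fin N ⊕ Fin N) :
    (sysM δ q₀ qm zn A B x t).mulVec (Sum.elim X X') (Sum.inl k) =
      poleSum (xi q₀ zn) (residueFactor δ q₀ zn A x t) (coeffD δ q₀ zn B x t) X X'
        (refl q₀ (xi q₀ zn k)) + xi q₀ zn k / conj qm * X k := by
  rw [sysM, Matrix.fromBlocks_mulVec]
  simp only [Sum.elim_inl, Pi.add_apply, Matrix.mulVec, dotProduct, Matrix.of_apply,
    Function.comp_apply, Sum.elim_inr, add_mul, Finset.sum_add_distrib, ite_mul, zero_mul,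
    Finset.sum_ite_eq, Finset.mem_univ, if_true]
  rw [add_right_comm, ← Finset.sum_add_distrib]
  congr 1
  refine Finset.sum_congr rfl fun n _ => ?_
  simp only [coeffC, residueFactor, xiStar, refl]
  ring

theorem sysM_mulVec_inr (X X' : Fin N ⊕ Fin N → ℂ) (k : Fin N ⊕ Fin N)
    (hk : ∀ n, refl q₀ (xi q₀ zn k) ≠ xi q₀ zn n) :
    (sysM δ q₀ qm zn A B x t).mulVec (Sum.elim X X') (Sum.inr k) =
      -deriv (poleSum (xi q₀ zn) (residueFactor δ q₀ zn A x t) (coeffD δ q₀ zn B x t) X X')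
        (refl q₀ (xi q₀ zn k)) - xi q₀ zn k ^ 2 / (q₀ ^ 2 * conj qm) * X k
        - xi q₀ zn k ^ 3 / (q₀ ^ 2 * conj qm) * X' k := by
  rw [sysM, Matrix.fromBlocks_mulVec, (hasDerivAt_poleSum hk).deriv]
  simp only [Sum.elim_inr, Pi.add_apply, Matrix.mulVec, dotProduct, Matrix.of_apply,
    Function.comp_apply, Sum.elim_inl, sub_mul, Finset.sum_sub_distrib, ite_mul, zero_mul,
    Finset.sum_ite_eq, Finset.mem_univ, if_true, neg_neg]
  rw [sub_add_sub_comm, ← Finset.sum_add_distrib, ← sub_sub]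
  congr 2
  refine Finset.sum_congr rfl fun n _ => ?_
  simp only [coeffC, residueFactor, xiStar, refl]
  ring

/-- Solvability of the linear system, Cramer's rule and the reconstruction of the potential. -/
theorem IsReflectionless.reconstruction
    (h : IsReflectionless q₀ qm Q (xi q₀ zn) (residueFactor δ q₀ zn A x t)
      (coeffD δ q₀ zn B x t) F) {X : (Fin N ⊕ Fin N) ⊕ (Fin N ⊕ Fin N) → ℂ}
    (hX : X = Sum.elim (fun n => dual q₀ qm (F · 1) (xi q₀ zn n))
      (fun n => deriv (dual q₀ qm (F · 1)) (xi q₀ zn n))) :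
    (sysM δ q₀ qm zn A B x t).mulVec X = sysV q₀ qm zn ∧
    (sysM δ q₀ qm zn A B x t).det ≠ 0 ∧
    (∀ j, X j = cramerX δ q₀ qm zn A B x t j) ∧
    Q = reconstruct δ q₀ qm zn A B x t X ∧
    Q = reconstruct δ q₀ qm zn A B x t (cramerX δ q₀ qm zn A B x t) := by
  have h1 : (sysM δ q₀ qm zn A B x t).mulVec X = sysV q₀ qm zn := by
    subst hX
    funext j
    rcases j with k | k
    · rw [sysM_mulVec_inl]
      exact (h.linear_system k).1
    · rw [sysM_mulVec_inr _ _ _ (h.refl_ne k)]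
      exact (h.linear_system k).2
  have h2 : (sysM δ q₀ qm zn A B x t).det ≠ 0 := by
    intro hdet
    obtain ⟨v, hv0, hv⟩ := Matrix.exists_mulVec_eq_zero_iff.2 hdet
    have hv' : v = Sum.elim (fun n => v (Sum.inl n)) (fun n => v (Sum.inr n)) := by
      funext j
      rcases j with k | k <;> rfl
    rw [hv'] at hv
    have := h.eq_zero_of_homogeneous (X := fun n => v (Sum.inl n)) (X' := fun n => v (Sum.inr n))
      (fun k => by rw [← sysM_mulVec_inl, hv]; rfl)
      (fun k => by rw [← sysM_mulVec_inr _ _ _ (h.refl_ne k), hv]; rfl)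
    refine hv0 (funext fun j => ?_)
    rcases j with k | k
    exacts [(this k).1, (this k).2]
  have h3 : ∀ j, X j = cramerX δ q₀ qm zn A B x t j := by
    intro j
    have e := Matrix.cramer_eq_adjugate_mulVec (sysM δ q₀ qm zn A B x t) (sysV q₀ qm zn)
    rw [← h1, Matrix.mulVec_mulVec, Matrix.adjugate_mul, Matrix.smul_mulVec, Matrix.one_mulVec] at e
    have e2 := congrFun e j
    rw [Matrix.cramer_apply, h1, Pi.smul_apply, smul_eq_mul] at e2
    rw [cramerX, e2, mul_div_cancel_left₀ _ h2]
  have h4 : Q = reconstruct δ q₀ qm zn A B x t X := by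
    rw [h.potential_eq, hX]
    rfl
  refine ⟨h1, h2, h3, h4, ?_⟩
  rw [h4]
  congr 1
  exact funext h3

end SexticNLS

namespace SexticNLS

variable {q₀ : ℝ} {qm qp Q z : ℂ} {ι : Type*} {ξ : ι → ℂ} {s : ℂ → ℂ} {m p : ℂ → Fin 2 → ℂ}

/-! ### Regions and conjugation -/

theorem notMem_DPlus_of_mem_closedMinus (hq₀ : 0 < q₀) (h : z ∈ closedMinus q₀) :
    z ∉ DPlus q₀ := fun h' => by
  have h1 := ((mem_closedMinus_iff hq₀).1 h).1
  have h2 : 0 < (‖z‖ ^ 2 - q₀ ^ 2) * z.im := h'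
  linarith

theorem mem_regions (hq₀ : 0 < q₀) (h0 : z ≠ 0) (h1 : z ≠ I * q₀) (h2 : z ≠ -(I * q₀)) :
    z ∈ DPlus q₀ ∨ z ∈ closedMinus q₀ := by
  rcases lt_or_ge 0 ((‖z‖ ^ 2 - q₀ ^ 2) * z.im) with h | h
  exacts [Or.inl h, Or.inr ((mem_closedMinus_iff hq₀).2 ⟨h, h0, h1, h2⟩)]

theorem refl_mem_closedPlus_iff (hq₀ : 0 < q₀) :
    refl q₀ z ∈ closedPlus q₀ ↔ z ∈ closedMinus q₀ := by
  rw [← refl_mem_closedMinus_iff hq₀, refl_refl hq₀]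

theorem conj_mem_closedMinus_iff (hq₀ : 0 < q₀) :
    conj z ∈ closedMinus q₀ ↔ z ∈ closedPlus q₀ := by
  have e1 : conj z = I * q₀ ↔ z = -(I * q₀) := by
    rw [← (starRingEnd ℂ).injective.eq_iff]
    simp
  have e2 : conj z = -(I * q₀) ↔ z = I * q₀ := by
    rw [← (starRingEnd ℂ).injective.eq_iff]
    simp
  rw [mem_closedMinus_iff hq₀, mem_closedPlus_iff hq₀, Ne, Ne, Ne, e1, e2]
  simp only [norm_conj, conj_im, mul_neg, Left.neg_nonpos_iff, map_eq_zero]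
  tauto

theorem conj_mem_closedPlus_iff (hq₀ : 0 < q₀) :
    conj z ∈ closedPlus q₀ ↔ z ∈ closedMinus q₀ := by
  rw [← conj_mem_closedMinus_iff hq₀, conj_conj]

theorem antiRefl_eq (q₀ : ℝ) (z : ℂ) : antiRefl q₀ z = refl q₀ (conj z) := rfl

theorem antiRefl_refl (hq₀ : 0 < q₀) (z : ℂ) : antiRefl q₀ (refl q₀ z) = conj z := by
  rw [antiRefl_eq, ← refl_refl hq₀ (conj z)]
  simp [refl]

theorem conj_antiRefl (q₀ : ℝ) (z : ℂ) : conj (antiRefl q₀ z) = refl q₀ z := by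
  simp [antiRefl, refl]

theorem antiRefl_mem_closedPlus_iff (hq₀ : 0 < q₀) :
    antiRefl q₀ z ∈ closedPlus q₀ ↔ z ∈ closedPlus q₀ := by
  rw [antiRefl_eq, refl_mem_closedPlus_iff hq₀, conj_mem_closedMinus_iff hq₀]

theorem antiRefl_mem_closedMinus_iff (hq₀ : 0 < q₀) :
    antiRefl q₀ z ∈ closedMinus q₀ ↔ z ∈ closedMinus q₀ := by
  rw [antiRefl_eq, refl_mem_closedMinus_iff hq₀, conj_mem_closedPlus_iff hq₀]

theorem antiRefl_mem_DPlus_iff (hq₀ : 0 < q₀) : antiRefl q₀ z ∈ DPlus q₀ ↔ z ∈ DPlus q₀ := by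
  rw [antiRefl_eq, refl_mem_DPlus_iff hq₀]
  simp [DPlus, DMinus]

theorem antiRot_smul (a : ℂ) (v : Fin 2 → ℂ) : antiRot (a • v) = conj a • antiRot v := by
  funext i
  fin_cases i <;> simp [antiRot]

theorem wronskian_antiRot (u v : Fin 2 → ℂ) :
    wronskian (antiRot u) (antiRot v) = conj (wronskian u v) := by
  simp [wronskian, antiRot]
  ring

theorem wronskian_smul_smul (a b : ℂ) (u v : Fin 2 → ℂ) :
    wronskian (a • u) (b • v) = a * b * wronskian u v := by
  simp [wronskian]
  ring

/-- The branch points are limits of points of the contour. -/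
theorem neBot_contour (hq₀ : 0 < q₀) {w : ℂ} (hw : w = I * q₀ ∨ w = -(I * q₀)) :
    (𝓝[contour q₀] w).NeBot := by
  have hq' : (q₀ : ℂ) ≠ 0 := by exact_mod_cast hq₀.ne'
  have hw0 : w ≠ 0 := by rcases hw with rfl | rfl <;> simp [hq']
  have hwn : ‖w‖ = q₀ := by rcases hw with rfl | rfl <;> simp [abs_of_pos hq₀]
  have hws : w ^ 2 = -(q₀ : ℂ) ^ 2 := by
    rcases hw with rfl | rfl <;> simp [mul_pow]
  have ht : Tendsto (fun r : ℝ => w * exp (I * r)) (𝓝[>] 0) (𝓝 w) := by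
    have : ContinuousAt (fun r : ℝ => w * exp (I * r)) 0 := by fun_prop
    simpa using this.tendsto.mono_left (nhdsWithin_le_nhds (s := Set.Ioi 0))
  have hmem : ∀ᶠ r : ℝ in 𝓝[>] 0, w * exp (I * r) ∈ contour q₀ := by
    filter_upwards [Ioo_mem_nhdsGT Real.pi_pos] with r hr
    have hs := Real.sin_pos_of_pos_of_lt_pi hr.1 hr.2
    have him : (exp (I * r)).im = Real.sin r := by
      rw [mul_comm, exp_ofReal_mul_I_im]
    have n1 : w * exp (I * r) ≠ w := fun h => by
      have := congrArg im (mul_right_eq_self₀.1 h |>.resolve_right hw0)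
      rw [him, one_im] at this
      exact hs.ne' this
    have n2 : w * exp (I * r) ≠ -w := fun h => by
      have h' : exp (I * r) = -1 := mul_left_cancel₀ hw0 (by rw [h]; ring)
      have := congrArg im h'
      rw [him, neg_im, one_im, neg_zero] at this
      exact hs.ne' this
    refine ⟨Or.inr ?_, mul_ne_zero hw0 (exp_ne_zero _), ?_⟩
    · rw [norm_mul, norm_exp_I_mul_ofReal, mul_one, hwn]
    · rcases hw with rfl | rfl
      · exact ⟨n1, n2⟩
      · rw [neg_neg] at n2
        exact ⟨n2, n1⟩
  exact (tendsto_nhdsWithin_of_tendsto_nhds_of_eventually_within _ ht hmem).neBot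

/-! ### Reflectionless scattering data -/

/-- The analytic properties, at fixed `(x, t)`, of the first columns `m` of `μ₋` and `p` of `μ₊`
and of the scattering coefficient `s`, in the reflectionless case. -/
structure IsScattering (q₀ : ℝ) (qm qp Q : ℂ) (ξ : ι → ℂ) (s : ℂ → ℂ) (m p : ℂ → Fin 2 → ℂ) :
    Prop where
  pos : 0 < q₀
  norm_minus : ‖qm‖ = q₀
  norm_plus : ‖qp‖ = q₀
  injective : Function.Injective ξ
  mem : ∀ n, ξ n ∈ DPlus q₀
  minus_diff : ∀ z ∈ DMinus q₀, DifferentiableAt ℂ m z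
  minus_cont : ∀ z ∈ closedMinus q₀, ContinuousWithinAt m (closedMinus q₀) z
  minus_branch : ∀ w, w = I * q₀ ∨ w = -(I * q₀) →
    ∃ L, L ≠ 0 ∧ Tendsto m (𝓝[closedMinus q₀] w) (𝓝 L)
  minus_inf : Tendsto m (infMinus q₀) (𝓝 ![1, 0])
  minus_symm : ∀ z ∈ closedMinus q₀, m z = (qm / z) • antiRot (m (antiRefl q₀ z))
  potential : Tendsto (fun τ : ℝ => -(I * τ) * m (-(I * τ)) 1) atTop (𝓝 Q)
  plus_diff : ∀ z ∈ DPlus q₀, DifferentiableAt ℂ p z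
  plus_cont : ∀ z ∈ closedPlus q₀, ContinuousWithinAt p (closedPlus q₀) z
  plus_branch : ∀ w, w = I * q₀ ∨ w = -(I * q₀) →
    ∃ L, L ≠ 0 ∧ Tendsto p (𝓝[closedPlus q₀] w) (𝓝 L)
  plus_inf : Tendsto p (infPlus q₀) (𝓝 ![1, 0])
  plus_symm : ∀ z ∈ closedPlus q₀, p z = (qp / z) • antiRot (p (antiRefl q₀ z))
  coeff : ∀ z ∈ closedPlus q₀,
    s z * gam q₀ z = p z 0 * dual q₀ qm (m · 1) z - p z 1 * dual q₀ qm (m · 0) z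
  zeros : ∀ z ∈ closedPlus q₀, s z = 0 ↔ ∃ n, z = ξ n
  jump : ∀ z ∈ contour q₀, p z = s z • m z

namespace IsScattering

/-- The second column of `μ₋` on `D⁺ ∪ Σ`. -/
theorem dual_eq (h : IsScattering q₀ qm qp Q ξ s m p) (hz : z ∈ closedPlus q₀) (i : Fin 2) :
    dual q₀ qm (m · i) z = antiRot (m (conj z)) i := by
  have hq' : (q₀ : ℂ) ≠ 0 := by exact_mod_cast h.pos.ne'
  have hz0 : z ≠ 0 := ((mem_closedPlus_iff h.pos).1 hz).2.1
  rw [dual, h.minus_symm _ ((refl_mem_closedMinus_iff h.pos).2 hz), antiRefl_refl h.pos,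
    Pi.smul_apply, smul_eq_mul, refl]
  have := mul_conj_of_norm h.norm_minus
  field_simp
  linear_combination antiRot (m (conj z)) i * this

theorem coeff' (h : IsScattering q₀ qm qp Q ξ s m p) (hz : z ∈ closedPlus q₀) :
    s z * gam q₀ z = wronskian (p z) (antiRot (m (conj z))) := by
  rw [h.coeff z hz, h.dual_eq hz, h.dual_eq hz]
  rfl

theorem gam_ne_zero (h : IsScattering q₀ qm qp Q ξ s m p) (hz : z ∈ closedPlus q₀) :
    gam q₀ z ≠ 0 := by
  obtain ⟨_, h0, h1, h2⟩ := (mem_closedPlus_iff h.pos).1 hz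
  exact SexticNLS.gam_ne_zero h0 h1 h2

/-- The symmetry of the scattering coefficient. -/
theorem coeff_symm (h : IsScattering q₀ qm qp Q ξ s m p) (hz : z ∈ closedPlus q₀) :
    s z = qp / qm * conj (s (antiRefl q₀ z)) := by
  have hq' : (q₀ : ℂ) ≠ 0 := by exact_mod_cast h.pos.ne'
  have hz0 : z ≠ 0 := ((mem_closedPlus_iff h.pos).1 hz).2.1
  have hg := h.gam_ne_zero hz
  have hm0 : qm ≠ 0 := by
    rw [← norm_ne_zero_iff, h.norm_minus]
    exact h.pos.ne'
  have hz' := (antiRefl_mem_closedPlus_iff h.pos).2 hz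
  have e1 := h.coeff' hz
  have e2 := congrArg conj (h.coeff' hz')
  have e3 : conj (gam q₀ (antiRefl q₀ z)) = z ^ 2 / q₀ ^ 2 * gam q₀ z := by
    rw [← gam_refl h.pos hz0, ← conj_antiRefl]
    simp [gam]
  have e4 : antiRot (m (conj z)) = (conj qm / z) • antiRot (antiRot (m (refl q₀ z))) := by
    rw [h.minus_symm _ ((conj_mem_closedMinus_iff h.pos).2 hz), antiRot_smul, antiRefl_eq]
    simp
  have e5 := mul_conj_of_norm h.norm_minus
  rw [map_mul, e3, conj_antiRefl, ← wronskian_antiRot] at e2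
  rw [h.plus_symm z hz, e4, wronskian_smul_smul, ← e2] at e1
  field_simp at e1 ⊢
  refine mul_left_cancel₀ (pow_ne_zero 2 hq') ?_
  linear_combination qm * e1 + qp * conj (s (antiRefl q₀ z)) * e5

theorem conj_tendsto_infMinus (hq₀ : 0 < q₀) :
    Tendsto (fun z : ℂ => conj z) (infPlus q₀) (infMinus q₀) := by
  refine tendsto_inf.2 ⟨?_, tendsto_principal.2 ?_⟩
  · have : Tendsto (fun z : ℂ => conj z) (cocompact ℂ) (cocompact ℂ) :=
      conjCLE.toHomeomorph.isClosedEmbedding.tendsto_cocompact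
    exact this.mono_left inf_le_left
  · exact mem_inf_of_right fun z hz => (conj_mem_closedMinus_iff hq₀).2 hz

theorem tendsto_gam : Tendsto (gam q₀) (cocompact ℂ) (𝓝 1) := by
  have ti : Tendsto (fun z : ℂ => z⁻¹) (cocompact ℂ) (𝓝 0) := by
    have := (tendsto_inv₀_cobounded' (α := ℂ)).mono_right nhdsWithin_le_nhds
    rwa [Metric.cobounded_eq_cocompact] at this
  have := ((ti.pow 2).const_mul ((q₀ : ℂ) ^ 2)).const_add 1
  norm_num at this
  refine this.congr fun z => ?_
  simp [gam, div_eq_mul_inv]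

theorem coeff_tendsto_inf (h : IsScattering q₀ qm qp Q ξ s m p) :
    Tendsto s (infPlus q₀) (𝓝 1) := by
  have t1 := (continuous_antiRot.tendsto _).comp
    (h.minus_inf.comp (conj_tendsto_infMinus h.pos))
  have t2 := (((tendsto_pi_nhds.1 h.plus_inf 0).mul (tendsto_pi_nhds.1 t1 1)).sub
    ((tendsto_pi_nhds.1 h.plus_inf 1).mul (tendsto_pi_nhds.1 t1 0))).div
      ((tendsto_gam (q₀ := q₀)).mono_left (inf_le_left (b := 𝓟 (closedPlus q₀)))) one_ne_zero
  simp [antiRot] at t2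
  refine t2.congr' ?_
  filter_upwards [mem_inf_of_right (mem_principal_self _)] with z hz
  have := h.coeff' hz
  simp only [Pi.div_apply]
  rw [div_eq_iff (h.gam_ne_zero hz), this]
  simp [wronskian, antiRot]

end IsScattering

end SexticNLS

namespace SexticNLS

variable {q₀ : ℝ} {qm qp Q z : ℂ} {ι : Type*} {ξ a D : ι → ℂ} {s : ℂ → ℂ} {m p : ℂ → Fin 2 → ℂ}

namespace IsScattering

/-! ### The column without jump -/

open Classical in
/-- The function equal to `m` on `D⁻ ∪ Σ` and to `p / s` on `D⁺`. -/
noncomputable def glued (q₀ : ℝ) (s : ℂ → ℂ) (m p : ℂ → Fin 2 → ℂ) (z : ℂ) : Fin 2 → ℂ :=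
  if z ∈ DPlus q₀ then (s z)⁻¹ • p z else m z

theorem glued_of_mem_DPlus (hz : z ∈ DPlus q₀) : glued q₀ s m p z = (s z)⁻¹ • p z := if_pos hz

theorem glued_of_mem_closedMinus (hq₀ : 0 < q₀) (hz : z ∈ closedMinus q₀) :
    glued q₀ s m p z = m z := if_neg (notMem_DPlus_of_mem_closedMinus hq₀ hz)

theorem glued_of_mem_closedPlus (h : IsScattering q₀ qm qp Q ξ s m p) (hz : z ∈ closedPlus q₀)
    (hs : s z ≠ 0) : glued q₀ s m p z = (s z)⁻¹ • p z := by
  by_cases hz' : z ∈ DPlus q₀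
  · exact glued_of_mem_DPlus hz'
  · have hc : z ∈ contour q₀ := hz.resolve_left hz'
    rw [glued_of_mem_closedMinus h.pos (Or.inr hc), h.jump z hc, smul_smul, inv_mul_cancel₀ hs,
      one_smul]

theorem refl_mem_DMinus (h : IsScattering q₀ qm qp Q ξ s m p) (hz : z ∈ DPlus q₀) :
    refl q₀ z ∈ DMinus q₀ := (refl_mem_DMinus_iff h.pos).2 hz

theorem differentiableAt_dual (h : IsScattering q₀ qm qp Q ξ s m p) (hz : z ∈ DPlus q₀)
    (i : Fin 2) : DifferentiableAt ℂ (dual q₀ qm (m · i)) z :=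
  SexticNLS.differentiableAt_dual (fun h0 => zero_notMem_DPlus (h0 ▸ hz))
    (differentiableAt_pi.1 (h.minus_diff _ (h.refl_mem_DMinus hz)) i)

theorem differentiableAt_gam (hz : z ≠ 0) : DifferentiableAt ℂ (gam q₀) z := by
  have : z ^ 2 ≠ 0 := pow_ne_zero _ hz
  unfold gam
  fun_prop (disch := assumption)

theorem coeff_differentiableAt (h : IsScattering q₀ qm qp Q ξ s m p) (hz : z ∈ DPlus q₀) :
    DifferentiableAt ℂ s z := by
  have hz0 : z ≠ 0 := fun h0 => zero_notMem_DPlus (h0 ▸ hz)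
  have hp := differentiableAt_pi.1 (h.plus_diff z hz)
  have := (((hp 0).mul (h.differentiableAt_dual hz 1)).sub
    ((hp 1).mul (h.differentiableAt_dual hz 0))).div (differentiableAt_gam (q₀ := q₀) hz0)
      (h.gam_ne_zero (Or.inl hz))
  refine this.congr_of_eventuallyEq ?_
  filter_upwards [(isOpen_DPlus q₀).mem_nhds hz] with w hw
  have := h.coeff w (Or.inl hw)
  simp only [Pi.div_apply]
  rw [eq_div_iff (h.gam_ne_zero (Or.inl hw)), this]
  rfl

theorem coeff_continuousWithinAt (h : IsScattering q₀ qm qp Q ξ s m p) (hz : z ∈ closedPlus q₀) :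
    ContinuousWithinAt s (closedPlus q₀) z := by
  have hz0 : z ≠ 0 := ((mem_closedPlus_iff h.pos).1 hz).2.1
  have hm : ContinuousWithinAt (fun z => antiRot (m (conj z))) (closedPlus q₀) z := by
    have h1 : ContinuousWithinAt (fun z : ℂ => conj z) (closedPlus q₀) z :=
      continuous_conj.continuousWithinAt
    have h2 := (h.minus_cont _ ((conj_mem_closedMinus_iff h.pos).2 hz)).comp h1
      fun w hw => (conj_mem_closedMinus_iff h.pos).2 hw
    exact continuous_antiRot.continuousAt.comp_continuousWithinAt h2
  have hp := h.plus_cont z hz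
  rw [continuousWithinAt_pi] at hm hp
  have := (((hp 0).mul (hm 1)).sub ((hp 1).mul (hm 0))).div
    (differentiableAt_gam (q₀ := q₀) hz0).continuousAt.continuousWithinAt (h.gam_ne_zero hz)
  refine this.congr (fun w hw => ?_) ?_
  · rw [Pi.div_apply, eq_div_iff (h.gam_ne_zero hw), h.coeff' hw]
    rfl
  · rw [Pi.div_apply, eq_div_iff (h.gam_ne_zero hz), h.coeff' hz]
    rfl

theorem ne_of_contour (h : IsScattering q₀ qm qp Q ξ s m p) (hz : z ∈ contour q₀) (n : ι) :
    z ≠ ξ n := fun e =>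
  notMem_DPlus_of_mem_closedMinus h.pos (Or.inr hz : z ∈ closedMinus q₀) (e ▸ h.mem n)

theorem coeff_ne_zero (h : IsScattering q₀ qm qp Q ξ s m p) (hz : z ∈ closedPlus q₀)
    (hn : ∀ n, z ≠ ξ n) : s z ≠ 0 := fun h0 => by
  obtain ⟨n, e⟩ := (h.zeros z hz).1 h0
  exact hn n e

theorem continuousAt_glued (h : IsScattering q₀ qm qp Q ξ s m p) [Finite ι] (hz : z ∈ contour q₀) :
    ContinuousAt (glued q₀ s m p) z := by
  obtain ⟨_, h0, h1, h2⟩ := (mem_closedPlus_iff h.pos).1 (Or.inr hz)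
  have hs := h.coeff_ne_zero (Or.inr hz) (h.ne_of_contour hz)
  have hn : ∀ᶠ w in 𝓝 z, ∀ n, w ≠ ξ n :=
    eventually_all.2 fun n => eventually_ne_nhds (h.ne_of_contour hz n)
  have c1 : ContinuousWithinAt (glued q₀ s m p) (closedMinus q₀) z :=
    (h.minus_cont z (Or.inr hz)).congr (fun w hw => glued_of_mem_closedMinus h.pos hw)
      (glued_of_mem_closedMinus h.pos (Or.inr hz))
  have c2 : ContinuousWithinAt (glued q₀ s m p) (closedPlus q₀) z := by
    have := ((h.coeff_continuousWithinAt (Or.inr hz)).inv₀ hs).smul (h.plus_cont z (Or.inr hz))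
    refine this.congr_of_eventuallyEq ?_ (h.glued_of_mem_closedPlus (Or.inr hz) hs)
    filter_upwards [self_mem_nhdsWithin, nhdsWithin_le_nhds hn] with w hw hwn
    exact h.glued_of_mem_closedPlus hw (h.coeff_ne_zero hw hwn)
  refine (c1.union c2).continuousAt ?_
  filter_upwards [eventually_ne_nhds h0, eventually_ne_nhds h1, eventually_ne_nhds h2]
    with w w0 w1 w2
  rcases mem_regions h.pos w0 w1 w2 with hw | hw
  exacts [Or.inr (Or.inl hw), Or.inl hw]

theorem differentiableAt_glued_minus (h : IsScattering q₀ qm qp Q ξ s m p) (hz : z ∈ DMinus q₀) :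
    DifferentiableAt ℂ (glued q₀ s m p) z :=
  (h.minus_diff z hz).congr_of_eventuallyEq <| by
    filter_upwards [(isOpen_DMinus q₀).mem_nhds hz] with w hw
    exact glued_of_mem_closedMinus h.pos (Or.inl hw)

theorem differentiableAt_glued_plus (h : IsScattering q₀ qm qp Q ξ s m p) (hz : z ∈ DPlus q₀)
    (hn : ∀ n, z ≠ ξ n) : DifferentiableAt ℂ (glued q₀ s m p) z := by
  refine (((h.coeff_differentiableAt hz).inv (h.coeff_ne_zero (Or.inl hz) hn)).smul
    (h.plus_diff z hz)).congr_of_eventuallyEq ?_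
  filter_upwards [(isOpen_DPlus q₀).mem_nhds hz] with w hw
  exact glued_of_mem_DPlus hw

theorem differentiableAt_glued (h : IsScattering q₀ qm qp Q ξ s m p) [Finite ι] (h0 : z ≠ 0)
    (h1 : z ≠ I * q₀) (h2 : z ≠ -(I * q₀)) (hn : ∀ n, z ≠ ξ n) (i : Fin 2) :
    DifferentiableAt ℂ (fun z => glued q₀ s m p z i) z := by
  set S : Set ℂ := {0, I * q₀, -(I * q₀)} ∪ Set.range ξ with hS
  have hmem : ∀ w, w ∈ Sᶜ ↔ w ≠ 0 ∧ w ≠ I * q₀ ∧ w ≠ -(I * q₀) ∧ ∀ n, w ≠ ξ n := by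
    intro w
    simp only [hS, Set.mem_compl_iff, Set.mem_union, Set.mem_insert_iff, Set.mem_singleton_iff,
      Set.mem_range, not_or, not_exists, eq_comm (b := w)]
    tauto
  have hO : IsOpen Sᶜ := ((Set.toFinite _).union (Set.finite_range ξ)).isClosed.isOpen_compl
  refine differentiableAt_of_off_real_circle h.pos hO ?_ ?_ z ((hmem z).2 ⟨h0, h1, h2, hn⟩)
  · intro w hw
    obtain ⟨w0, w1, w2, w3⟩ := (hmem w).1 hw
    have : ContinuousAt (glued q₀ s m p) w := by
      rcases mem_regions h.pos w0 w1 w2 with hw | hw | hw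
      exacts [(h.differentiableAt_glued_plus hw w3).continuousAt,
        (h.differentiableAt_glued_minus hw).continuousAt, h.continuousAt_glued hw]
    exact (continuousAt_pi.1 this i).continuousWithinAt
  · intro w hw him hnorm
    obtain ⟨w0, w1, w2, w3⟩ := (hmem w).1 hw
    have : DifferentiableAt ℂ (glued q₀ s m p) w := by
      rcases mem_regions h.pos w0 w1 w2 with hw | hw | hw
      exacts [h.differentiableAt_glued_plus hw w3, h.differentiableAt_glued_minus hw,
        absurd hw.1 (not_or.2 ⟨him, hnorm⟩)]
    exact differentiableAt_pi.1 this i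

theorem wronskian_glued_plus (h : IsScattering q₀ qm qp Q ξ s m p) (hz : z ∈ closedPlus q₀)
    (hn : ∀ n, z ≠ ξ n) :
    glued q₀ s m p z 0 * dual q₀ qm (glued q₀ s m p · 1) z -
      glued q₀ s m p z 1 * dual q₀ qm (glued q₀ s m p · 0) z = gam q₀ z := by
  have hs := h.coeff_ne_zero hz hn
  have e : ∀ i, dual q₀ qm (glued q₀ s m p · i) z = dual q₀ qm (m · i) z := fun i => by
    simp only [dual]
    rw [glued_of_mem_closedMinus h.pos ((refl_mem_closedMinus_iff h.pos).2 hz)]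
  rw [e, e, h.glued_of_mem_closedPlus hz hs]
  have := h.coeff z hz
  simp only [Pi.smul_apply, smul_eq_mul]
  field_simp
  linear_combination -this

theorem wronskian_glued (h : IsScattering q₀ qm qp Q ξ s m p) (h0 : z ≠ 0)
    (h1 : z ≠ I * q₀) (h2 : z ≠ -(I * q₀)) (hn : ∀ n, z ≠ ξ n) (hn' : ∀ n, refl q₀ z ≠ ξ n) :
    glued q₀ s m p z 0 * dual q₀ qm (glued q₀ s m p · 1) z -
      glued q₀ s m p z 1 * dual q₀ qm (glued q₀ s m p · 0) z = gam q₀ z := by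
  rcases mem_regions h.pos h0 h1 h2 with hz | hz
  · exact h.wronskian_glued_plus (Or.inl hz) hn
  · have hq' : (q₀ : ℂ) ≠ 0 := by exact_mod_cast h.pos.ne'
    have hc := conj_ne_zero_of_norm h.pos h.norm_minus
    have w := h.wronskian_glued_plus ((refl_mem_closedPlus_iff h.pos).2 hz) hn'
    rw [dual_refl h.pos _ h0, dual_refl h.pos _ h0, gam_refl h.pos h0] at w
    simp only [dual]
    field_simp at w ⊢
    linear_combination w

/-- The symmetry of the glued function. -/
theorem glued_symm (h : IsScattering q₀ qm qp Q ξ s m p) (h0 : z ≠ 0)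
    (h1 : z ≠ I * q₀) (h2 : z ≠ -(I * q₀)) :
    glued q₀ s m p z = (qm / z) • antiRot (glued q₀ s m p (antiRefl q₀ z)) := by
  rcases mem_regions h.pos h0 h1 h2 with hz | hz
  · have hp0 : qp ≠ 0 := by
      rw [← norm_ne_zero_iff, h.norm_plus]
      exact h.pos.ne'
    rw [glued_of_mem_DPlus hz, glued_of_mem_DPlus ((antiRefl_mem_DPlus_iff h.pos).2 hz),
      antiRot_smul, smul_smul, h.plus_symm z (Or.inl hz), smul_smul, h.coeff_symm (Or.inl hz)]
    congr 1
    rw [map_inv₀]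
    field_simp
  · rw [glued_of_mem_closedMinus h.pos hz,
      glued_of_mem_closedMinus h.pos ((antiRefl_mem_closedMinus_iff h.pos).2 hz)]
    exact h.minus_symm z hz

theorem eventually_cocompact_ne [Finite ι] (S : ι → ℂ) : ∀ᶠ z in cocompact ℂ, ∀ n, z ≠ S n :=
  eventually_all.2 fun n => (Set.finite_singleton (S n)).isCompact.compl_mem_cocompact

theorem tendsto_glued_inf (h : IsScattering q₀ qm qp Q ξ s m p) [Finite ι] :
    Tendsto (glued q₀ s m p) (cocompact ℂ) (𝓝 ![1, 0]) := by
  have t1 : Tendsto (glued q₀ s m p) (infMinus q₀) (𝓝 ![1, 0]) := by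
    refine h.minus_inf.congr' ?_
    filter_upwards [mem_inf_of_right (mem_principal_self _)] with z hz
    exact (glued_of_mem_closedMinus h.pos hz).symm
  have t2 : Tendsto (glued q₀ s m p) (infPlus q₀) (𝓝 ![1, 0]) := by
    have := (h.coeff_tendsto_inf.inv₀ one_ne_zero).smul h.plus_inf
    rw [inv_one, one_smul] at this
    refine this.congr' ?_
    filter_upwards [mem_inf_of_right (mem_principal_self _),
      mem_inf_of_left (eventually_cocompact_ne ξ)] with z hz hn
    exact (h.glued_of_mem_closedPlus hz (h.coeff_ne_zero hz hn)).symm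
  have t3 := t1.sup t2
  rw [infMinus, infPlus, ← inf_sup_left, sup_principal] at t3
  refine t3.mono_left (le_inf le_rfl (le_principal_iff.2 ?_))
  filter_upwards [eventually_cocompact_ne ![0, I * (q₀ : ℂ), -(I * (q₀ : ℂ))]] with z hz
  rcases mem_regions h.pos (hz 0) (hz 1) (hz 2) with hw | hw
  exacts [Or.inr (Or.inl hw), Or.inl hw]

theorem tendsto_glued_zero (h : IsScattering q₀ qm qp Q ξ s m p) [Finite ι] :
    Tendsto (fun z => z • glued q₀ s m p z) (𝓝[≠] 0) (𝓝 ![0, qm]) := by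
  have hq' : (q₀ : ℂ) ≠ 0 := by exact_mod_cast h.pos.ne'
  have c1 : Tendsto (fun z : ℂ => conj z) (cocompact ℂ) (cocompact ℂ) :=
    conjCLE.toHomeomorph.isClosedEmbedding.tendsto_cocompact
  have t1 : Tendsto (antiRefl q₀) (𝓝[≠] 0) (cocompact ℂ) := by
    refine (c1.comp (tendsto_refl_zero h.pos)).congr fun z => ?_
    simp [refl, antiRefl]
  have t2 := ((continuous_antiRot.tendsto _).comp (h.tendsto_glued_inf.comp t1)).const_smul qm
  have e : qm • antiRot ![1, 0] = ![0, qm] := by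
    funext i
    fin_cases i <;> simp [antiRot]
  rw [e] at t2
  refine t2.congr' ?_
  have f1 : ∀ᶠ z : ℂ in 𝓝 0, z ≠ I * q₀ := eventually_ne_nhds (by simp [hq'])
  have f2 : ∀ᶠ z : ℂ in 𝓝 0, z ≠ -(I * q₀) := eventually_ne_nhds (by simp [hq'])
  filter_upwards [self_mem_nhdsWithin, nhdsWithin_le_nhds f1, nhdsWithin_le_nhds f2]
    with z h0 h1 h2
  rw [h.glued_symm h0 h1 h2, smul_smul, mul_div_cancel₀ _ h0]
  rfl

end IsScattering

end SexticNLS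

namespace SexticNLS

variable {q₀ : ℝ} {qm qp Q z : ℂ} {ι : Type*} {ξ a D : ι → ℂ} {s : ℂ → ℂ} {m p : ℂ → Fin 2 → ℂ}

namespace IsScattering

/-! ### The branch points -/

theorem exists_index {L : Fin 2 → ℂ} (hL : L ≠ 0) : ∃ i, L i ≠ 0 := by
  by_contra! hc
  exact hL (funext hc)

theorem parallel_limits (h : IsScattering q₀ qm qp Q ξ s m p) {w : ℂ}
    (hw : w = I * q₀ ∨ w = -(I * q₀)) {L L' : Fin 2 → ℂ}
    (hL : Tendsto m (𝓝[closedMinus q₀] w) (𝓝 L)) (hL' : Tendsto p (𝓝[closedPlus q₀] w) (𝓝 L')) :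
    L 0 * L' 1 = L 1 * L' 0 := by
  have := neBot_contour h.pos hw
  have t1 : Tendsto m (𝓝[contour q₀] w) (𝓝 L) :=
    hL.mono_left (nhdsWithin_mono _ Set.subset_union_right)
  have t2 : Tendsto p (𝓝[contour q₀] w) (𝓝 L') :=
    hL'.mono_left (nhdsWithin_mono _ Set.subset_union_right)
  rw [tendsto_pi_nhds] at t1 t2
  refine tendsto_nhds_unique ((t1 0).mul (t2 1)) (((t1 1).mul (t2 0)).congr' ?_)
  filter_upwards [self_mem_nhdsWithin] with z hz
  rw [h.jump z hz]
  simp only [Pi.smul_apply, smul_eq_mul]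
  ring

theorem tendsto_branch (h : IsScattering q₀ qm qp Q ξ s m p) [Finite ι] {w : ℂ}
    (hw : w = I * q₀ ∨ w = -(I * q₀)) :
    ∃ L, Tendsto (glued q₀ s m p) (𝓝[≠] w) (𝓝 L) := by
  have hq' : (q₀ : ℂ) ≠ 0 := by exact_mod_cast h.pos.ne'
  have hw0 : w ≠ 0 := by rcases hw with rfl | rfl <;> simp [hq']
  have hwr : refl q₀ w = w := by
    rcases hw with rfl | rfl
    exacts [refl_branch q₀, refl_neg_branch q₀]
  have hc := conj_ne_zero_of_norm h.pos h.norm_minus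
  obtain ⟨L, hL0, hL⟩ := h.minus_branch w hw
  obtain ⟨L', hL0', hL'⟩ := h.plus_branch w hw
  have hpar := h.parallel_limits hw hL hL'
  obtain ⟨i, hi⟩ := exists_index hL0
  obtain ⟨j, hj⟩ : ∃ j : Fin 2, (i = 0 ∧ j = 1) ∨ (i = 1 ∧ j = 0) := by
    fin_cases i
    exacts [⟨1, Or.inl ⟨rfl, rfl⟩⟩, ⟨0, Or.inr ⟨rfl, rfl⟩⟩]
  have hpar' : L i * L' j = L j * L' i := by
    rcases hj with ⟨rfl, rfl⟩ | ⟨rfl, rfl⟩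
    exacts [hpar, hpar.symm]
  have hi' : L' i ≠ 0 := fun h0 => hL0' <| by
    rw [h0, mul_zero] at hpar'
    have hj0 : L' j = 0 := (mul_eq_zero.1 hpar').resolve_left hi
    funext k
    rcases hj with ⟨rfl, rfl⟩ | ⟨rfl, rfl⟩ <;> fin_cases k <;> assumption
  set F := glued q₀ s m p with hF
  have hregion : ∀ᶠ z in 𝓝[≠] w, z ≠ 0 ∧ z ≠ I * q₀ ∧ z ≠ -(I * q₀) ∧ ∀ n, z ≠ ξ n := by
    have f1 : ∀ᶠ z in 𝓝 w, z ≠ -w := eventually_ne_nhds fun e => by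
      have : 2 * w = 0 := by linear_combination e
      simp [hw0] at this
    have f2 : ∀ᶠ z in 𝓝 w, ∀ n, z ≠ ξ n := eventually_all.2 fun n => eventually_ne_nhds fun e => by
      have := ((mem_closedPlus_iff h.pos).1 (Or.inl (h.mem n))).2.2
      rw [← e] at this
      rcases hw with rfl | rfl
      exacts [this.1 rfl, this.2 rfl]
    filter_upwards [self_mem_nhdsWithin, nhdsWithin_le_nhds (eventually_ne_nhds hw0),
      nhdsWithin_le_nhds f1, nhdsWithin_le_nhds f2] with z hz z0 z1 z2
    refine ⟨z0, ?_, ?_, z2⟩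
    · rcases hw with rfl | rfl
      exacts [hz, by simpa using z1]
    · rcases hw with rfl | rfl
      exacts [z1, hz]
  have hsplit : 𝓝[≠] w ≤ 𝓝[closedMinus q₀] w ⊔ (𝓝[closedPlus q₀] w ⊓ 𝓟 {z | ∀ n, z ≠ ξ n}) := by
    rw [nhdsWithin, nhdsWithin, nhdsWithin, inf_assoc, ← inf_sup_left, inf_principal, sup_principal]
    refine le_inf (nhdsWithin_le_nhds) (le_principal_iff.2 ?_)
    filter_upwards [hregion] with z hz
    rcases mem_regions h.pos hz.1 hz.2.1 hz.2.2.1 with h' | h'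
    exacts [Or.inr ⟨Or.inl h', hz.2.2.2⟩, Or.inl h']
  rw [tendsto_pi_nhds] at hL hL'
  have hplus : ∀ᶠ z in 𝓝[closedPlus q₀] w ⊓ 𝓟 {z | ∀ n, z ≠ ξ n},
      F z = (s z)⁻¹ • p z ∧ s z ≠ 0 := by
    rw [eventually_inf_principal]
    filter_upwards [self_mem_nhdsWithin] with z hz hn
    have hs := h.coeff_ne_zero hz hn
    exact ⟨h.glued_of_mem_closedPlus hz hs, hs⟩
  have hFi : ∀ᶠ z in 𝓝[≠] w, F z i ≠ 0 := by
    refine hsplit (eventually_sup.2 ⟨?_, ?_⟩)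
    · filter_upwards [self_mem_nhdsWithin, (hL i).eventually_ne hi] with z hz hz'
      rwa [hF, glued_of_mem_closedMinus h.pos hz]
    · filter_upwards [hplus, mem_inf_of_left ((hL' i).eventually_ne hi')] with z hz hz'
      rw [hz.1]
      exact mul_ne_zero (inv_ne_zero hz.2) hz'
  have hratio : Tendsto (fun z => F z j / F z i) (𝓝[≠] w) (𝓝 (L j / L i)) := by
    refine Tendsto.mono_left (Tendsto.sup ?_ ?_) hsplit
    · refine ((hL j).div (hL i) hi).congr' ?_
      filter_upwards [self_mem_nhdsWithin] with z hz
      rw [hF, glued_of_mem_closedMinus h.pos hz, Pi.div_apply]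
    · have e : L j / L i = L' j / L' i := by
        rw [div_eq_div_iff hi hi']
        linear_combination -hpar'
      rw [e]
      refine (((hL' j).div (hL' i) hi').mono_left inf_le_left).congr' ?_
      filter_upwards [hplus] with z hz
      rw [hz.1, Pi.div_apply, Pi.smul_apply, Pi.smul_apply, smul_eq_mul, smul_eq_mul,
        mul_div_mul_left _ _ (inv_ne_zero hz.2)]
  have hFd : ∀ k, ∀ᶠ z in 𝓝[≠] w, DifferentiableAt ℂ (fun z => F z k) z := fun k => by
    filter_upwards [hregion] with z hz
    exact h.differentiableAt_glued hz.1 hz.2.1 hz.2.2.1 hz.2.2.2 k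
  set R := Function.update (fun z => F z j / F z i) w (L j / L i) with hR
  have hRne : ∀ z, z ≠ w → R z = F z j / F z i := fun z hz => Function.update_of_ne hz _ _
  have hRa : AnalyticAt ℂ R w := by
    refine analyticAt_of_differentiable_on_punctured_nhds_of_continuousAt ?_ ?_
    · filter_upwards [hFd i, hFd j, hFi, self_mem_nhdsWithin] with z d1 d2 hz hzw
      refine (d2.div d1 hz).congr_of_eventuallyEq ?_
      filter_upwards [eventually_ne_nhds hzw] with y hy
      exact hRne y hy
    · exact continuousAt_update_same.2 hratio
  have htau := tendsto_refl_punctured h.pos hw0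
  rw [hwr] at htau
  have hNe : (𝓝[closedMinus q₀] w).NeBot :=
    (neBot_contour h.pos hw).mono (nhdsWithin_mono _ Set.subset_union_right)
  have han : ∀ {f : ℂ → ℂ}, (∀ z, z ≠ 0 → DifferentiableAt ℂ f z) → AnalyticAt ℂ f w := by
    intro f hf
    refine DifferentiableOn.analyticAt (s := {0}ᶜ) (fun z hz => (hf z hz).differentiableWithinAt) ?_
    exact isOpen_compl_singleton.mem_nhds hw0
  obtain ⟨e, he0, he⟩ : ∃ e : ℂ, e ≠ 0 ∧ ∀ u v : Fin 2 → ℂ,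
      u i * v j - u j * v i = e * (u 0 * v 1 - u 1 * v 0) := by
    rcases hj with ⟨rfl, rfl⟩ | ⟨rfl, rfl⟩
    · exact ⟨1, one_ne_zero, fun u v => by ring⟩
    · exact ⟨-1, neg_ne_zero.2 one_ne_zero, fun u v => by ring⟩
  have key := exists_tendsto_of_involution (p := w) (v₀ := L i) (τ := refl q₀) (F := fun z => F z i)
    (R := R) (V := fun z => e * -(z / conj qm * gam q₀ z)) (A := closedMinus q₀) hNe
    (fun hm => by
      have := ((mem_closedMinus_iff h.pos).1 hm).2.2
      rcases hw with rfl | rfl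
      exacts [this.1 rfl, this.2 rfl])
    (han fun z hz => (hasDerivAt_refl hz).differentiableAt) hwr
    (htau.eventually self_mem_nhdsWithin)
    (by
      filter_upwards [hregion] with z hz
      rcases mem_regions h.pos hz.1 hz.2.1 hz.2.2.1 with h' | h'
      exacts [Or.inr (Or.inl (h.refl_mem_DMinus h')), Or.inl h'])
    (hFd i)
    ((hL i).congr' (by
      filter_upwards [self_mem_nhdsWithin] with z hz
      rw [hF, glued_of_mem_closedMinus h.pos hz]))
    hi hRa
    (han fun z hz => by
      have := differentiableAt_gam (q₀ := q₀) hz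
      fun_prop)
    (by
      filter_upwards [hregion] with z hz
      exact mul_ne_zero he0 (neg_ne_zero.2 (mul_ne_zero (div_ne_zero hz.1 hc)
        (SexticNLS.gam_ne_zero hz.1 hz.2.1 hz.2.2.1))))
    (by
      filter_upwards [hregion, htau.eventually hregion, hFi, htau.eventually hFi,
        self_mem_nhdsWithin, htau.eventually self_mem_nhdsWithin] with z hz hz' hi hi' hzw hzw'
      rw [hRne z hzw, hRne _ hzw']
      have w1 := h.wronskian_glued hz.1 hz.2.1 hz.2.2.1 hz.2.2.2 hz'.2.2.2
      have w2 := he (F z) (F (refl q₀ z))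
      simp only [dual, ← hF] at w1
      have z0 := hz.1
      field_simp at w1 ⊢
      linear_combination conj qm * w2 - e * w1)
  obtain ⟨l, hl⟩ := key
  refine ⟨fun k => if k = i then l else (L j / L i) * l, tendsto_pi_nhds.2 fun k => ?_⟩
  by_cases hk : k = i
  · rw [hk, if_pos rfl]
    exact hl
  · rw [if_neg hk]
    have hkj : k = j := by
      rcases hj with ⟨rfl, rfl⟩ | ⟨rfl, rfl⟩ <;> fin_cases k <;> first | rfl | exact absurd rfl hk
    rw [hkj]
    refine (hratio.mul hl).congr' ?_
    filter_upwards [hFi] with z hz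
    exact div_mul_cancel₀ _ hz

/-- Reflectionless scattering data with principal parts at the poles solve the Riemann–Hilbert
problem. -/
theorem isReflectionless (h : IsScattering q₀ qm qp Q ξ s m p) [Finite ι]
    (hpole : ∀ n i, Tendsto (fun z => (z - ξ n) * (p z i / s z -
      a n * (1 / (z - ξ n) ^ 2 + D n / (z - ξ n)) * dual q₀ qm (m · i) z)) (𝓝[≠] (ξ n)) (𝓝 0)) :
    IsReflectionless q₀ qm Q ξ a D (glued q₀ s m p) where
  pos := h.pos
  norm_eq := h.norm_minus
  injective := h.injective
  mem := h.mem
  differentiableAt := fun z h0 h1 h2 hn i => h.differentiableAt_glued h0 h1 h2 hn i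
  wronskian_eq := fun z h0 h1 h2 hn hn' => h.wronskian_glued h0 h1 h2 hn hn'
  tendsto_inf := h.tendsto_glued_inf
  tendsto_zero := h.tendsto_glued_zero
  tendsto_branch := fun w hw => h.tendsto_branch hw
  tendsto_pole := fun n i => by
    refine (hpole n i).congr' ?_
    filter_upwards [nhdsWithin_le_nhds ((isOpen_DPlus q₀).mem_nhds (h.mem n))] with z hz
    have e : dual q₀ qm (glued q₀ s m p · i) z = dual q₀ qm (m · i) z := by
      simp only [dual]
      rw [glued_of_mem_closedMinus h.pos (Or.inl (h.refl_mem_DMinus hz))]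
    rw [e, glued_of_mem_DPlus hz, Pi.smul_apply, smul_eq_mul, inv_mul_eq_div]
  tendsto_potential := by
    refine h.potential.congr' ?_
    filter_upwards [eventually_gt_atTop q₀] with τ hτ
    rw [glued_of_mem_closedMinus h.pos]
    rw [← neg_mem_closedPlus_iff, neg_neg]
    exact I_mul_mem_closedPlus h.pos hτ

end IsScattering

end SexticNLS

namespace SexticNLS

variable {δ q₀ : ℝ} {q : ℝ → ℝ → ℂ} {qm qp c z : ℂ} {U : Set ℂ} {l : Filter ℝ} {ι : Type*} {ξ : ι → ℂ}
  {ψ ψm ψp : ℝ → ℝ → ℂ → Matrix (Fin 2) (Fin 2) ℂ}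

/-! ### From the Lax pair to the normalized Jost solutions -/

theorem theta_eq (δ q₀ x t : ℝ) (z : ℂ) : theta δ q₀ x t z = lam q₀ z * x + theta δ q₀ 0 t z := by
  simp only [theta, ofReal_zero]
  ring

theorem hasDerivAt_theta (δ q₀ x t : ℝ) (z : ℂ) :
    HasDerivAt (fun y => theta δ q₀ y t z) (lam q₀ z) x := by
  have h : HasDerivAt (fun y : ℝ => lam q₀ z * (y : ℂ) + theta δ q₀ 0 t z) (lam q₀ z * 1) x :=
    ((hasDerivAt_id x).ofReal_comp.const_mul (lam q₀ z)).add_const _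
  rw [mul_one] at h
  exact h.congr_of_eventuallyEq (Eventually.of_forall fun y => theta_eq δ q₀ y t z)

theorem hasDerivAt_exp_theta (δ q₀ x t : ℝ) (a z : ℂ) :
    HasDerivAt (fun y => exp (a * theta δ q₀ y t z))
      (a * lam q₀ z * exp (a * theta δ q₀ x t z)) x := by
  refine ((hasDerivAt_theta δ q₀ x t z).const_mul a).cexp.congr_deriv ?_
  ring

theorem theta_refl (hq₀ : 0 < q₀) (x t : ℝ) (z : ℂ) :
    theta δ q₀ x t (refl q₀ z) = -theta δ q₀ x t z := by
  simp only [theta, lam_refl hq₀, kfun_refl hq₀]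
  ring

theorem mu_zero (x t : ℝ) (i : Fin 2) :
    mu δ q₀ ψ x t z i 0 = ψ x t z i 0 * exp (-I * theta δ q₀ x t z) := by
  simp [mu, Matrix.mul_diagonal]

theorem mu_one (x t : ℝ) (i : Fin 2) :
    mu δ q₀ ψ x t z i 1 = ψ x t z i 1 * exp (I * theta δ q₀ x t z) := by
  simp [mu, Matrix.mul_diagonal]

theorem dx_zero (x t : ℝ) : dx q x t 0 = q x t := by simp [dx]

theorem IsJostColumn.hasDerivAt_zero {j : Fin 2} (h : IsJostColumn δ q₀ q U l c j ψ) (hz : z ∈ U)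
    (x t : ℝ) : HasDerivAt (fun y => ψ y t z 0 j)
      (I * kfun q₀ z * ψ x t z 0 j + I * conj (q x t) * ψ x t z 1 j) x := by
  have h0 := hasDerivAt_pi.1 (h.lax_x x t z hz) 0
  refine h0.congr_deriv ?_
  simp [laxX, Matrix.mulVec, dotProduct, Fin.sum_univ_two, dxc, dx_zero]

theorem IsJostColumn.hasDerivAt_one {j : Fin 2} (h : IsJostColumn δ q₀ q U l c j ψ) (hz : z ∈ U)
    (x t : ℝ) : HasDerivAt (fun y => ψ y t z 1 j)
      (I * q x t * ψ x t z 0 j - I * kfun q₀ z * ψ x t z 1 j) x := by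
  have h0 := hasDerivAt_pi.1 (h.lax_x x t z hz) 1
  refine h0.congr_deriv ?_
  simp [laxX, Matrix.mulVec, dotProduct, Fin.sum_univ_two, dx_zero]
  ring

theorem IsJostColumn.isJostAt (h : IsJostColumn δ q₀ q U l c 0 ψ) (hz : z ∈ U) (t : ℝ) :
    IsJostAt l q₀ (fun x => q x t) c z (fun x => (mu δ q₀ ψ x t z).col 0) where
  deriv_zero := fun x => by
    have h1 := (h.hasDerivAt_zero hz x t).fun_mul (hasDerivAt_exp_theta δ q₀ x t (-I) z)
    simp only [Matrix.col_apply, mu_zero]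
    refine h1.congr_deriv ?_
    linear_combination I * ψ x t z 0 0 * exp (-I * theta δ q₀ x t z) * kfun_sub_lam q₀ z
  deriv_one := fun x => by
    have h1 := (h.hasDerivAt_one hz x t).fun_mul (hasDerivAt_exp_theta δ q₀ x t (-I) z)
    simp only [Matrix.col_apply, mu_zero]
    refine h1.congr_deriv ?_
    linear_combination -I * ψ x t z 1 0 * exp (-I * theta δ q₀ x t z) * kfun_add_lam q₀ z
  lim := by
    have := h.normalized t z hz
    have e : (Ymat c z).col 0 = ![1, c / z] := by
      funext i
      fin_cases i <;> simp [Ymat]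
    rwa [e] at this

/-- The second column at the reflected point is, up to a factor, the first column. -/
theorem IsJostColumn.isJostAt_refl (hq₀ : 0 < q₀) (hc : ‖c‖ = q₀)
    (h : IsJostColumn δ q₀ q U l c 1 ψ) (hz0 : z ≠ 0) (hz : refl q₀ z ∈ U) (t : ℝ) :
    IsJostAt l q₀ (fun x => q x t) c z
      (fun x => (c / z) • (mu δ q₀ ψ x t (refl q₀ z)).col 1) where
  deriv_zero := fun x => by
    have h1 := ((h.hasDerivAt_zero hz x t).fun_mul
      (hasDerivAt_exp_theta δ q₀ x t I (refl q₀ z))).const_mul (c / z)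
    simp only [Pi.smul_apply, smul_eq_mul, Matrix.col_apply, mu_one]
    refine h1.congr_deriv ?_
    rw [kfun_refl hq₀, lam_refl hq₀]
    linear_combination (c / z) * I * ψ x t (refl q₀ z) 0 1 *
      exp (I * theta δ q₀ x t (refl q₀ z)) * kfun_sub_lam q₀ z
  deriv_one := fun x => by
    have h1 := ((h.hasDerivAt_one hz x t).fun_mul
      (hasDerivAt_exp_theta δ q₀ x t I (refl q₀ z))).const_mul (c / z)
    simp only [Pi.smul_apply, smul_eq_mul, Matrix.col_apply, mu_one]
    refine h1.congr_deriv ?_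
    rw [kfun_refl hq₀, lam_refl hq₀]
    linear_combination -(c / z) * I * ψ x t (refl q₀ z) 1 1 *
      exp (I * theta δ q₀ x t (refl q₀ z)) * kfun_add_lam q₀ z
  lim := by
    have hq' : (q₀ : ℂ) ≠ 0 := by exact_mod_cast hq₀.ne'
    have := (h.normalized t _ hz).const_smul (c / z)
    have e : (c / z) • (Ymat c (refl q₀ z)).col 1 = ![1, c / z] := by
      funext i
      fin_cases i
      · simp [Ymat, refl]
        field_simp
        exact mul_conj_of_norm hc
      · simp [Ymat]
    rwa [e] at this

/-! ### Wronskians -/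

theorem wronskian_const {u v : ℝ → Fin 2 → ℂ} {A : ℝ → Matrix (Fin 2) (Fin 2) ℂ}
    (hA : ∀ x, A x 1 1 = -A x 0 0) (hu : ∀ x, HasDerivAt u ((A x).mulVec (u x)) x)
    (hv : ∀ x, HasDerivAt v ((A x).mulVec (v x)) x) (x y : ℝ) :
    wronskian (u x) (v x) = wronskian (u y) (v y) := by
  have hd : ∀ x, HasDerivAt (fun x => wronskian (u x) (v x)) 0 x := fun x => by
    have u' := hasDerivAt_pi.1 (hu x)
    have v' := hasDerivAt_pi.1 (hv x)
    refine (((u' 0).fun_mul (v' 1)).fun_sub ((u' 1).fun_mul (v' 0))).congr_deriv ?_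
    simp only [Matrix.mulVec, dotProduct, Fin.sum_univ_two, hA]
    ring
  exact is_const_of_deriv_eq_zero (fun x => (hd x).differentiableAt) (fun x => (hd x).deriv) x y

theorem IsJostColumn.wronskian_eq {U' : Set ℂ} {l' : Filter ℝ} {c' : ℂ} {j j' : Fin 2}
    {ψ' : ℝ → ℝ → ℂ → Matrix (Fin 2) (Fin 2) ℂ} (h : IsJostColumn δ q₀ q U l c j ψ)
    (h' : IsJostColumn δ q₀ q U' l' c' j' ψ') (hz : z ∈ U) (hz' : z ∈ U') (x t x' t' : ℝ) :
    wronskian ((ψ x t z).col j) ((ψ' x t z).col j') =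
      wronskian ((ψ x' t' z).col j) ((ψ' x' t' z).col j') := by
  have h1 := wronskian_const (u := fun y => (ψ y t z).col j) (v := fun y => (ψ' y t z).col j')
    (A := fun x => laxX (dx q x t) (dxc q x t) (kfun q₀ z)) (fun x => by simp [laxX])
    (fun x => h.lax_x x t z hz) (fun x => h'.lax_x x t z hz') x x'
  have h2 := wronskian_const (u := fun s => (ψ x' s z).col j) (v := fun s => (ψ' x' s z).col j')
    (A := fun s => laxT δ q₀ (dx q x' s) (dxc q x' s) (kfun q₀ z)) (fun x => by simp [laxT])
    (fun s => h.lax_t x' s z hz) (fun s => h'.lax_t x' s z hz') t t'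
  exact h1.trans h2

theorem wronskian_mu (x t : ℝ) :
    wronskian ((mu δ q₀ ψ x t z).col 0) ((mu δ q₀ ψm x t z).col 1) =
      wronskian ((ψ x t z).col 0) ((ψm x t z).col 1) := by
  have e : exp (-I * theta δ q₀ x t z) * exp (I * theta δ q₀ x t z) = 1 := by
    rw [← exp_add]
    simp
  simp only [wronskian, Matrix.col_apply, mu_zero, mu_one]
  linear_combination (ψ x t z 0 0 * ψm x t z 1 1 - ψ x t z 1 0 * ψm x t z 0 1) * e

/-! ### Reflectionless solutions -/

/-- A solution of the equation with Jost solutions `ψm` and `ψp` and without reflection, for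
which the zeros of `s₁₁` are the points `ξ n`. -/
structure IsReflectionlessSolution (δ q₀ : ℝ) (q : ℝ → ℝ → ℂ) (qm qp : ℂ)
    (ψm ψp : ℝ → ℝ → ℂ → Matrix (Fin 2) (Fin 2) ℂ) (ξ : ι → ℂ) : Prop where
  pos : 0 < q₀
  norm_minus : ‖qm‖ = q₀
  norm_plus : ‖qp‖ = q₀
  smooth : ContDiff ℝ 6 (fun p : ℝ × ℝ => q p.1 p.2)
  integrable_minus : ∀ t : ℝ, MeasureTheory.IntegrableOn
    (fun x => (1 + |x|) * ‖q x t - qm‖) (Set.Iic 0)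
  integrable_plus : ∀ t : ℝ, MeasureTheory.IntegrableOn
    (fun x => (1 + |x|) * ‖q x t - qp‖) (Set.Ici 0)
  jost : IsJostPair δ q₀ q qm qp ψm ψp
  injective : Function.Injective ξ
  mem : ∀ n, ξ n ∈ DPlus q₀
  zeros : ∀ z ∈ closedPlus q₀, s11 q₀ ψm ψp z = 0 ↔ ∃ n, z = ξ n
  jump : ∀ x t : ℝ, ∀ z ∈ contour q₀, jumpG δ q₀ ψm ψp x t z = 0

namespace IsReflectionlessSolution

theorem contDiff (h : IsReflectionlessSolution δ q₀ q qm qp ψm ψp ξ) (t : ℝ) :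
    ContDiff ℝ 6 (fun x => q x t) :=
  h.smooth.comp (contDiff_id.prodMk contDiff_const)

theorem potential_plus (h : IsReflectionlessSolution δ q₀ q qm qp ψm ψp ξ) (t : ℝ) :
    IsPotential q₀ (fun x => q x t) qp :=
  ⟨h.pos, (h.contDiff t).of_le (by norm_num), h.norm_plus, h.integrable_plus t⟩

theorem potential_minus (h : IsReflectionlessSolution δ q₀ q qm qp ψm ψp ξ) (t : ℝ) :
    IsPotential q₀ (fun x => q (-x) t) qm :=
  isPotential_of_bot (q := fun x => q x t) h.pos ((h.contDiff t).of_le (by norm_num)) h.norm_minus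
    (h.integrable_minus t)

theorem jost_minus (h : IsReflectionlessSolution δ q₀ q qm qp ψm ψp ξ) (t : ℝ) :
    ∀ z ∈ closedMinus q₀, IsJostAt atBot q₀ (fun x => q x t) qm z
      (fun x => (mu δ q₀ ψm x t z).col 0) := fun _ hz => h.jost.minus_one.isJostAt hz t

theorem jost_plus (h : IsReflectionlessSolution δ q₀ q qm qp ψm ψp ξ) (t : ℝ) :
    ∀ z ∈ closedPlus q₀, IsJostOne q₀ (fun x => q x t) qp z
      (fun x => (mu δ q₀ ψp x t z).col 0) := fun _ hz => (h.jost.plus_one.isJostAt hz t).isJostOne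

/-- The second column of `μ₋` is the dual of the first. -/
theorem minus_two_eq (h : IsReflectionlessSolution δ q₀ q qm qp ψm ψp ξ) (x t : ℝ)
    (hz : z ∈ closedPlus q₀) (i : Fin 2) :
    mu δ q₀ ψm x t z i 1 = dual q₀ qm (fun z => mu δ q₀ ψm x t z i 0) z := by
  have hq' : (q₀ : ℂ) ≠ 0 := by exact_mod_cast h.pos.ne'
  have hz0 : z ≠ 0 := ((mem_closedPlus_iff h.pos).1 hz).2.1
  have hr := (refl_mem_closedMinus_iff h.pos).2 hz
  have e := (h.jost_minus t _ hr).unique_bot (h.potential_minus t) hr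
    (h.jost.minus_two.isJostAt_refl h.pos h.norm_minus (refl_ne_zero h.pos hz0)
      (by rwa [refl_refl h.pos]) t)
  have e1 := congrFun (congrFun e x) i
  simp only [Matrix.col_apply, Pi.smul_apply, smul_eq_mul, refl_refl h.pos] at e1
  rw [dual, e1, refl]
  have := mul_conj_of_norm h.norm_minus
  field_simp
  linear_combination -mu δ q₀ ψm x t z i 1 * this

theorem s11_mul_gam (h : IsReflectionlessSolution δ q₀ q qm qp ψm ψp ξ) (x t : ℝ)
    (hz : z ∈ closedPlus q₀) : s11 q₀ ψm ψp z * gam q₀ z =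
      wronskian ((mu δ q₀ ψp x t z).col 0) ((mu δ q₀ ψm x t z).col 1) := by
  obtain ⟨_, h0, h1, h2⟩ := (mem_closedPlus_iff h.pos).1 hz
  have hg := gam_ne_zero h0 h1 h2
  have e : s11 q₀ ψm ψp z =
      wronskian ((ψp 0 0 z).col 0) ((ψm 0 0 z).col 1) / gam q₀ z := rfl
  rw [wronskian_mu, e, div_mul_cancel₀ _ hg]
  exact h.jost.plus_one.wronskian_eq h.jost.minus_two hz hz 0 0 x t

/-- The determinant of `μ₋` on the contour. -/
theorem det_minus (h : IsReflectionlessSolution δ q₀ q qm qp ψm ψp ξ) (x t : ℝ)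
    (hz : z ∈ contour q₀) :
    wronskian ((mu δ q₀ ψm x t z).col 0) ((mu δ q₀ ψm x t z).col 1) = gam q₀ z := by
  have t1 := h.jost.minus_one.normalized t z (Or.inr hz)
  have t2 := h.jost.minus_two.normalized t z (Or.inr hz)
  have hz0 : z ≠ 0 := hz.2.1
  rw [tendsto_pi_nhds] at t1 t2
  have t3 := ((t1 0).mul (t2 1)).sub ((t1 1).mul (t2 0))
  have e : (Ymat qm z).col 0 0 * (Ymat qm z).col 1 1 - (Ymat qm z).col 0 1 * (Ymat qm z).col 1 0
      = gam q₀ z := by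
    have := mul_conj_of_norm h.norm_minus
    simp only [Ymat, gam, Matrix.col_apply, Matrix.of_apply, Matrix.cons_val_zero,
      Matrix.cons_val_one, Matrix.cons_val_fin_one]
    field_simp
    linear_combination this
  rw [e] at t3
  refine tendsto_nhds_unique (tendsto_const_nhds.congr fun y => ?_) t3
  have := h.jost.minus_one.wronskian_eq h.jost.minus_two (Or.inr hz) (Or.inr hz) x t y t
  rw [wronskian_mu, this, ← wronskian_mu (δ := δ) (q₀ := q₀)]
  rfl

theorem jump_eq (h : IsReflectionlessSolution δ q₀ q qm qp ψm ψp ξ) (x t : ℝ)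
    (hz : z ∈ contour q₀) :
    (mu δ q₀ ψp x t z).col 0 = s11 q₀ ψm ψp z • (mu δ q₀ ψm x t z).col 0 := by
  have hzp : z ∈ closedPlus q₀ := Or.inr hz
  have hzm : z ∈ closedMinus q₀ := Or.inr hz
  have hg := gam_ne_zero hz.2.1 hz.2.2.1 hz.2.2.2
  have hs : s11 q₀ ψm ψp z ≠ 0 := fun h0 => by
    obtain ⟨n, e⟩ := (h.zeros z hzp).1 h0
    exact notMem_DPlus_of_mem_closedMinus h.pos hzm (e ▸ h.mem n)
  have j := congrFun (congrFun (h.jump 0 0 z hz) 1) 0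
  have j1 : rho q₀ ψm ψp z = 0 := by
    have : rho q₀ ψm ψp z * exp (-(2 * I * theta δ q₀ 0 0 z)) = 0 := j
    exact (mul_eq_zero.1 this).resolve_right (exp_ne_zero _)
  have j2 : scattering q₀ ψm ψp z 1 0 = 0 := (div_eq_zero_iff.1 j1).resolve_right hs
  have j3 : wronskian ((ψm 0 0 z).col 0) ((ψp 0 0 z).col 0) = 0 :=
    (div_eq_zero_iff.1 j2).resolve_right hg
  rw [h.jost.minus_one.wronskian_eq h.jost.plus_one hzm hzp 0 0 x t] at j3
  have w1 := h.s11_mul_gam x t hzp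
  have w2 := h.det_minus x t hz
  simp only [wronskian, Matrix.col_apply] at j3 w1 w2
  have j4 : mu δ q₀ ψm x t z 0 0 * mu δ q₀ ψp x t z 1 0 -
      mu δ q₀ ψm x t z 1 0 * mu δ q₀ ψp x t z 0 0 = 0 := by
    simp only [mu_zero]
    linear_combination exp (-I * theta δ q₀ x t z) ^ 2 * j3
  funext i
  refine mul_right_cancel₀ hg ?_
  rw [Pi.smul_apply, smul_eq_mul, mul_right_comm, w1, ← w2]
  fin_cases i
  · simp only [Matrix.col_apply, Fin.zero_eta]
    linear_combination mu δ q₀ ψm x t z 0 1 * j4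
  · simp only [Matrix.col_apply, Fin.mk_one]
    linear_combination mu δ q₀ ψm x t z 1 1 * j4

theorem symm_plus (h : IsReflectionlessSolution δ q₀ q qm qp ψm ψp ξ) (x t : ℝ)
    (hz : z ∈ closedPlus q₀) : (mu δ q₀ ψp x t z).col 0 =
      (qp / z) • antiRot ((mu δ q₀ ψp x t (antiRefl q₀ z)).col 0) := by
  have hz0 : z ≠ 0 := ((mem_closedPlus_iff h.pos).1 hz).2.1
  have h1 := (h.jost.plus_one.isJostAt ((antiRefl_mem_closedPlus_iff h.pos).2 hz) t).symm h.pos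
    h.norm_plus hz0
  exact congrFun ((h.jost_plus t z hz).unique (h.potential_plus t) hz h1.isJostOne) x

theorem symm_minus (h : IsReflectionlessSolution δ q₀ q qm qp ψm ψp ξ) (x t : ℝ)
    (hz : z ∈ closedMinus q₀) : (mu δ q₀ ψm x t z).col 0 =
      (qm / z) • antiRot ((mu δ q₀ ψm x t (antiRefl q₀ z)).col 0) := by
  have hz0 : z ≠ 0 := ((mem_closedMinus_iff h.pos).1 hz).2.1
  have h1 := (h.jost.minus_one.isJostAt ((antiRefl_mem_closedMinus_iff h.pos).2 hz) t).symm h.pos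
    h.norm_minus hz0
  exact congrFun ((h.jost_minus t z hz).unique_bot (h.potential_minus t) hz h1) x

theorem isScattering (h : IsReflectionlessSolution δ q₀ q qm qp ψm ψp ξ) (x t : ℝ) :
    IsScattering q₀ qm qp (q x t) ξ (s11 q₀ ψm ψp) (fun z => (mu δ q₀ ψm x t z).col 0)
      (fun z => (mu δ q₀ ψp x t z).col 0) where
  pos := h.pos
  norm_minus := h.norm_minus
  norm_plus := h.norm_plus
  injective := h.injective
  mem := h.mem
  minus_diff := fun _ hz => IsJostAt.differentiableAt_bot (h.potential_minus t) (h.jost_minus t) hz x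
  minus_cont := fun _ hz =>
    IsJostAt.continuousWithinAt_bot (h.potential_minus t) (h.jost_minus t) hz x
  minus_branch := fun w hw => by
    have : (𝓝[closedMinus q₀] w).NeBot :=
      (neBot_contour h.pos hw).mono (nhdsWithin_mono _ Set.subset_union_right)
    have hq' : (q₀ : ℂ) ≠ 0 := by exact_mod_cast h.pos.ne'
    exact IsJostAt.exists_tendsto_bot (h.potential_minus t) (h.jost_minus t)
      (by rcases hw with rfl | rfl <;> simp [hq']) x
  minus_inf := IsJostAt.tendsto_infMinus (h.potential_minus t) (h.jost_minus t) x
  minus_symm := fun _ hz => h.symm_minus x t hz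
  potential := IsJostAt.tendsto_potential_bot (h.potential_minus t) (h.jost_minus t) x
  plus_diff := fun _ hz => IsJostOne.differentiableAt (h.potential_plus t) (h.jost_plus t) hz x
  plus_cont := fun _ hz => IsJostOne.continuousWithinAt (h.potential_plus t) (h.jost_plus t) hz x
  plus_branch := fun w hw => by
    have : (𝓝[closedPlus q₀] w).NeBot :=
      (neBot_contour h.pos hw).mono (nhdsWithin_mono _ Set.subset_union_right)
    have hq' : (q₀ : ℂ) ≠ 0 := by exact_mod_cast h.pos.ne'
    have hw0 : w ≠ 0 := by rcases hw with rfl | rfl <;> simp [hq']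
    obtain ⟨L, hL⟩ := IsJostOne.exists_tendsto (h.potential_plus t) (h.jost_plus t) hw0 x
    exact ⟨L, IsJostOne.limit_ne_zero (h.potential_plus t) (h.jost_plus t) hw0 hL, hL⟩
  plus_inf := IsJostOne.tendsto_infPlus (h.potential_plus t) (h.jost_plus t) x
  plus_symm := fun _ hz => h.symm_plus x t hz
  coeff := fun z hz => by
    rw [h.s11_mul_gam x t hz]
    simp only [Matrix.col_apply, wronskian]
    rw [h.minus_two_eq x t hz, h.minus_two_eq x t hz]
  zeros := h.zeros
  jump := fun _ hz => h.jump_eq x t hz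

end IsReflectionlessSolution

end SexticNLS

namespace SexticNLS

variable {δ q₀ : ℝ} {q : ℝ → ℝ → ℂ} {qm qp c z w : ℂ} {ι : Type*} {ξ : ι → ℂ}
  {ψm ψp : ℝ → ℝ → ℂ → Matrix (Fin 2) (Fin 2) ℂ}

/-! ### A priori bounds for the Lax pair -/

theorem contDiff_dx {n : ℕ} {j : ℕ}
    (hq : ContDiff ℝ ((n + j : ℕ) : ℕ∞) (fun p : ℝ × ℝ => q p.1 p.2)) :
    ContDiff ℝ (n : ℕ∞) (fun p : ℝ × ℝ => dx q p.1 p.2 j) := by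
  induction j generalizing n with
  | zero => simpa [dx] using hq
  | succ j ih =>
    have h1 : ContDiff ℝ ((n + 1 : ℕ) : ℕ∞) (fun p : ℝ × ℝ => dx q p.1 p.2 j) :=
      ih (by rwa [add_right_comm, add_assoc])
    have hd : Differentiable ℝ (fun p : ℝ × ℝ => dx q p.1 p.2 j) :=
      h1.differentiable (by simp)
    have e : (fun p : ℝ × ℝ => dx q p.1 p.2 (j + 1)) =
        fun p => fderiv ℝ (fun p : ℝ × ℝ => dx q p.1 p.2 j) p (1, 0) := by
      funext p
      have h2 : HasDerivAt (fun y : ℝ => (y, p.2)) (1, 0) p.1 :=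
        (hasDerivAt_id _).prodMk (hasDerivAt_const _ _)
      have h3 := (hd (p.1, p.2)).hasFDerivAt.comp_hasDerivAt p.1 h2
      have h4 : dx q p.1 p.2 (j + 1) = deriv (fun y => dx q y p.2 j) p.1 := by
        simp only [dx, iteratedDeriv_succ]
      rw [h4]
      exact h3.deriv
    rw [e]
    exact (h1.fderiv_right (m := (n : ℕ∞)) (by norm_cast)).clm_apply contDiff_const

theorem exists_mulVec_bound {K : Set (ℝ × ℂ)} (hK : IsCompact K)
    {A : ℝ × ℂ → Matrix (Fin 2) (Fin 2) ℂ} (hA : ∀ i j, ContinuousOn (fun p => A p i j) K) :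
    ∃ C, 0 ≤ C ∧ ∀ p ∈ K, ∀ v, ‖(A p).mulVec v‖ ≤ C * ‖v‖ := by
  have hc : ContinuousOn (fun p => ∑ i, ∑ j, ‖A p i j‖) K :=
    continuousOn_finsetSum _ fun i _ => continuousOn_finsetSum _ fun j _ => (hA i j).norm
  obtain ⟨C, hC⟩ := hK.exists_bound_of_continuousOn hc
  refine ⟨max C 0, le_max_right _ _, fun p hp v => ?_⟩
  have h1 : ∑ i, ∑ j, ‖A p i j‖ ≤ max C 0 :=
    (le_abs_self _).trans ((hC p hp).trans (le_max_left _ _))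
  rw [pi_norm_le_iff_of_nonneg (by positivity)]
  intro i
  refine le_trans ?_ (mul_le_mul_of_nonneg_right h1 (norm_nonneg v))
  rw [Matrix.mulVec, dotProduct]
  calc ‖∑ j, A p i j * v j‖ ≤ ∑ j, ‖A p i j‖ * ‖v‖ := by
        refine norm_sum_le_of_le _ fun j _ => ?_
        rw [norm_mul]
        exact mul_le_mul_of_nonneg_left (norm_le_pi_norm v j) (norm_nonneg _)
    _ = (∑ j, ‖A p i j‖) * ‖v‖ := by rw [Finset.sum_mul]
    _ ≤ (∑ i, ∑ j, ‖A p i j‖) * ‖v‖ := by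
        refine mul_le_mul_of_nonneg_right ?_ (norm_nonneg v)
        exact Finset.single_le_sum (f := fun i => ∑ j, ‖A p i j‖)
          (fun i _ => Finset.sum_nonneg fun j _ => norm_nonneg _) (Finset.mem_univ i)

/-- A solution of both equations of the Lax pair at the spectral parameter `z`. -/
structure IsLaxSolution (δ q₀ : ℝ) (q : ℝ → ℝ → ℂ) (z : ℂ) (u : ℝ → ℝ → Fin 2 → ℂ) : Prop where
  lax_x : ∀ x t : ℝ, HasDerivAt (fun y => u y t)
    ((laxX (dx q x t) (dxc q x t) (kfun q₀ z)).mulVec (u x t)) x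
  lax_t : ∀ x t : ℝ, HasDerivAt (fun s => u x s)
    ((laxT δ q₀ (dx q x t) (dxc q x t) (kfun q₀ z)).mulVec (u x t)) t

theorem IsLaxSolution.sub {u v : ℝ → ℝ → Fin 2 → ℂ} (hu : IsLaxSolution δ q₀ q z u)
    (hv : IsLaxSolution δ q₀ q z v) : IsLaxSolution δ q₀ q z (fun x t => u x t - v x t) where
  lax_x := fun x t => ((hu.lax_x x t).sub (hv.lax_x x t)).congr_deriv (Matrix.mulVec_sub _ _ _).symm
  lax_t := fun x t => ((hu.lax_t x t).sub (hv.lax_t x t)).congr_deriv (Matrix.mulVec_sub _ _ _).symm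

theorem IsLaxSolution.const_smul {u : ℝ → ℝ → Fin 2 → ℂ} (hu : IsLaxSolution δ q₀ q z u) (a : ℂ) :
    IsLaxSolution δ q₀ q z (fun x t => a • u x t) where
  lax_x := fun x t => ((hu.lax_x x t).const_smul a).congr_deriv (Matrix.mulVec_smul _ _ _).symm
  lax_t := fun x t => ((hu.lax_t x t).const_smul a).congr_deriv (Matrix.mulVec_smul _ _ _).symm

theorem IsJostColumn.isLaxSolution {U : Set ℂ} {l : Filter ℝ} {j : Fin 2}
    (h : IsJostColumn δ q₀ q U l c j ψm) (hz : z ∈ U) :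
    IsLaxSolution δ q₀ q z (fun x t => (ψm x t z).col j) :=
  ⟨fun x t => h.lax_x x t z hz, fun x t => h.lax_t x t z hz⟩

theorem continuousOn_laxX {Y : Type*} [TopologicalSpace Y] {S : Set Y} {u v : Y → ℕ → ℂ} {k : Y → ℂ}
    (hu : ContinuousOn (fun p => u p 0) S) (hv : ContinuousOn (fun p => v p 0) S)
    (hk : ContinuousOn k S) (i j : Fin 2) :
    ContinuousOn (fun p => laxX (u p) (v p) (k p) i j) S := by
  fin_cases i <;> fin_cases j <;> simp [laxX] <;> fun_prop

theorem continuousOn_laxT {Y : Type*} [TopologicalSpace Y] {S : Set Y} {u v : Y → ℕ → ℂ} {k : Y → ℂ}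
    (hu : ∀ j ≤ 5, ContinuousOn (fun p => u p j) S) (hv : ∀ j ≤ 5, ContinuousOn (fun p => v p j) S)
    (hk : ContinuousOn k S) (i j : Fin 2) :
    ContinuousOn (fun p => laxT δ q₀ (u p) (v p) (k p) i j) S := by
  have u0 := hu 0 (by norm_num)
  have u1 := hu 1 (by norm_num)
  have u2 := hu 2 (by norm_num)
  have u3 := hu 3 (by norm_num)
  have u4 := hu 4 (by norm_num)
  have u5 := hu 5 (by norm_num)
  have v0 := hv 0 (by norm_num)
  have v1 := hv 1 (by norm_num)
  have v2 := hv 2 (by norm_num)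
  have v3 := hv 3 (by norm_num)
  have v4 := hv 4 (by norm_num)
  have v5 := hv 5 (by norm_num)
  have h11 : ContinuousOn (fun p => laxT11 δ q₀ (u p) (v p) (k p)) S := by
    unfold laxT11
    fun_prop
  have h12 : ContinuousOn (fun p => laxT12 δ (u p) (v p) (k p)) S := by
    unfold laxT12
    fun_prop
  have h21 : ContinuousOn (fun p => laxT21 δ (u p) (v p) (k p)) S := by
    unfold laxT21
    fun_prop
  fin_cases i <;> fin_cases j
  exacts [h11, h12, h21, h11.neg]

/-- Solutions of the Lax pair are controlled by their value at one point, locally uniformly in the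
spectral parameter. -/
theorem exists_lax_bound (hq : ContDiff ℝ 6 (fun p : ℝ × ℝ => q p.1 p.2)) (hw : w ≠ 0)
    (x₀ t₀ x₁ t₁ : ℝ) : ∃ C, 0 ≤ C ∧ ∀ᶠ z in 𝓝 w, ∀ u, IsLaxSolution δ q₀ q z u →
      ‖u x₁ t₁‖ ≤ C * ‖u x₀ t₀‖ := by
  have hdx : ∀ j ≤ 5, Continuous (fun p : ℝ × ℝ => dx q p.1 p.2 j) := by
    intro j hj
    have h6 : ContDiff ℝ ((0 + j : ℕ) : ℕ∞) (fun p : ℝ × ℝ => q p.1 p.2) := by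
      refine hq.of_le ?_
      have : ((0 + j : ℕ) : ℕ∞) ≤ 6 := by
        rw [zero_add]
        exact Nat.cast_le.2 (hj.trans (by norm_num : 5 ≤ 6))
      exact WithTop.coe_le_coe.2 this
    exact (contDiff_dx h6).continuous
  have hdxc : ∀ j ≤ 5, Continuous (fun p : ℝ × ℝ => dxc q p.1 p.2 j) := fun j hj =>
    continuous_conj.comp (hdx j hj)
  obtain ⟨r, hr, hball⟩ := Metric.eventually_nhds_iff_ball.1 (eventually_ne_nhds hw)
  set B := Metric.closedBall w (r / 2) with hB
  have hB0 : ∀ z ∈ B, z ≠ 0 := fun z hz => hball z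
    (Metric.closedBall_subset_ball (by linarith) hz)
  have hk : ∀ S : Set ℝ, ContinuousOn (fun p : ℝ × ℂ => kfun q₀ p.2) (S ×ˢ B) := fun S p hp =>
    ((continuousAt_kfun (hB0 _ hp.2)).comp continuousAt_snd).continuousWithinAt
  have hBc : IsCompact B := isCompact_closedBall _ _
  obtain ⟨a, b, hx₀, hx₁⟩ : ∃ a b, x₀ ∈ Set.Icc a b ∧ x₁ ∈ Set.Icc a b :=
    ⟨min x₀ x₁, max x₀ x₁, ⟨min_le_left _ _, le_max_left _ _⟩, ⟨min_le_right _ _, le_max_right _ _⟩⟩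
  obtain ⟨a', b', ht₀, ht₁⟩ : ∃ a b, t₀ ∈ Set.Icc a b ∧ t₁ ∈ Set.Icc a b :=
    ⟨min t₀ t₁, max t₀ t₁, ⟨min_le_left _ _, le_max_left _ _⟩, ⟨min_le_right _ _, le_max_right _ _⟩⟩
  obtain ⟨C, hC, hCX⟩ := exists_mulVec_bound ((isCompact_Icc (a := a) (b := b)).prod hBc)
    (A := fun p => laxX (dx q p.1 t₀) (dxc q p.1 t₀) (kfun q₀ p.2)) (by
      have h0 : Continuous fun p : ℝ × ℂ => dx q p.1 t₀ 0 :=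
        (hdx 0 (by norm_num)).comp (by fun_prop : Continuous fun p : ℝ × ℂ => (p.1, t₀))
      have h1 : Continuous fun p : ℝ × ℂ => dxc q p.1 t₀ 0 :=
        (hdxc 0 (by norm_num)).comp (by fun_prop : Continuous fun p : ℝ × ℂ => (p.1, t₀))
      exact continuousOn_laxX h0.continuousOn h1.continuousOn (hk _))
  obtain ⟨C', hC', hCT⟩ := exists_mulVec_bound ((isCompact_Icc (a := a') (b := b')).prod hBc)
    (A := fun p => laxT δ q₀ (dx q x₁ p.1) (dxc q x₁ p.1) (kfun q₀ p.2)) (by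
      have h : Continuous fun p : ℝ × ℂ => (x₁, p.1) := by fun_prop
      exact continuousOn_laxT (fun j hj => ((hdx j hj).comp h).continuousOn)
        (fun j hj => ((hdxc j hj).comp h).continuousOn) (hk _))
  refine ⟨Real.exp (C' * (b' - a')) * Real.exp (C * (b - a)), by positivity, ?_⟩
  filter_upwards [Metric.closedBall_mem_nhds w (half_pos hr)] with z hz u hu
  have e1 := norm_le_exp_mul_norm hC (u := fun y => u y t₀)
    (fun x _ => hu.lax_x x t₀) (fun x hx => hCX (x, z) ⟨hx, hz⟩ _) hx₀ hx₁
  have e2 := norm_le_exp_mul_norm hC' (u := fun s => u x₁ s)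
    (fun t _ => hu.lax_t x₁ t) (fun t ht => hCT (t, z) ⟨ht, hz⟩ _) ht₀ ht₁
  rw [mul_assoc]
  exact e2.trans (mul_le_mul_of_nonneg_left e1 (Real.exp_pos _).le)

theorem IsLaxSolution.eq_zero (hq : ContDiff ℝ 6 (fun p : ℝ × ℝ => q p.1 p.2)) (hz : z ≠ 0)
    {u : ℝ → ℝ → Fin 2 → ℂ} (hu : IsLaxSolution δ q₀ q z u) {x₀ t₀ : ℝ} (h0 : u x₀ t₀ = 0)
    (x t : ℝ) : u x t = 0 := by
  obtain ⟨C, hC, h⟩ := exists_lax_bound (δ := δ) (q₀ := q₀) hq hz x₀ t₀ x t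
  have := h.self_of_nhds u hu
  rw [h0, norm_zero, mul_zero] at this
  exact norm_le_zero_iff.1 this

end SexticNLS

namespace SexticNLS

variable {δ q₀ : ℝ} {q : ℝ → ℝ → ℂ} {qm qp c z w : ℂ} {ι : Type*} {ξ : ι → ℂ}
  {ψm ψp : ℝ → ℝ → ℂ → Matrix (Fin 2) (Fin 2) ℂ}

/-! ### Norming constants -/

theorem differentiableAt_theta (δ q₀ x t : ℝ) (hz : z ≠ 0) :
    DifferentiableAt ℂ (fun z => theta δ q₀ x t z) z := by
  have h1 := differentiableAt_kfun (q₀ := q₀) hz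
  have h2 := differentiableAt_lam (q₀ := q₀) hz
  unfold theta
  fun_prop

theorem psi_eq_zero (ψ : ℝ → ℝ → ℂ → Matrix (Fin 2) (Fin 2) ℂ) (x t : ℝ) (z : ℂ) (i : Fin 2) :
    ψ x t z i 0 = mu δ q₀ ψ x t z i 0 * exp (I * theta δ q₀ x t z) := by
  rw [mu_zero, mul_assoc, ← exp_add]
  simp

theorem psi_eq_one (ψ : ℝ → ℝ → ℂ → Matrix (Fin 2) (Fin 2) ℂ) (x t : ℝ) (z : ℂ) (i : Fin 2) :
    ψ x t z i 1 = mu δ q₀ ψ x t z i 1 * exp (-I * theta δ q₀ x t z) := by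
  rw [mu_one, mul_assoc, ← exp_add]
  simp

/-- Vectors with vanishing Wronskian are proportional. -/
theorem exists_smul_of_wronskian_eq_zero {u v : Fin 2 → ℂ} (hv : v ≠ 0) (h : wronskian u v = 0) :
    ∃ b : ℂ, u = b • v := by
  simp only [wronskian] at h
  obtain ⟨i, hi⟩ := IsScattering.exists_index hv
  refine ⟨u i / v i, ?_⟩
  funext j
  rw [Pi.smul_apply, smul_eq_mul]
  field_simp
  fin_cases i <;> fin_cases j <;> simp only [Fin.zero_eta, Fin.mk_one] <;>
    first | ring1 | linear_combination h | linear_combination -h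

namespace IsReflectionlessSolution

theorem ne_zero_of_mem_DPlus (hz : z ∈ DPlus q₀) : z ≠ 0 := fun h => zero_notMem_DPlus (h ▸ hz)

theorem differentiableAt_mu_minus (h : IsReflectionlessSolution δ q₀ q qm qp ψm ψp ξ) (x t : ℝ)
    (hz : z ∈ DPlus q₀) (i : Fin 2) :
    DifferentiableAt ℂ (fun z => mu δ q₀ ψm x t z i 1) z := by
  refine ((h.isScattering x t).differentiableAt_dual hz i).congr_of_eventuallyEq ?_
  filter_upwards [(isOpen_DPlus q₀).mem_nhds hz] with w hw
  exact h.minus_two_eq x t (Or.inl hw) i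

theorem differentiableAt_minus (h : IsReflectionlessSolution δ q₀ q qm qp ψm ψp ξ) (x t : ℝ)
    (hz : z ∈ DPlus q₀) (i : Fin 2) : DifferentiableAt ℂ (fun z => ψm x t z i 1) z := by
  have h1 := h.differentiableAt_mu_minus x t hz i
  have h2 := differentiableAt_theta δ q₀ x t (ne_zero_of_mem_DPlus hz)
  have h3 := h1.fun_mul (h2.const_mul (-I)).cexp
  exact h3.congr_of_eventuallyEq (Eventually.of_forall fun w => psi_eq_one ψm x t w i)

theorem differentiableAt_plus (h : IsReflectionlessSolution δ q₀ q qm qp ψm ψp ξ) (x t : ℝ)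
    (hz : z ∈ DPlus q₀) (i : Fin 2) : DifferentiableAt ℂ (fun z => ψp x t z i 0) z := by
  have h1 := differentiableAt_pi.1 ((h.isScattering x t).plus_diff z hz) i
  have h2 := differentiableAt_theta δ q₀ x t (ne_zero_of_mem_DPlus hz)
  have h3 := h1.fun_mul (h2.const_mul I).cexp
  exact h3.congr_of_eventuallyEq (Eventually.of_forall fun w => psi_eq_zero ψp x t w i)

theorem minus_ne_zero (h : IsReflectionlessSolution δ q₀ q qm qp ψm ψp ξ) (x t : ℝ)
    (hz : z ∈ DPlus q₀) : (ψm x t z).col 1 ≠ 0 := fun h0 => by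
  have e := (h.jost.minus_two.isLaxSolution (Or.inl hz)).eq_zero h.smooth
    (ne_zero_of_mem_DPlus hz) h0
  have t1 := tendsto_pi_nhds.1 (h.jost.minus_two.normalized 0 z (Or.inl hz)) 1
  have t2 : Tendsto (fun x => (mu δ q₀ ψm x 0 z).col 1 1) atBot (𝓝 0) := by
    refine tendsto_const_nhds.congr fun y => ?_
    have := congrFun (e y 0) 1
    simp only [Matrix.col_apply, Pi.zero_apply] at this
    rw [Matrix.col_apply, mu_one, this, zero_mul]
  have := tendsto_nhds_unique t1 t2
  simp [Ymat] at this

theorem plus_ne_zero (h : IsReflectionlessSolution δ q₀ q qm qp ψm ψp ξ) (x t : ℝ)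
    (hz : z ∈ DPlus q₀) : (ψp x t z).col 0 ≠ 0 := fun h0 => by
  have e := (h.jost.plus_one.isLaxSolution (Or.inl hz)).eq_zero h.smooth
    (ne_zero_of_mem_DPlus hz) h0
  have t1 := tendsto_pi_nhds.1 (h.jost.plus_one.normalized 0 z (Or.inl hz)) 0
  have t2 : Tendsto (fun x => (mu δ q₀ ψp x 0 z).col 0 0) atTop (𝓝 0) := by
    refine tendsto_const_nhds.congr fun y => ?_
    have := congrFun (e y 0) 0
    simp only [Matrix.col_apply, Pi.zero_apply] at this
    rw [Matrix.col_apply, mu_zero, this, zero_mul]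
  have := tendsto_nhds_unique t1 t2
  simp [Ymat] at this

theorem s11_mul_gam' (h : IsReflectionlessSolution δ q₀ q qm qp ψm ψp ξ) (x t : ℝ)
    (hz : z ∈ DPlus q₀) : s11 q₀ ψm ψp z * gam q₀ z =
      ψp x t z 0 0 * ψm x t z 1 1 - ψp x t z 1 0 * ψm x t z 0 1 := by
  rw [h.s11_mul_gam x t (Or.inl hz), wronskian_mu]
  rfl

/-- Existence of the norming constants at a multiple zero of `s₁₁`. -/
theorem exists_norming (h : IsReflectionlessSolution δ q₀ q qm qp ψm ψp ξ) (hw : w ∈ DPlus q₀)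
    (h0 : s11 q₀ ψm ψp w = 0) (h1 : deriv (s11 q₀ ψm ψp) w = 0) :
    ∃ b d : ℂ, b ≠ 0 ∧ IsNorming ψm ψp w b d := by
  have hw0 := ne_zero_of_mem_DPlus hw
  have hm := h.minus_ne_zero 0 0 hw
  have hwr : wronskian ((ψp 0 0 w).col 0) ((ψm 0 0 w).col 1) = 0 := by
    have := h.s11_mul_gam' 0 0 hw
    rw [h0, zero_mul] at this
    exact this.symm
  obtain ⟨b, hb⟩ := exists_smul_of_wronskian_eq_zero hm hwr
  have hb0 : b ≠ 0 := fun e => h.plus_ne_zero 0 0 hw (by rw [hb, e, zero_smul])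
  have sm := h.jost.minus_two.isLaxSolution (z := w) (Or.inl hw)
  have sp := h.jost.plus_one.isLaxSolution (z := w) (Or.inl hw)
  have hball : ∀ x t i, ψp x t w i 0 = b * ψm x t w i 1 := fun x t i => by
    have e := (sp.sub (sm.const_smul b)).eq_zero h.smooth hw0 (x₀ := 0) (t₀ := 0)
      (by rw [hb, sub_self]) x t
    have := congrFun e i
    simp only [Pi.sub_apply, Pi.smul_apply, smul_eq_mul, Matrix.col_apply, Pi.zero_apply] at this
    exact sub_eq_zero.1 this
  have dp := fun x t i => (h.differentiableAt_plus x t hw i).hasDerivAt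
  have dm := fun x t i => (h.differentiableAt_minus x t hw i).hasDerivAt
  have hwr' : wronskian (fun i => deriv (fun z => ψp 0 0 z i 0) w - b * deriv (fun z => ψm 0 0 z i 1) w)
      ((ψm 0 0 w).col 1) = 0 := by
    have e1 : HasDerivAt (fun z => s11 q₀ ψm ψp z * gam q₀ z) 0 w := by
      have := ((h.isScattering 0 0).coeff_differentiableAt hw).hasDerivAt.fun_mul
        (IsScattering.differentiableAt_gam (q₀ := q₀) hw0).hasDerivAt
      rwa [h0, h1, zero_mul, zero_mul, zero_add] at this
    have e2 := ((dp 0 0 0).fun_mul (dm 0 0 1)).fun_sub ((dp 0 0 1).fun_mul (dm 0 0 0))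
    have e3 := e1.congr_of_eventuallyEq (f₁ := fun z =>
        ψp 0 0 z 0 0 * ψm 0 0 z 1 1 - ψp 0 0 z 1 0 * ψm 0 0 z 0 1) (by
      filter_upwards [(isOpen_DPlus q₀).mem_nhds hw] with y hy
      exact (h.s11_mul_gam' 0 0 hy).symm)
    have e4 := e2.unique e3
    rw [hball, hball] at e4
    simp only [wronskian, Matrix.col_apply]
    linear_combination e4
  obtain ⟨d, hd⟩ := exists_smul_of_wronskian_eq_zero hm hwr'
  refine ⟨b, d, hb0, fun x t i => ⟨hball x t i, ?_⟩⟩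
  set V : ℝ → ℝ → ℂ → Fin 2 → ℂ := fun x t z =>
    (z - w)⁻¹ • ((ψp x t z).col 0 - b • (ψm x t z).col 1) - d • (ψm x t z).col 1 with hV
  have hVlim : ∀ x t, Tendsto (V x t) (𝓝[≠] w) (𝓝 fun i => deriv (fun z => ψp x t z i 0) w -
      b * deriv (fun z => ψm x t z i 1) w - d * ψm x t w i 1) := fun x t => by
    refine tendsto_pi_nhds.2 fun i => ?_
    have t1 := hasDerivAt_iff_tendsto_slope.1 ((dp x t i).fun_sub ((dm x t i).const_mul b))
    have t2 : Tendsto (fun z => ψm x t z i 1) (𝓝[≠] w) (𝓝 (ψm x t w i 1)) :=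
      (dm x t i).continuousAt.tendsto.mono_left nhdsWithin_le_nhds
    refine (t1.sub (t2.const_mul d)).congr fun z => ?_
    simp only [slope_def_field, hball, sub_self, sub_zero, hV, Pi.sub_apply, Pi.smul_apply,
      smul_eq_mul, Matrix.col_apply]
    ring
  have hV0 : Tendsto (V 0 0) (𝓝[≠] w) (𝓝 0) := by
    have := hVlim 0 0
    convert this using 2
    funext i
    have := congrFun hd i
    simp only [Pi.smul_apply, smul_eq_mul, Matrix.col_apply] at this
    rw [this, sub_self]
    rfl
  obtain ⟨C, hC, hbd⟩ := exists_lax_bound (δ := δ) (q₀ := q₀) h.smooth hw0 0 0 x t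
  have hVx : Tendsto (V x t) (𝓝[≠] w) (𝓝 0) := by
    have t1 := hV0.norm.const_mul C
    rw [norm_zero, mul_zero] at t1
    refine squeeze_zero_norm' ?_ t1
    filter_upwards [nhdsWithin_le_nhds hbd, nhdsWithin_le_nhds ((isOpen_DPlus q₀).mem_nhds hw)]
      with z hz hzD
    have s1 := h.jost.minus_two.isLaxSolution (z := z) (Or.inl hzD)
    have s2 := h.jost.plus_one.isLaxSolution (z := z) (Or.inl hzD)
    exact hz _ (((s2.sub (s1.const_smul b)).const_smul (z - w)⁻¹).sub (s1.const_smul d))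
  have := congrFun (tendsto_nhds_unique (hVlim x t) hVx) i
  simp only [Pi.zero_apply] at this
  linear_combination this

end IsReflectionlessSolution

end SexticNLS

namespace SexticNLS

variable {δ q₀ : ℝ} {q : ℝ → ℝ → ℂ} {qm qp c z w b d : ℂ} {ι : Type*} {ξ : ι → ℂ} {e s : ℂ → ℂ}
  {ψm ψp : ℝ → ℝ → ℂ → Matrix (Fin 2) (Fin 2) ℂ}

/-! ### Discrete data at reflected points -/

theorem antiRefl_antiRefl (hq₀ : 0 < q₀) (z : ℂ) : antiRefl q₀ (antiRefl q₀ z) = z := by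
  rw [antiRefl_eq, conj_antiRefl, refl_refl hq₀]

theorem theta_conj (δ q₀ x t : ℝ) (z : ℂ) :
    conj (theta δ q₀ x t z) = theta δ q₀ x t (conj z) := by
  simp [theta, lam, kfun, map_ofNat (starRingEnd ℂ)]

theorem theta_antiRefl (hq₀ : 0 < q₀) (x t : ℝ) (z : ℂ) :
    theta δ q₀ x t (antiRefl q₀ z) = -conj (theta δ q₀ x t z) := by
  rw [antiRefl_eq, theta_refl hq₀, theta_conj]

theorem hasDerivAt_const_div (α : ℂ) (hz : z ≠ 0) :
    HasDerivAt (fun z => α / z) (-(α / z ^ 2)) z := by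
  refine ((hasDerivAt_const z α).fun_div (hasDerivAt_id z) hz).congr_deriv ?_
  simp only [id]
  ring

/-- The derivative of `f(σ z)*`. -/
theorem hasDerivAt_conj_antiRefl (hq₀ : 0 < q₀) {f : ℂ → ℂ} {f' : ℂ} (hw : w ≠ 0)
    (hf : HasDerivAt f f' w) :
    HasDerivAt (fun z => conj (f (antiRefl q₀ z))) (conj f' * (q₀ ^ 2 / antiRefl q₀ w ^ 2))
      (antiRefl q₀ w) := by
  have hz : antiRefl q₀ w ≠ 0 := refl_ne_zero hq₀ (by simpa using hw)
  have e : refl q₀ (antiRefl q₀ w) = conj w := by rw [antiRefl_eq, refl_refl hq₀]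
  have h1 := hf.conj_conj
  rw [← e] at h1
  have h2 := h1.comp (antiRefl q₀ w) (hasDerivAt_refl hz)
  refine h2.congr_of_eventuallyEq (Eventually.of_forall fun z => ?_)
  simp only [Function.comp_apply]
  rw [← conj_antiRefl, conj_conj]

/-- The data of a double zero: `s = (z - w)² e`. -/
theorem coeff_of_double_zero (he : AnalyticAt ℂ e w) (he0 : e w ≠ 0)
    (hs : s =ᶠ[𝓝 w] fun z => (z - w) ^ 2 * e z) (b d : ℂ) :
    iteratedDeriv 2 s w ≠ 0 ∧ coeffA s w b = b / e w ∧ coeffB s w b d = d / b - deriv e w / e w := by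
  obtain ⟨-, -, h2, h3⟩ := iteratedDeriv_two_three_of_eventuallyEq he hs
  refine ⟨by rw [h2]; exact mul_ne_zero two_ne_zero he0, ?_, ?_⟩
  · rw [coeffA, h2, mul_div_mul_left _ _ two_ne_zero]
  · rw [coeffB, h2, h3]
    field_simp
    ring

/-- The factor `e` at the reflected point. -/
noncomputable def reflFactor (q₀ : ℝ) (κ w : ℂ) (e : ℂ → ℂ) (z : ℂ) : ℂ :=
  κ * (q₀ ^ 2 / (z * antiRefl q₀ w)) ^ 2 * conj (e (antiRefl q₀ z))

theorem hasDerivAt_reflFactor (hq₀ : 0 < q₀) (κ : ℂ) (hw : w ≠ 0) (he : DifferentiableAt ℂ e w) :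
    HasDerivAt (reflFactor q₀ κ w e) (κ * (q₀ ^ 2 / antiRefl q₀ w ^ 2) ^ 2 *
      (conj (deriv e w) * (q₀ ^ 2 / antiRefl q₀ w ^ 2) - 2 / antiRefl q₀ w * conj (e w)))
      (antiRefl q₀ w) := by
  have hz : antiRefl q₀ w ≠ 0 := refl_ne_zero hq₀ (by simpa using hw)
  have h1 := hasDerivAt_conj_antiRefl hq₀ hw he.hasDerivAt
  have h2 : ∀ ζ : ℂ, ζ ≠ 0 → HasDerivAt (fun z => κ * (q₀ ^ 2 / (z * ζ)) ^ 2)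
      (-(2 * κ * (q₀ ^ 2 / ζ ^ 2) ^ 2 / ζ)) ζ := fun ζ hζ => by
    have := (((hasDerivAt_const ζ ((q₀ : ℂ) ^ 2)).fun_div
      ((hasDerivAt_id ζ).mul_const ζ) (mul_ne_zero hζ hζ)).fun_pow 2).const_mul κ
    refine this.congr_deriv ?_
    simp only [id, Nat.cast_ofNat, Nat.reduceSub, pow_one]
    field_simp
    ring
  refine ((h2 _ hz).fun_mul h1).congr_deriv ?_
  rw [antiRefl_antiRefl hq₀]
  field_simp
  ring

namespace IsReflectionlessSolution

theorem analyticAt_s11 (h : IsReflectionlessSolution δ q₀ q qm qp ψm ψp ξ) (hw : w ∈ DPlus q₀) :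
    AnalyticAt ℂ (s11 q₀ ψm ψp) w :=
  DifferentiableOn.analyticAt (s := DPlus q₀)
    (fun _ hz => ((h.isScattering 0 0).coeff_differentiableAt hz).differentiableWithinAt)
    ((isOpen_DPlus q₀).mem_nhds hw)

theorem reflected_zero (h : IsReflectionlessSolution δ q₀ q qm qp ψm ψp ξ) (hw : w ∈ DPlus q₀)
    (he : AnalyticAt ℂ e w) (hs : s11 q₀ ψm ψp =ᶠ[𝓝 w] fun z => (z - w) ^ 2 * e z) :
    AnalyticAt ℂ (reflFactor q₀ (qp / qm) w e) (antiRefl q₀ w) ∧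
    s11 q₀ ψm ψp =ᶠ[𝓝 (antiRefl q₀ w)]
      fun z => (z - antiRefl q₀ w) ^ 2 * reflFactor q₀ (qp / qm) w e z := by
  have hq' : (q₀ : ℂ) ≠ 0 := by exact_mod_cast h.pos.ne'
  have hw0 := ne_zero_of_mem_DPlus hw
  have hz0 : antiRefl q₀ w ≠ 0 := refl_ne_zero h.pos (by simpa using hw0)
  have hcont : Tendsto (antiRefl q₀) (𝓝 (antiRefl q₀ w)) (𝓝 w) := by
    have h1 : ContinuousAt (antiRefl q₀) (antiRefl q₀ w) :=
      (hasDerivAt_refl (by simpa using hz0)).continuousAt.comp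
        continuous_conj.continuousAt
    have := h1.tendsto
    rwa [antiRefl_antiRefl h.pos] at this
  constructor
  · rw [analyticAt_iff_eventually_differentiableAt]
    filter_upwards [hcont.eventually he.eventually_analyticAt, eventually_ne_nhds hz0]
      with z hz hzne
    have hz' : antiRefl q₀ z ≠ 0 := refl_ne_zero h.pos (by simpa using hzne)
    have d1 := (hasDerivAt_conj_antiRefl h.pos hz' hz.differentiableAt.hasDerivAt).differentiableAt
    rw [antiRefl_antiRefl h.pos] at d1
    have d2 : DifferentiableAt ℂ (fun z => qp / qm * (q₀ ^ 2 / (z * antiRefl q₀ w)) ^ 2) z := by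
      have : z * antiRefl q₀ w ≠ 0 := mul_ne_zero hzne hz0
      fun_prop (disch := assumption)
    exact d2.mul d1
  · filter_upwards [hcont.eventually hs, eventually_ne_nhds hz0,
      (isOpen_DPlus q₀).mem_nhds ((antiRefl_mem_DPlus_iff h.pos).2 hw)] with z hz hzne hzD
    rw [(h.isScattering 0 0).coeff_symm (Or.inl hzD), hz, map_mul, map_pow, map_sub, conj_antiRefl,
      reflFactor]
    have e1 : refl q₀ z - conj w = q₀ ^ 2 * (z - antiRefl q₀ w) / (z * antiRefl q₀ w) := by
      have : conj w = refl q₀ (antiRefl q₀ w) := by rw [antiRefl_eq, refl_refl h.pos]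
      rw [this]
      simp only [refl]
      field_simp
      ring
    rw [e1]
    field_simp

/-- The symmetries of the Jost solutions. -/
theorem psi_symm (h : IsReflectionlessSolution δ q₀ q qm qp ψm ψp ξ) (x t : ℝ)
    (hz : z ∈ DPlus q₀) :
    (ψp x t z).col 0 = (qp / z) • antiRot ((ψp x t (antiRefl q₀ z)).col 0) ∧
    (ψm x t z).col 1 = (conj qm / z) • antiRot ((ψm x t (antiRefl q₀ z)).col 1) := by
  have hz' := (antiRefl_mem_DPlus_iff h.pos).2 hz
  have c0 : ∀ z, (ψp x t z).col 0 = exp (I * theta δ q₀ x t z) • (mu δ q₀ ψp x t z).col 0 := by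
    intro z
    funext i
    rw [Pi.smul_apply, smul_eq_mul, mul_comm]
    exact psi_eq_zero ψp x t z i
  have c1 : ∀ z, (ψm x t z).col 1 = exp (-I * theta δ q₀ x t z) • (mu δ q₀ ψm x t z).col 1 := by
    intro z
    funext i
    rw [Pi.smul_apply, smul_eq_mul, mul_comm]
    exact psi_eq_one ψm x t z i
  have e0 : conj (exp (I * theta δ q₀ x t (antiRefl q₀ z))) = exp (I * theta δ q₀ x t z) := by
    rw [← exp_conj, theta_antiRefl h.pos]
    simp
  have e1 : conj (exp (-I * theta δ q₀ x t (antiRefl q₀ z))) = exp (-I * theta δ q₀ x t z) := by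
    rw [← exp_conj, theta_antiRefl h.pos]
    simp
  constructor
  · rw [c0, c0, h.symm_plus x t (Or.inl hz), antiRot_smul, e0, smul_comm]
  · have hdual : ∀ z ∈ DPlus q₀, (mu δ q₀ ψm x t z).col 1 =
        antiRot ((mu δ q₀ ψm x t (conj z)).col 0) := by
      intro z hz
      funext i
      rw [Matrix.col_apply, h.minus_two_eq x t (Or.inl hz)]
      exact (h.isScattering x t).dual_eq (Or.inl hz) i
    have e2 : (mu δ q₀ ψm x t z).col 1 =
        (conj qm / z) • antiRot ((mu δ q₀ ψm x t (antiRefl q₀ z)).col 1) := by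
      rw [hdual z hz, hdual _ hz', conj_antiRefl, h.symm_minus x t
        ((conj_mem_closedMinus_iff h.pos).2 (Or.inl hz)), antiRot_smul, antiRefl_eq]
      simp
    rw [c1, c1, e2, antiRot_smul, e1, smul_comm]

theorem reflected_norming (h : IsReflectionlessSolution δ q₀ q qm qp ψm ψp ξ) (hw : w ∈ DPlus q₀)
    (hn : IsNorming ψm ψp w b d) :
    IsNorming ψm ψp (antiRefl q₀ w) (qp / conj qm * conj b)
      (qp / conj qm * (q₀ ^ 2 / antiRefl q₀ w ^ 2) * conj d) := by
  intro x t
  have hq' : (q₀ : ℂ) ≠ 0 := by exact_mod_cast h.pos.ne'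
  have hc := conj_ne_zero_of_norm h.pos h.norm_minus
  have hw0 := ne_zero_of_mem_DPlus hw
  have hz0 : antiRefl q₀ w ≠ 0 := refl_ne_zero h.pos (by simpa using hw0)
  have hwD := (antiRefl_mem_DPlus_iff h.pos).2 hw
  obtain ⟨σ, j, hσ⟩ : ∃ (σ : Fin 2 → ℂ) (j : Fin 2 → Fin 2), ∀ v i, antiRot v i = σ i * conj (v (j i)) := by
    refine ⟨![-1, 1], ![1, 0], fun v i => ?_⟩
    fin_cases i <;> simp [antiRot]
  intro i
  have fp : ∀ z ∈ DPlus q₀, ψp x t z i 0 = qp / z * (σ i * conj (ψp x t (antiRefl q₀ z) (j i) 0)) :=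
    fun z hz => by
      have := congrFun (h.psi_symm x t hz).1 i
      rwa [Pi.smul_apply, hσ, smul_eq_mul] at this
  have fm : ∀ z ∈ DPlus q₀, ψm x t z i 1 =
      conj qm / z * (σ i * conj (ψm x t (antiRefl q₀ z) (j i) 1)) := fun z hz => by
      have := congrFun (h.psi_symm x t hz).2 i
      rwa [Pi.smul_apply, hσ, smul_eq_mul] at this
  have hdiv := fun α => hasDerivAt_const_div α hz0
  have gp := (hasDerivAt_conj_antiRefl h.pos hw0
    (h.differentiableAt_plus x t hw (j i)).hasDerivAt).const_mul (σ i)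
  have gm := (hasDerivAt_conj_antiRefl h.pos hw0
    (h.differentiableAt_minus x t hw (j i)).hasDerivAt).const_mul (σ i)
  have ep : deriv (fun z => ψp x t z i 0) (antiRefl q₀ w) = _ :=
    (((hdiv qp).fun_mul gp).congr_of_eventuallyEq (by
      filter_upwards [(isOpen_DPlus q₀).mem_nhds hwD] with z hz
      exact fp z hz)).deriv
  have em : deriv (fun z => ψm x t z i 1) (antiRefl q₀ w) = _ :=
    (((hdiv (conj qm)).fun_mul gm).congr_of_eventuallyEq (by
      filter_upwards [(isOpen_DPlus q₀).mem_nhds hwD] with z hz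
      exact fm z hz)).deriv
  obtain ⟨n1, n2⟩ := hn x t (j i)
  rw [ep, em, fp _ hwD, fm _ hwD, antiRefl_antiRefl h.pos, n1, n2]
  simp only [map_mul, map_add]
  constructor
  · field_simp
  · field_simp
    ring

end IsReflectionlessSolution

end SexticNLS

namespace SexticNLS

variable {δ q₀ : ℝ} {q : ℝ → ℝ → ℂ} {qm qp z w b d : ℂ} {ι : Type*} {ξ : ι → ℂ} {e : ℂ → ℂ}
  {ψm ψp : ℝ → ℝ → ℂ → Matrix (Fin 2) (Fin 2) ℂ}

/-! ### Principal parts and the discrete spectrum -/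

namespace IsReflectionlessSolution

/-- The principal part of `μ₊₁ / s₁₁` at a double zero of `s₁₁`. -/
theorem tendsto_principal (h : IsReflectionlessSolution δ q₀ q qm qp ψm ψp ξ) (hw : w ∈ DPlus q₀)
    (he : AnalyticAt ℂ e w) (he0 : e w ≠ 0)
    (hs : s11 q₀ ψm ψp =ᶠ[𝓝 w] fun z => (z - w) ^ 2 * e z) (hb : b ≠ 0)
    (hn : IsNorming ψm ψp w b d) (x t : ℝ) (i : Fin 2) :
    Tendsto (fun z => (z - w) * (mu δ q₀ ψp x t z i 0 / s11 q₀ ψm ψp z -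
      b / e w * exp (-(2 * I * theta δ q₀ x t w)) * (1 / (z - w) ^ 2 +
        (d / b - deriv e w / e w - 2 * I * deriv (fun z => theta δ q₀ x t z) w) / (z - w)) *
        dual q₀ qm (fun z => mu δ q₀ ψm x t z i 0) z)) (𝓝[≠] w) (𝓝 0) := by
  obtain ⟨n1, n2⟩ := hn x t i
  set θ := fun z => theta δ q₀ x t z with hθ
  set D := d / b - deriv e w / e w - 2 * I * deriv θ w with hD
  have dθ : HasDerivAt θ (deriv θ w) w :=
    (differentiableAt_theta δ q₀ x t (ne_zero_of_mem_DPlus hw)).hasDerivAt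
  have dp := (h.differentiableAt_plus x t hw i).hasDerivAt
  have dm := (h.differentiableAt_minus x t hw i).hasDerivAt
  have dl : HasDerivAt (fun z => 1 + D * (z - w)) D w := by
    simpa using (((hasDerivAt_id w).sub_const w).const_mul D).const_add 1
  set H : ℂ → ℂ := fun z => ψp x t z i 0 * exp (-I * θ z) / e z -
    b / e w * exp (-(2 * I * θ w)) * ((1 + D * (z - w)) * (ψm x t z i 1 * exp (I * θ z))) with hH
  have hexp : exp (-(2 * I * θ w)) * exp (I * θ w) = exp (-I * θ w) := by
    rw [← exp_add]
    ring_nf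
  have dH : HasDerivAt H 0 w := by
    refine (((dp.fun_mul (dθ.const_mul (-I)).cexp).fun_div
      he.differentiableAt.hasDerivAt he0).fun_sub ((dl.fun_mul (dm.fun_mul
        (dθ.const_mul I).cexp)).const_mul (b / e w * exp (-(2 * I * θ w))))).congr_deriv ?_
    rw [n1, n2, hD, ← hexp]
    field_simp
    ring
  have H0 : H w = 0 := by
    simp only [hH, n1, ← hexp]
    field_simp
    ring
  have t1 := hasDerivAt_iff_tendsto_slope.1 dH
  refine t1.congr' ?_
  filter_upwards [self_mem_nhdsWithin, nhdsWithin_le_nhds hs,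
    nhdsWithin_le_nhds (he.continuousAt.eventually_ne he0),
    nhdsWithin_le_nhds ((isOpen_DPlus q₀).mem_nhds hw)] with z hz hsz hez hzD
  have hzw : z - w ≠ 0 := sub_ne_zero.2 hz
  rw [slope_def_field, H0, sub_zero, ← h.minus_two_eq x t (Or.inl hzD), hsz, mu_zero, mu_one]
  simp only [hH, hθ]
  field_simp

end IsReflectionlessSolution

variable {N : ℕ} {zn : Fin N → ℂ}

theorem mem_DPlus_of_upper (hq₀ : 0 < q₀) (h : 0 < z.im ∧ q₀ < ‖z‖) : z ∈ DPlus q₀ := by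
  have h1 : 0 < (‖z‖ ^ 2 - q₀ ^ 2) * z.im := by
    refine mul_pos ?_ h.1
    nlinarith [h.2]
  exact h1

theorem xi_mem_DPlus (hq₀ : 0 < q₀) (hzn : ∀ n, 0 < (zn n).im ∧ q₀ < ‖zn n‖) (n : Fin N ⊕ Fin N) :
    xi q₀ zn n ∈ DPlus q₀ := by
  rcases n with n | n
  · exact mem_DPlus_of_upper hq₀ (hzn n)
  · exact (antiRefl_mem_DPlus_iff hq₀).2 (mem_DPlus_of_upper hq₀ (hzn n))

theorem xi_injective (hq₀ : 0 < q₀) (hinj : Function.Injective zn)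
    (hzn : ∀ n, 0 < (zn n).im ∧ q₀ < ‖zn n‖) : Function.Injective (xi q₀ zn) := by
  have hne : ∀ n k, zn n ≠ antiRefl q₀ (zn k) := fun n k hnk => by
    have h1 := congrArg norm hnk
    rw [antiRefl_eq, norm_refl, norm_conj, eq_div_iff (hq₀.trans (hzn k).2).ne'] at h1
    nlinarith [(hzn n).2, (hzn k).2]
  rintro (n | n) (k | k) hnk
  · exact congrArg _ (hinj hnk)
  · exact absurd hnk (hne n k)
  · exact absurd hnk.symm (hne k n)
  · have := congrArg (antiRefl q₀) (show antiRefl q₀ (zn n) = antiRefl q₀ (zn k) from hnk)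
    rw [antiRefl_antiRefl hq₀, antiRefl_antiRefl hq₀] at this
    exact congrArg _ (hinj this)

/-- The discrete data at all double zeros of `s₁₁`: `s₁₁ = (z - ξ n)² e n`. -/
theorem IsReflectionlessSolution.exists_data
    (h : IsReflectionlessSolution δ q₀ q qm qp ψm ψp (xi q₀ zn))
    (hdouble : ∀ n, deriv (s11 q₀ ψm ψp) (zn n) = 0 ∧ iteratedDeriv 2 (s11 q₀ ψm ψp) (zn n) ≠ 0) :
    ∃ (e : Fin N ⊕ Fin N → ℂ → ℂ) (b d : Fin N ⊕ Fin N → ℂ),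
      (∀ n, AnalyticAt ℂ (e n) (xi q₀ zn n) ∧ e n (xi q₀ zn n) ≠ 0 ∧
        (s11 q₀ ψm ψp =ᶠ[𝓝 (xi q₀ zn n)] fun z => (z - xi q₀ zn n) ^ 2 * e n z) ∧ b n ≠ 0 ∧
        IsNorming ψm ψp (xi q₀ zn n) (b n) (d n)) ∧
      ∀ n : Fin N, coeffA (s11 q₀ ψm ψp) (xi q₀ zn (Sum.inr n)) (b (Sum.inr n)) =
          q₀ ^ 4 * qm / (conj (zn n) ^ 4 * conj qm) *
            conj (coeffA (s11 q₀ ψm ψp) (xi q₀ zn (Sum.inl n)) (b (Sum.inl n))) ∧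
        coeffB (s11 q₀ ψm ψp) (xi q₀ zn (Sum.inr n)) (b (Sum.inr n)) (d (Sum.inr n)) =
          q₀ ^ 2 / xi q₀ zn (Sum.inr n) ^ 2 *
            conj (coeffB (s11 q₀ ψm ψp) (xi q₀ zn (Sum.inl n)) (b (Sum.inl n)) (d (Sum.inl n)))
            + 2 / xi q₀ zn (Sum.inr n) := by
  have hq' : (q₀ : ℂ) ≠ 0 := by exact_mod_cast h.pos.ne'
  have hqm := conj_ne_zero_of_norm h.pos h.norm_minus
  have hqm0 : qm ≠ 0 := by simpa using hqm
  have hqp0 : qp ≠ 0 := by simpa using conj_ne_zero_of_norm h.pos h.norm_plus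
  have hmem : ∀ n, zn n ∈ DPlus q₀ := fun n => h.mem (Sum.inl n)
  have hzero : ∀ n, s11 q₀ ψm ψp (zn n) = 0 := fun n =>
    (h.zeros _ (Or.inl (hmem n))).2 ⟨Sum.inl n, rfl⟩
  choose e he hs using fun n => exists_eventuallyEq_sq_mul (h.analyticAt_s11 (hmem n)) (hzero n)
    (hdouble n).1
  have he0 : ∀ n, e n (zn n) ≠ 0 := fun n h0 => (hdouble n).2 <| by
    rw [(iteratedDeriv_two_three_of_eventuallyEq (he n) (hs n)).2.2.1, h0, mul_zero]
  choose b d hb hn using fun n => h.exists_norming (hmem n) (hzero n) (hdouble n).1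
  have hr := fun n => h.reflected_zero (hmem n) (he n) (hs n)
  have hz0 : ∀ n, antiRefl q₀ (zn n) ≠ 0 := fun n =>
    IsReflectionlessSolution.ne_zero_of_mem_DPlus (h.mem (Sum.inr n))
  have hval : ∀ n, reflFactor q₀ (qp / qm) (zn n) (e n) (antiRefl q₀ (zn n)) =
      qp / qm * (q₀ ^ 2 / antiRefl q₀ (zn n) ^ 2) ^ 2 * conj (e n (zn n)) := fun n => by
    rw [reflFactor, antiRefl_antiRefl h.pos, ← sq]
  have hval0 : ∀ n, reflFactor q₀ (qp / qm) (zn n) (e n) (antiRefl q₀ (zn n)) ≠ 0 := fun n => by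
    rw [hval]
    refine mul_ne_zero (mul_ne_zero (div_ne_zero hqp0 hqm0) (pow_ne_zero _
      (div_ne_zero (pow_ne_zero _ hq') (pow_ne_zero _ (hz0 n))))) ?_
    simpa using he0 n
  refine ⟨Sum.elim e fun n => reflFactor q₀ (qp / qm) (zn n) (e n),
    Sum.elim b fun n => qp / conj qm * conj (b n),
    Sum.elim d fun n => qp / conj qm * (q₀ ^ 2 / antiRefl q₀ (zn n) ^ 2) * conj (d n), ?_, ?_⟩
  · rintro (n | n)
    · exact ⟨he n, he0 n, hs n, hb n, hn n⟩
    · exact ⟨(hr n).1, hval0 n, (hr n).2,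
        mul_ne_zero (div_ne_zero hqp0 hqm) (by simpa using hb n), h.reflected_norming (hmem n) (hn n)⟩
  · intro n
    have hzn0 := IsReflectionlessSolution.ne_zero_of_mem_DPlus (hmem n)
    have c1 := coeff_of_double_zero (he n) (he0 n) (hs n) (b n) (d n)
    have c2 := coeff_of_double_zero (hr n).1 (hval0 n) (hr n).2 (qp / conj qm * conj (b n))
      (qp / conj qm * (q₀ ^ 2 / antiRefl q₀ (zn n) ^ 2) * conj (d n))
    have x1 : xi q₀ zn (Sum.inl n) = zn n := rfl
    have x2 : xi q₀ zn (Sum.inr n) = antiRefl q₀ (zn n) := rfl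
    have he' : conj (e n (zn n)) ≠ 0 := by simpa using he0 n
    have hb' : conj (b n) ≠ 0 := by simpa using hb n
    have hzc : conj (zn n) ≠ 0 := by simpa using hzn0
    simp only [Sum.elim_inl, Sum.elim_inr, x1, x2]
    rw [c1.2.1, c1.2.2, c2.2.1, c2.2.2, hval,
      (hasDerivAt_reflFactor h.pos (qp / qm) hzn0 (he n).differentiableAt).deriv]
    constructor
    · have : antiRefl q₀ (zn n) = -(q₀ ^ 2 / conj (zn n)) := rfl
      rw [this, map_div₀]
      field_simp
    · have := hz0 n
      rw [map_sub, map_div₀, map_div₀]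
      field_simp
      ring

end SexticNLS

namespace SexticNLS

variable {δ q₀ : ℝ} {q : ℝ → ℝ → ℂ} {qm qp z : ℂ} {ι : Type*} {ξ : ι → ℂ}
  {ψm ψp : ℝ → ℝ → ℂ → Matrix (Fin 2) (Fin 2) ℂ}

/-- On `D⁺` the column `μ₋₂` is the dual of the glued function. -/
theorem IsReflectionlessSolution.minus_two_eq_dual_glued
    (h : IsReflectionlessSolution δ q₀ q qm qp ψm ψp ξ) (x t : ℝ) (hz : z ∈ DPlus q₀) (i : Fin 2) :
    mu δ q₀ ψm x t z i 1 = dual q₀ qm (IsScattering.glued q₀ (s11 q₀ ψm ψp)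
      (fun z => (mu δ q₀ ψm x t z).col 0) (fun z => (mu δ q₀ ψp x t z).col 0) · i) z := by
  rw [h.minus_two_eq x t (Or.inl hz), dual, dual,
    IsScattering.glued_of_mem_closedMinus h.pos (Or.inl ((refl_mem_DMinus_iff h.pos).2 hz))]
  rfl

end SexticNLS

theorem mainTheorem9 (δ q₀ : ℝ) (hq₀ : 0 < q₀) (q : ℝ → ℝ → ℂ) (qm qp : ℂ)
    (hqm : ‖qm‖ = q₀) (hqp : ‖qp‖ = q₀)
    -- `q` is a classical solution with the non-zero boundary values `qm` and `qp`
    (hsmooth : ContDiff ℝ 6 (fun p : ℝ × ℝ => q p.1 p.2))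
    (hsol : SolvesSexticNLS δ q₀ q)
    (hbot : ∀ t : ℝ, Tendsto (fun x => q x t) atBot (𝓝 qm))
    (htop : ∀ t : ℝ, Tendsto (fun x => q x t) atTop (𝓝 qp))
    (hbotInt : ∀ t : ℝ, MeasureTheory.IntegrableOn
      (fun x => (1 + |x|) * ‖q x t - qm‖) (Set.Iic 0))
    (htopInt : ∀ t : ℝ, MeasureTheory.IntegrableOn
      (fun x => (1 + |x|) * ‖q x t - qp‖) (Set.Ici 0))
    (ψm ψp : ℝ → ℝ → ℂ → Matrix (Fin 2) (Fin 2) ℂ)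
    (hJost : IsJostPair δ q₀ q qm qp ψm ψp)
    -- the zeros of `s11` are the `2N` points `xi`, and they are double
    (N : ℕ) (zn : Fin N → ℂ) (hinj : Function.Injective zn)
    (hzn : ∀ n, 0 < (zn n).im ∧ q₀ < ‖zn n‖)
    (hzeros : ∀ z ∈ DPlus q₀ ∪ contour q₀,
      s11 q₀ ψm ψp z = 0 ↔ ∃ n : Fin N ⊕ Fin N, z = xi q₀ zn n)
    (hdouble : ∀ n, deriv (s11 q₀ ψm ψp) (zn n) = 0 ∧ iteratedDeriv 2 (s11 q₀ ψm ψp) (zn n) ≠ 0)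
    -- the potential is reflectionless
    (hG : ∀ x t : ℝ, ∀ z ∈ contour q₀, jumpG δ q₀ ψm ψp x t z = 0) :
    -- the eigenfunctions and `s11` are analytic in `D⁺`, so that the derivatives below exist
    (∀ (x t : ℝ) (i : Fin 2), DifferentiableOn ℂ (fun z => ψp x t z i 0) (DPlus q₀) ∧
      DifferentiableOn ℂ (fun z => ψm x t z i 1) (DPlus q₀)) ∧
    DifferentiableOn ℂ (s11 q₀ ψm ψp) (DPlus q₀) ∧
    (∀ n, iteratedDeriv 2 (s11 q₀ ψm ψp) (xi q₀ zn n) ≠ 0) ∧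
    ∃ b d A B : Fin N ⊕ Fin N → ℂ,
      (∀ n, b n ≠ 0 ∧ IsNorming ψm ψp (xi q₀ zn n) (b n) (d n)) ∧
      (∀ n, A n = coeffA (s11 q₀ ψm ψp) (xi q₀ zn n) (b n)) ∧
      (∀ n, B n = coeffB (s11 q₀ ψm ψp) (xi q₀ zn n) (b n) (d n)) ∧
      -- the constants at `ξ_{N+n}` are determined by those at `ξ_n = z_n`
      (∀ n : Fin N,
        A (Sum.inr n) = q₀ ^ 4 * qm / (conj (zn n) ^ 4 * conj qm) * conj (A (Sum.inl n)) ∧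
        B (Sum.inr n) = q₀ ^ 2 / xi q₀ zn (Sum.inr n) ^ 2 * conj (B (Sum.inl n))
          + 2 / xi q₀ zn (Sum.inr n)) ∧
      ∀ x t : ℝ,
        -- the linear system, its unique solvability, and Cramer's rule
        (sysM δ q₀ qm zn A B x t).mulVec (sysX δ q₀ zn ψm x t) = sysV q₀ qm zn ∧
        (sysM δ q₀ qm zn A B x t).det ≠ 0 ∧
        (∀ j, sysX δ q₀ zn ψm x t j = cramerX δ q₀ qm zn A B x t j) ∧
        -- the potential
        q x t = reconstruct δ q₀ qm zn A B x t (sysX δ q₀ zn ψm x t) ∧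
        q x t = reconstruct δ q₀ qm zn A B x t (cramerX δ q₀ qm zn A B x t) := by
  have h : IsReflectionlessSolution δ q₀ q qm qp ψm ψp (xi q₀ zn) :=
    ⟨hq₀, hqm, hqp, hsmooth, hbotInt, htopInt, hJost, xi_injective hq₀ hinj hzn,
      xi_mem_DPlus hq₀ hzn, hzeros, hG⟩
  obtain ⟨e, b, d, hebd, hsym⟩ := h.exists_data hdouble
  have hcoeff := fun n => coeff_of_double_zero (hebd n).1 (hebd n).2.1 (hebd n).2.2.1 (b n) (d n)
  refine ⟨fun x t i =>
      ⟨fun z hz => (h.differentiableAt_plus x t hz i).differentiableWithinAt,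
        fun z hz => (h.differentiableAt_minus x t hz i).differentiableWithinAt⟩,
    fun z hz => ((h.isScattering 0 0).coeff_differentiableAt hz).differentiableWithinAt,
    fun n => (hcoeff n).1, b, d, fun n => coeffA (s11 q₀ ψm ψp) (xi q₀ zn n) (b n),
    fun n => coeffB (s11 q₀ ψm ψp) (xi q₀ zn n) (b n) (d n), fun n => (hebd n).2.2.2,
    fun n => rfl, fun n => rfl, hsym, fun x t => ?_⟩
  refine ((h.isScattering x t).isReflectionless (fun n i => ?_)).reconstruction ?_
  · obtain ⟨he, he0, hs, hb, hn⟩ := hebd n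
    simp only [residueFactor, coeffD, (hcoeff n).2.1, (hcoeff n).2.2]
    exact h.tendsto_principal (h.mem n) he he0 hs hb hn x t i
  · refine congrArg₂ Sum.elim (funext fun n => h.minus_two_eq_dual_glued x t (h.mem n) 1)
      (funext fun n => Filter.EventuallyEq.deriv_eq ?_)
    filter_upwards [(isOpen_DPlus q₀).mem_nhds (h.mem n)] with z hz
    exact h.minus_two_eq_dual_glued x t hz 1
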